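/- **Layered graphs.** Let $T=(t_0,\dots,t_k)$ be a sequence of positive integers. A $T$-layered graph has layers $V_0,\dots,V_k$ with $V_i=[t_i]$ and edge sets $E_1,\dots,E_k$, where $E_i$ is a matching of size $\min(t_{i-1},t_i)$ between $V_{i-1}$ and $V_i$. For $i\le i'$ let $G_{i\to i'}$ be the partial injection from $V_i$ to $V_{i'}$ that follows the edges. $G$ is *nice* if for all $i<i'$ exactly $\min_{i\le j\le i'}t_j$ vertices of $V_i$ are connected to $V_{i'}$. **Nested block graphs.** Let $c\ge 1$ and let $S=(s_1,\dots,s_k)$ be a strictly increasing sequence of positive integers. Put $\mathsf{nest}(c,(s_1))=(s_1,s_1)$, and for $|S|>1$ let $\mathsf{nest}(c,S)$ be obtained from $\mathsf{nest}(c,(s_1,\dots,s_{k-1}))$ by inserting $2c-1$ copies of $s_k$ between any two consecutive entries; it has $\ell+1$ entries, $\ell=(2c)^{|S|-1}$, and its first and last entries are $s_1$. For $0<s\le s_1$ an *$(s,c,S)$-almost nested block graph* is a nice $T$-layered graph, where $T$ is $\mathsf{nest}(c,S)$ with either its first entry (left version) or its last entry (right version) replaced by $s$. For an injection $\mathsf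 Z:[s]\to[s_1]$, $\mathcal D^{\mathsf Z}_{s,c,S}$ is the uniform distribution over the $(s,c,S)$-almost nested block graphs $G$ (of a given version) in which every vertex $u$ of the end layer of size $s$ is connected to the vertex $\mathsf Z(u)$ of the other end layer (in the left version: $G_{0\to\ell}=\mathsf Z$). **Protocols.** In an $r$-round $(s,c,S)$-protocol ($r\ge 0$, left or right version) the input is a $T$-layered graph with $T$ as above; Alice gets the $E_i$ with $i$ even, Bob those with $i$ odd. Alice sends a message in odd rounds and Bob in even rounds, bit by bit as in a standard protocol tree; after $r$ rounds Alice (if $r$ is even) or Bob (if $r$ is odd) computes an output, in an arbitrary set, from its input and the transcript. A randomized protocol $\Pi$ is a probability distribution over deterministic protocols, and $\|\Pi\|$ is the worst-case number of bits communicated over all inputs and coins. $\Pi(G)$ denotes the output, and $\|\mu-\nu\|_{\mathrm{tvd}}=\frac12\sum_x|\mu(x)-\nu(x)|$. **Lemma 3.3.** Let $S=(s_1,s_2,\dots)$ be a strictly increasing finite sequence of positive integers with $|S|\ge 2$, let $c,C>0$ be integers and $\epsilon_0>0$. Write $S_{\ge 2}=(s_2,\dots,s_{|S|})$. Assume that for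 both versions (left and right), all $0<s\le s_2$, all injections $\mathsf Y',\mathsf N':[s]\to[s_2]$ and all randomized $(|S|-2)$-round $(s,c,S_{\ge 2})$-protocols $\Pi'$ with $\|\Pi'\|\le C$, $$\left\|\Pi'(G')_{G'\sim\mathcal D^{\mathsf Y'}_{s,c,S_{\ge2}}}-\Pi'(G')_{G'\sim\mathcal D^{\mathsf N'}_{s,c,S_{\ge2}}}\right\|_{\mathrm{tvd}}\le\epsilon_0 .$$ Then for both versions, all $0<s\le s_1$, all injections $\mathsf Y,\mathsf N:[s]\to[s_1]$ and all randomized $(|S|-1)$-round $(s,c,S)$-protocols $\Pi$ with $\|\Pi\|\le C$, $$\left\|\Pi(G)_{G\sim\mathcal D^{\mathsf Y}_{s,c,S}}-\Pi(G)_{G\sim\mathcal D^{\mathsf N}_{s,c,S}}\right\|_{\mathrm{tvd}}\le 2c\,\epsilon_0+\Phi(s,c,s_2,C),\qquad \Phi(s,c,s_2,C)=2s_2^2\left(\frac{40C}{s_2-s}\right)^{c/6}.$$ -/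

import Mathlib

noncomputable section

namespace FinalMatching

/-! ### Layered graphs

A sequence `T = t₀, …, t_k` is given by its length parameter `k` and a function `t : ℕ → ℕ` of which
only the values at `0, …, k` matter. The `i`-th layer is `Fin (t i)`. -/

/-- A matching of size `min a b` between `Fin a` and `Fin b`, as a partial bijection. -/
abbrev Matching (a b : ℕ) : Type :=
  {M : Fin a ≃. Fin b // {v : Fin a | (M v).isSome}.ncard = min a b}

/-- A `T`-layered graph: the entry at `i : Fin k` is the edge set `E_{i+1}`, which joins
layer `i` to layer `i + 1`. -/
abbrev LayeredGraph (k : ℕ) (t : ℕ → ℕ) : Type :=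
  (i : Fin k) → Matching (t i) (t (i + 1))

/-- The partial map `G_{i → i + d}` from layer `i` to layer `i + d`. -/
def LayeredGraph.path {k : ℕ} {t : ℕ → ℕ} (G : LayeredGraph k t) (i : ℕ) :
    (d : ℕ) → i + d ≤ k → (Fin (t i) ≃. Fin (t (i + d)))
  | 0, _ => PEquiv.refl _
  | d + 1, h => (G.path i d (by omega)).trans (G ⟨i + d, by omega⟩).1

/-- A layered graph is nice if between any two layers as many vertices as possible are connected. -/
def LayeredGraph.Nice {k : ℕ} {t : ℕ → ℕ} (G : LayeredGraph k t) : Prop :=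
  ∀ (i d : ℕ) (h : i + d ≤ k),
    {v : Fin (t i) | (G.path i d h v).isSome}.ncard =
      (Finset.Icc i (i + d)).inf' ⟨i, by simp⟩ t

/-- Vertex number `a` of the first layer is connected to vertex number `b` of the last layer. -/
def LayeredGraph.Joins {k : ℕ} {t : ℕ → ℕ} (G : LayeredGraph k t) (a b : ℕ) : Prop :=
  ∃ (v : Fin (t 0)) (w : Fin (t (0 + k))),
    v.val = a ∧ w.val = b ∧ G.path 0 k (by omega) v = some w

/-! ### Nested block graphs

A sequence `S = s₁, …, s_{n+1}` is a function `S : Fin (n + 1) → ℕ`, so `s₁ = S 0`;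
`Fin.init S` drops the last entry and `Fin.tail S` the first one. -/

/-- `c` copies of `s` are put between any two consecutive entries of `t`. -/
def plug (t : ℕ → ℕ) (c s : ℕ) : ℕ → ℕ :=
  fun i => if (c + 1) ∣ i then t (i / (c + 1)) else s

/-- The sequence `nest(c, S)`; its last index is `nestLen c n`. -/
def nest (c : ℕ) : {n : ℕ} → (Fin (n + 1) → ℕ) → ℕ → ℕ
  | 0, S => fun _ => S 0
  | _ + 1, S => plug (nest c (Fin.init S)) (2 * c - 1) (S (Fin.last _))

/-- The number of edge layers of `nest(c, S)` when `|S| = n + 1`. -/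
def nestLen (c n : ℕ) : ℕ := (2 * c) ^ n

/-- Which end of an almost nested block graph has the modified size. -/
inductive Side
  | left
  | right

/-- `nest_l(s, c, S)` and `nest_r(s, c, S)`: the first, respectively the last, entry
of `nest(c, S)` is replaced by `s`. -/
def almostNest (side : Side) (s c : ℕ) {n : ℕ} (S : Fin (n + 1) → ℕ) (i : ℕ) : ℕ :=
  match side with
  | .left => if i = 0 then s else nest c S i
  | .right => if i = nestLen c n then s else nest c S i

/-- Layered graphs with the layer sizes of an `(s, c, S)`-almost nested block graph. -/
abbrev BlockGraph (side : Side) (s c : ℕ) {n : ℕ} (S : Fin (n + 1) → ℕ) : Type :=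
  LayeredGraph (nestLen c n) (almostNest side s c S)

/-- The end-to-end matching of `G` is `Z`, where `Z` maps the (smaller) modified end layer into
the other end layer. As `Z` covers the modified layer, this determines the matching completely. -/
def FinalIs {side : Side} {s c n : ℕ} {S : Fin (n + 1) → ℕ} (G : BlockGraph side s c S)
    (Z : Fin s ↪ Fin (S 0)) : Prop :=
  match side with
  | .left => ∀ u : Fin s, LayeredGraph.Joins G u.val (Z u).val
  | .right => ∀ u : Fin s, LayeredGraph.Joins G (Z u).val u.val

/-- The `(s, c, S)`-almost nested block graphs with end-to-end matching `Z`. -/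
def blockGraphs (side : Side) (s c : ℕ) {n : ℕ} (S : Fin (n + 1) → ℕ) (Z : Fin s ↪ Fin (S 0)) :
    Set (BlockGraph side s c S) :=
  {G | LayeredGraph.Nice G ∧ FinalIs G Z}

/-! ### Communication protocols -/

inductive Player
  | alice
  | bob

def Player.other : Player → Player
  | .alice => .bob
  | .bob => .alice

/-- The owner of the edge set `E_i`: Alice if `i` is even, Bob if `i` is odd. -/
def owner (i : ℕ) : Player := if Even i then .alice else .bob

/-- The input of a player: the edge sets that the player owns. -/
abbrev View (k : ℕ) (t : ℕ → ℕ) (p : Player) : Type :=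
  (i : {i : Fin k // owner (i + 1) = p}) → Matching (t i.1) (t (i.1 + 1))

/-- The inputs of the two players on a layered graph. -/
def LayeredGraph.views {k : ℕ} {t : ℕ → ℕ} (G : LayeredGraph k t) (p : Player) : View k t p :=
  fun i => G i.1

/-- Deterministic two-party protocol trees. `Protocol In O p r` is the type of protocols in which
player `p` has the turn and `r` rounds remain (including the one in progress). The player who has
the turn sends bits one by one and then ends the round; when no round remains, the player
who would have the turn computes the output from its input. -/
inductive Protocol (In : Player → Type) (O : Type) : Player → ℕ → Type
  | output {p : Player} (f : In p → O) : Protocol In O p 0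
  | send {p : Player} {r : ℕ} (f : In p → Bool) (next : Bool → Protocol In O p (r + 1)) :
      Protocol In O p (r + 1)
  | endRound {p : Player} {r : ℕ} (next : Protocol In O p.other r) : Protocol In O p (r + 1)

/-- The output of a protocol on given inputs. -/
def Protocol.run {In : Player → Type} {O : Type} (x : (p : Player) → In p) :
    {p : Player} → {r : ℕ} → Protocol In O p r → O
  | p, _, .output f => f (x p)
  | p, _, .send f next => (next (f (x p))).run x
  | _, _, .endRound next => next.run x

/-- The number of bits communicated on given inputs. -/
def Protocol.bits {In : Player → Type} {O : Type} (x : (p : Player) → In p) :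
    {p : Player} → {r : ℕ} → Protocol In O p r → ℕ
  | _, _, .output _ => 0
  | p, _, .send f next => (next (f (x p))).bits x + 1
  | _, _, .endRound next => next.bits x

/-- A deterministic `r`-round `(s, c, S)`-protocol with outputs in `O`; Alice speaks first. -/
abbrev BlockProtocol (side : Side) (s c : ℕ) {n : ℕ} (S : Fin (n + 1) → ℕ) (O : Type) (r : ℕ) :
    Type :=
  Protocol (View (nestLen c n) (almostNest side s c S)) O .alice r

/-- A randomized protocol is a distribution over deterministic protocols. -/
abbrev RandProtocol (side : Side) (s c : ℕ) {n : ℕ} (S : Fin (n + 1) → ℕ) (O : Type) (r : ℕ) :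
    Type :=
  PMF (BlockProtocol side s c S O r)

/-- The communication cost (worst case over inputs and coins) is at most `C`. -/
def CostAtMost {side : Side} {s c n : ℕ} {S : Fin (n + 1) → ℕ} {O : Type} {r : ℕ}
    (P : RandProtocol side s c S O r) (C : ℕ) : Prop :=
  ∀ π ∈ P.support, ∀ G : BlockGraph side s c S, Protocol.bits (LayeredGraph.views G) π ≤ C

/-- The probability that `P` outputs `o` on a uniformly random `(s, c, S)`-almost nested block
graph with end-to-end matching `Z`. -/
def outputProb {side : Side} {s c n : ℕ} {S : Fin (n + 1) → ℕ} {O : Type} {r : ℕ}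
    (P : RandProtocol side s c S O r) (Z : Fin s ↪ Fin (S 0)) (o : O) : ℝ :=
  ∑' π : BlockProtocol side s c S O r, (P π).toReal *
    ({G ∈ blockGraphs side s c S Z | Protocol.run (LayeredGraph.views G) π = o}.ncard /
      (blockGraphs side s c S Z).ncard : ℝ)

/-- Total variation distance of two discrete distributions. -/
def tvd {O : Type} (μ ν : O → ℝ) : ℝ := (1 / 2) * ∑' o, |μ o - ν o|

/-- `Φ(s, c, s₂, C) = 2 s₂² (40 C / (s₂ - s))^{c/6}`. -/
def Phi (s c s₂ C : ℕ) : ℝ :=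
  2 * (s₂ : ℝ) ^ 2 * (40 * (C : ℝ) / ((s₂ : ℝ) - (s : ℝ))) ^ ((c : ℝ) / 6)

end FinalMatching

end

open FinalMatching

/-! ### Second moments of chains of random permutations -/

section PermutationChains

open Finset BigOperators

/-! Put N = s₂. Away from its ends, a graph of type nest(c, S) is a row of blocks of type nest(c,
S_{≥2}). Each of them begins and ends in a layer of size N and, being nice, carries a permutation of
[N]. About c consecutive blocks are kept, 2k+1 in number, and everything outside them is fixed. The
fixed part translates the end-to-end matching into a condition on the block permutations: the chain
a_k b_{k-1} ⋯ b_0 a_0 sends s given points to s given points. All fibres over permutations have the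
same size, so the graph is a uniform tuple of permutations subject to this condition, followed by
independent uniform blocks in the fibres (`sum_joined`). It remains to compare two such conditions.

Let p be the speaker of the last round and q the player who computes the output. Let W consist of
the transcript before the last round, p's view of the even blocks and q's view of the odd blocks. A
protocol with one round less, run on a single block, can compute any function of W
(`abs_expect_state_even_le`, `abs_expect_state_odd_le`). By the hypothesis and a hybrid argument
over the blocks, the law of W hardly depends on the permutations. Given W, the last message is a
function of the odd blocks and the output is a function of the message and the even blocks. The
level sets of W are rectangles, so this product structure survives conditioning. Hence W may be
drawn from a fixed reference law, and what is left is a one-way problem: a C-bit message about the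
b_i goes to a player who knows the a_i (`decoupling_bound`).

In that problem the deviation of a message from being uninformative is a sum over b of terms
N·1[chain sends x to y] − 1. Its mean square over the uniform a_i involves only covariances for
pairs b, b', and by Schur's lemma such a covariance is (N−1) times the product of the normalized
characters of the standard representation at b_i⁻¹ b'_i (`expect_chain_covariance`). The product is
tiny unless b and b' agree at many points in total, which is exponentially unlikely
(`expect_agree_tail`). Cauchy–Schwarz settles one prescribed point (`chain_single_point_bound`).
Several points are handled one at a time: given the image of one point, the chain is again a uniform
chain on the remaining points (`chain_bound`).

Each of the two conditions is compared with the unconditioned chain, which costs Φ for each, and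
decoupling costs 2(2k+1)·2ε₀. Passing from test functions with values in [−1, 1] to total variation
halves the sum. -/

theorem expect_pi_succ {X : Type*} [Fintype X] {k : ℕ} (F : (Fin (k + 1) → X) → ℝ) :
    𝔼 a, F a = 𝔼 x, 𝔼 a' : Fin k → X, F (Fin.cons x a') := by
  rw [← Finset.expect_product' univ univ (fun x a' => F (Fin.cons x a'))]
  refine (Fintype.expect_equiv (Fin.consEquiv fun _ => X) _ _ fun i => ?_).symm
  rfl

theorem expect_perm_apply {α : Type*} [Fintype α] [DecidableEq α] (F : α → ℝ) (z : α) :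
    𝔼 σ : Equiv.Perm α, F (σ z) = 𝔼 v, F v := by
  have : Nonempty α := ⟨z⟩
  have h : ∀ z', 𝔼 σ : Equiv.Perm α, F (σ z') = 𝔼 σ : Equiv.Perm α, F (σ z) := by
    intro z'
    refine Fintype.expect_equiv (Equiv.mulRight (Equiv.swap z z')) _ _ fun σ => ?_
    simp
  calc 𝔼 σ : Equiv.Perm α, F (σ z) = 𝔼 _z' : α, 𝔼 σ : Equiv.Perm α, F (σ z) := by
        rw [Fintype.expect_const]
    _ = 𝔼 z' : α, 𝔼 σ : Equiv.Perm α, F (σ z') := by simp_rw [h]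
    _ = 𝔼 σ : Equiv.Perm α, 𝔼 z' : α, F (σ z') := expect_comm _ _ _
    _ = 𝔼 _σ : Equiv.Perm α, 𝔼 v, F v :=
        expect_congr rfl fun σ _ => Fintype.expect_equiv σ _ _ fun _ => rfl
    _ = _ := Fintype.expect_const _

/-- The number of points at which two permutations agree. -/
def agree {α : Type*} [Fintype α] [DecidableEq α] (M M' : Equiv.Perm α) : ℕ :=
  #{v | M v = M' v}

/-- The normalized character of the standard representation at `M⁻¹ * M'`. -/
noncomputable def stdChar {α : Type*} [Fintype α] [DecidableEq α] (M M' : Equiv.Perm α) : ℝ :=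
  ((agree M M' : ℝ) - 1) / ((Fintype.card α : ℝ) - 1)

/-- Schur's lemma for the standard representation: averaging `M⁻¹ * M'` over conjugates gives a
scalar there, namely the normalized character. By hand: the collision probability is `agree M M' /
n` for `z = z'`, is constant over all `z' ≠ z` by symmetry, and sums to 1 over `z'`. -/
theorem expect_perm_collision {α : Type*} [Fintype α] [DecidableEq α]
    (hα : 2 ≤ Fintype.card α) (M M' : Equiv.Perm α) (z z' : α) :
    𝔼 σ : Equiv.Perm α, ((Fintype.card α : ℝ) * (if M (σ z) = M' (σ z') then 1 else 0) - 1) =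
      stdChar M M' * ((Fintype.card α : ℝ) * (if z = z' then 1 else 0) - 1) := by
  have : Nonempty α := ⟨z⟩
  have hn : (2 : ℝ) ≤ Fintype.card α := by exact_mod_cast hα
  set n : ℝ := (Fintype.card α : ℝ) with hndef
  have hdiag : ∀ z, 𝔼 σ : Equiv.Perm α, (if M (σ z) = M' (σ z) then (1 : ℝ) else 0) =
      agree M M' / n := by
    intro z
    rw [expect_perm_apply (fun v => if M v = M' v then (1 : ℝ) else 0),
      Fintype.expect_eq_sum_div_card]
    simp [agree, hndef]
  rw [expect_sub_distrib, Fintype.expect_const, ← mul_expect]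
  by_cases hz : z = z'
  · subst hz
    rw [hdiag, stdChar, ← hndef]
    simp only [if_true]
    field_simp
    rw [mul_div_cancel_right₀ _ (by linarith)]
  · set q := fun w => 𝔼 σ : Equiv.Perm α, (if M (σ z) = M' (σ w) then (1 : ℝ) else 0) with hq
    have hsym : ∀ w, w ≠ z → q w = q z' := by
      intro w hw
      refine Fintype.expect_equiv (Equiv.mulRight (Equiv.swap w z')) _ _ fun σ => ?_
      simp [Equiv.swap_apply_of_ne_of_ne (Ne.symm hw) hz]
    have hsum : ∑ w, q w = 1 := by
      simp only [hq]
      rw [← expect_sum_comm]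
      have : ∀ σ : Equiv.Perm α, ∑ w, (if M (σ z) = M' (σ w) then (1 : ℝ) else 0) = 1 := by
        intro σ
        rw [Finset.sum_eq_single (σ⁻¹ (M'⁻¹ (M (σ z))))]
        · simp
        · intro b _ hb
          rw [if_neg]
          intro h
          apply hb
          rw [h]; simp
        · simp
      simp_rw [this]
      exact Fintype.expect_const _
    have h2 : ∑ w, q w = q z + (n - 1) * q z' := by
      rw [← Finset.add_sum_erase univ q (mem_univ z)]
      congr 1
      rw [Finset.sum_congr rfl fun w hw => hsym w (Finset.ne_of_mem_erase hw)]
      rw [Finset.sum_const, Finset.card_erase_of_mem (mem_univ z), nsmul_eq_mul, Finset.card_univ,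
        Nat.cast_sub (by omega)]
      simp [hndef]
    have h3 : q z = agree M M' / n := hdiag z
    rw [hsum, h3] at h2
    change n * q z' - 1 = _
    rw [if_neg hz, stdChar, ← hndef]
    have hn1 : n - 1 ≠ 0 := by linarith
    have h4 : q z' = (1 - agree M M' / n) / (n - 1) := by
      rw [eq_div_iff hn1]; linarith
    rw [h4]
    have hn0 : n ≠ 0 := by linarith
    field_simp
    ring

/-- The composition `a k ∘ b (k - 1) ∘ ⋯ ∘ b 0 ∘ a 0`. -/
def chain {α : Type*} : (k : ℕ) → (Fin (k + 1) → Equiv.Perm α) → (Fin k → Equiv.Perm α) →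
    Equiv.Perm α
  | 0, a, _ => a 0
  | k + 1, a, b => chain k (Fin.tail a) (Fin.tail b) * (b 0 * a 0)

/-- Each uniform factor, averaged together with the fixed factor after it, multiplies the centred
collision indicator by one character. The last uniform factor makes the common image uniform, whence
the division by the square of the cardinality. -/
theorem expect_chain_collision {α : Type*} [Fintype α] [DecidableEq α]
    (hα : 2 ≤ Fintype.card α) (y : α) : ∀ (k : ℕ) (b b' : Fin k → Equiv.Perm α) (z z' : α),
    𝔼 a, (if chain k a b z = y then (1 : ℝ) else 0) * (if chain k a b' z' = y then 1 else 0) =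
      (1 + ((Fintype.card α : ℝ) * (if z = z' then 1 else 0) - 1) *
        ∏ i, stdChar (b i) (b' i)) / (Fintype.card α : ℝ) ^ 2 := by
  have hn : (2 : ℝ) ≤ Fintype.card α := by exact_mod_cast hα
  intro k
  induction k with
  | zero =>
    intro b b' z z'
    have : Nonempty α := ⟨z⟩
    rw [expect_pi_succ]
    simp only [chain, Fin.cons_zero, Fintype.expect_const]
    by_cases hz : z = z'
    · subst hz
      have h1 : ∀ σ : Equiv.Perm α, (if σ z = y then (1 : ℝ) else 0) * (if σ z = y then 1 else 0) =
        if σ z = y then (1 : ℝ) else 0 := by intro σ; split_ifs <;> simp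
      simp_rw [h1]
      rw [expect_perm_apply (fun v => if v = y then (1 : ℝ) else 0),
        Fintype.expect_eq_sum_div_card]
      simp
      field_simp
    · have h1 : ∀ σ : Equiv.Perm α,
          (if σ z = y then (1 : ℝ) else 0) * (if σ z' = y then 1 else 0) = 0 := by
        intro σ
        split_ifs with h h' <;> simp
        exact hz (σ.injective (h.trans h'.symm))
      simp_rw [h1]
      simp [hz]
  | succ k ih =>
    intro b b' z z'
    have : Nonempty α := ⟨z⟩
    rw [expect_pi_succ]
    simp only [chain, Fin.cons_zero, Fin.tail_cons, Equiv.Perm.mul_apply]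
    simp_rw [ih, ← expect_div]
    congr 1
    rw [expect_add_distrib, Fintype.expect_const, ← expect_mul, expect_perm_collision hα,
      Fin.prod_univ_succ]
    simp only [Fin.tail]
    ring

theorem stdChar_self {α : Type*} [Fintype α] [DecidableEq α] (hα : 2 ≤ Fintype.card α)
    (M : Equiv.Perm α) : stdChar M M = 1 := by
  have hn : (2 : ℝ) ≤ Fintype.card α := by exact_mod_cast hα
  simp only [stdChar, agree, Finset.filter_true, Finset.card_univ]
  exact div_self (by linarith)

theorem expect_chain_apply {α : Type*} [Fintype α] [DecidableEq α]
    (hα : 2 ≤ Fintype.card α) (y : α) (k : ℕ) (b : Fin k → Equiv.Perm α) (z : α) :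
    𝔼 a, (if chain k a b z = y then (1 : ℝ) else 0) = 1 / Fintype.card α := by
  have hn : (2 : ℝ) ≤ Fintype.card α := by exact_mod_cast hα
  have h := expect_chain_collision hα y k b b z z
  simp only [stdChar_self hα, prod_const_one, if_true, mul_one] at h
  have h1 : ∀ a : Fin (k + 1) → Equiv.Perm α, (if chain k a b z = y then (1 : ℝ) else 0) *
    (if chain k a b z = y then 1 else 0) = if chain k a b z = y then (1 : ℝ) else 0 := by
    intro σ; split_ifs <;> simp
  simp_rw [h1] at h
  rw [h]
  field_simp
  ring

/-- The covariance of two chains that share the factors `a`. -/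
theorem expect_chain_covariance {α : Type*} [Fintype α] [DecidableEq α]
    (hα : 2 ≤ Fintype.card α) (x y : α) (k : ℕ) (b b' : Fin k → Equiv.Perm α) :
    𝔼 a, ((Fintype.card α : ℝ) * (if chain k a b x = y then 1 else 0) - 1) *
        ((Fintype.card α : ℝ) * (if chain k a b' x = y then 1 else 0) - 1) =
      ((Fintype.card α : ℝ) - 1) * ∏ i, stdChar (b i) (b' i) := by
  have : Nonempty α := ⟨x⟩
  have hn : (2 : ℝ) ≤ Fintype.card α := by exact_mod_cast hα
  set n : ℝ := (Fintype.card α : ℝ) with hndef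
  have h : ∀ a : Fin (k + 1) → Equiv.Perm α,
      (n * (if chain k a b x = y then 1 else 0) - 1) *
        (n * (if chain k a b' x = y then 1 else 0) - 1) =
      n ^ 2 * ((if chain k a b x = y then (1 : ℝ) else 0) * (if chain k a b' x = y then 1 else 0))
      - n * (if chain k a b x = y then (1 : ℝ) else 0)
      - n * (if chain k a b' x = y then (1 : ℝ) else 0) + 1 := by intro a; ring
  simp_rw [h]
  rw [expect_add_distrib, expect_sub_distrib, expect_sub_distrib, ← mul_expect, ← mul_expect,
    ← mul_expect, expect_chain_collision hα, expect_chain_apply hα, expect_chain_apply hα,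
    Fintype.expect_const, ← hndef]
  simp
  field_simp
  ring

/-! ### One prescribed point: Cauchy–Schwarz over the messages -/

theorem sq_expect_le {ι : Type*} [Fintype ι] [Nonempty ι] (f : ι → ℝ) :
    (𝔼 i, f i) ^ 2 ≤ 𝔼 i, f i ^ 2 := by
  have := Finset.expect_mul_sq_le_sq_mul_sq univ f (fun _ => (1 : ℝ))
  simpa using this

theorem sqrt_add_le_add_sqrt {a b : ℝ} (ha : 0 ≤ a) (hb : 0 ≤ b) : √(a + b) ≤ √a + √b := by
  refine Real.sqrt_le_iff.2 ⟨by positivity, ?_⟩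
  have h : 0 ≤ √a * √b := by positivity
  nlinarith [Real.sq_sqrt ha, Real.sq_sqrt hb]

theorem expect_le_sqrt {ι : Type*} [Fintype ι] [Nonempty ι] (f : ι → ℝ) :
    𝔼 i, f i ≤ √(𝔼 i, f i ^ 2) :=
  Real.le_sqrt_of_sq_le (sq_expect_le f)

/-- A message about the factors `b` says little about the image of one point under a chain whose
other factors are uniformly random. -/
theorem chain_single_point_bound {α Msg : Type*} [Fintype α] [DecidableEq α] [Fintype Msg]
    (hα : 2 ≤ Fintype.card α) (x y : α) (k : ℕ)
    (Bad : (Fin k → Equiv.Perm α) → (Fin k → Equiv.Perm α) → Prop)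
    [∀ b b', Decidable (Bad b b')] (Λ ρ : ℝ) (hΛ : 0 ≤ Λ) (hρ : 0 ≤ ρ)
    (hgood : ∀ b b', ¬ Bad b b' → ∏ i, stdChar (b i) (b' i) ≤ Λ)
    (hone : ∀ b b' : Fin k → Equiv.Perm α, ∏ i, stdChar (b i) (b' i) ≤ 1)
    (hbad : ∀ b, 𝔼 b', (if Bad b b' then (1 : ℝ) else 0) ≤ ρ)
    (κ : Msg → (Fin k → Equiv.Perm α) → ℝ) (hκ : ∀ m b, 0 ≤ κ m b) (hκ1 : ∀ b, ∑ m, κ m b ≤ 1)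
    (η : Msg → (Fin (k + 1) → Equiv.Perm α) → ℝ) (hη : ∀ m a, |η m a| ≤ 1) :
    |𝔼 a, 𝔼 b, ((Fintype.card α : ℝ) * (if chain k a b x = y then 1 else 0) - 1) *
        ∑ m, κ m b * η m a| ≤
      √((Fintype.card α : ℝ) - 1) * (√Λ + √((Fintype.card Msg : ℝ) * ρ)) := by
  have hn : (2 : ℝ) ≤ Fintype.card α := by exact_mod_cast hα
  set n : ℝ := (Fintype.card α : ℝ) with hndef
  set D : (Fin (k + 1) → Equiv.Perm α) → (Fin k → Equiv.Perm α) → ℝ :=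
    fun a b => n * (if chain k a b x = y then 1 else 0) - 1 with hD
  set p : Msg → ℝ := fun m => 𝔼 b, κ m b with hp
  have hp0 : ∀ m, 0 ≤ p m := fun m => expect_nonneg fun b _ => hκ m b
  have hp1 : ∑ m, p m ≤ 1 := by
    simp only [hp]
    rw [← expect_sum_comm]
    exact expect_le univ_nonempty fun b _ => hκ1 b
  have hm : ∀ m, 𝔼 a, |𝔼 b, κ m b * D a b| ≤ √(n - 1) * (p m * √Λ + √(p m) * √ρ) := by
    intro m
    -- Opening the square introduces an independent copy `b'`. Only then is the mean over `a` taken,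
    -- and it produces the characters.
    have h1 : 𝔼 a, |𝔼 b, κ m b * D a b| ^ 2 =
        (n - 1) * 𝔼 b, 𝔼 b', κ m b * κ m b' * ∏ i, stdChar (b i) (b' i) := by
      have : ∀ a, |𝔼 b, κ m b * D a b| ^ 2 =
          𝔼 b, 𝔼 b', κ m b * κ m b' * (D a b * D a b') := by
        intro a
        rw [sq_abs, sq, Fintype.expect_mul_expect]
        exact expect_congr rfl fun b _ => expect_congr rfl fun b' _ => by ring
      simp_rw [this]
      rw [expect_comm]
      rw [mul_expect]
      refine expect_congr rfl fun b _ => ?_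
      rw [expect_comm, mul_expect]
      refine expect_congr rfl fun b' _ => ?_
      rw [← mul_expect]
      simp only [hD]
      rw [expect_chain_covariance hα]
      ring
    have h2 : 𝔼 b, 𝔼 b', κ m b * κ m b' * ∏ i, stdChar (b i) (b' i) ≤ p m ^ 2 * Λ + p m * ρ := by
      calc 𝔼 b, 𝔼 b', κ m b * κ m b' * ∏ i, stdChar (b i) (b' i)
          ≤ 𝔼 b, 𝔼 b', (κ m b * κ m b' * Λ + κ m b * (if Bad b b' then (1 : ℝ) else 0)) := by
            refine expect_le_expect fun b _ => expect_le_expect fun b' _ => ?_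
            have hle : κ m b' ≤ 1 :=
              (single_le_sum (fun m _ => hκ m b') (mem_univ m)).trans (hκ1 b')
            have hb := hκ m b
            have hb' := hκ m b'
            by_cases h : Bad b b'
            -- On bad pairs only the factor `κ m b'` is bounded by 1. Keeping `κ m b` gives `p m *
            -- ρ`, linear in `p m`, so that the sum over the messages costs √|Msg| rather than
            -- |Msg|.
            · rw [if_pos h]
              have e1 := hone b b'
              have e2 : κ m b * κ m b' * ∏ i, stdChar (b i) (b' i) ≤ κ m b * κ m b' * 1 :=
                mul_le_mul_of_nonneg_left e1 (by positivity)
              have e3 : κ m b * κ m b' ≤ κ m b * 1 := mul_le_mul_of_nonneg_left hle hb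
              have e4 : 0 ≤ κ m b * κ m b' * Λ := by positivity
              linarith
            · rw [if_neg h]
              have := mul_le_mul_of_nonneg_left (hgood b b' h) (mul_nonneg hb hb')
              linarith
        _ = p m ^ 2 * Λ + 𝔼 b, κ m b * 𝔼 b', (if Bad b b' then (1 : ℝ) else 0) := by
            simp_rw [expect_add_distrib, ← mul_expect, ← expect_mul]
            simp only [hp]
            rw [sq, Fintype.expect_mul_expect]
        _ ≤ p m ^ 2 * Λ + 𝔼 b, κ m b * ρ := by
            gcongr with b _
            · exact hκ m b
            · exact hbad b
        _ = _ := by rw [← expect_mul]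
    calc 𝔼 a, |𝔼 b, κ m b * D a b| ≤ √(𝔼 a, |𝔼 b, κ m b * D a b| ^ 2) := expect_le_sqrt _
      _ ≤ √((n - 1) * (p m ^ 2 * Λ + p m * ρ)) := by
          rw [h1]
          exact Real.sqrt_le_sqrt (mul_le_mul_of_nonneg_left h2 (by linarith))
      _ = √(n - 1) * √(p m ^ 2 * Λ + p m * ρ) := Real.sqrt_mul (by linarith) _
      _ ≤ √(n - 1) * (√(p m ^ 2 * Λ) + √(p m * ρ)) := by
          gcongr
          exact sqrt_add_le_add_sqrt (by positivity) (mul_nonneg (hp0 m) hρ)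
      _ = _ := by rw [Real.sqrt_mul (by positivity), Real.sqrt_sq (hp0 m), Real.sqrt_mul (hp0 m)]
  have hsq : ∑ m, √(p m) ≤ √(Fintype.card Msg : ℝ) := by
    refine Real.le_sqrt_of_sq_le ?_
    have := sum_mul_sq_le_sq_mul_sq univ (fun _ : Msg => (1 : ℝ)) (fun m => √(p m))
    simp only [one_mul, one_pow, sum_const, nsmul_eq_mul, mul_one, card_univ,
      Real.sq_sqrt (hp0 _)] at this
    refine this.trans ?_
    exact mul_le_of_le_one_right (by positivity) hp1
  have hrew : ∀ a, 𝔼 b, D a b * ∑ m, κ m b * η m a = ∑ m, η m a * 𝔼 b, κ m b * D a b := by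
    intro a
    simp_rw [mul_sum, mul_expect]
    rw [expect_sum_comm]
    exact sum_congr rfl fun m _ => expect_congr rfl fun b _ => by ring
  calc |𝔼 a, 𝔼 b, D a b * ∑ m, κ m b * η m a|
      = |𝔼 a, ∑ m, η m a * 𝔼 b, κ m b * D a b| := by simp_rw [hrew]
    _ ≤ 𝔼 a, |∑ m, η m a * 𝔼 b, κ m b * D a b| := abs_expect_le _ _
    _ ≤ 𝔼 a, ∑ m, |𝔼 b, κ m b * D a b| := by
        refine expect_le_expect fun a _ => (abs_sum_le_sum_abs _ _).trans ?_
        refine sum_le_sum fun m _ => ?_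
        rw [abs_mul]
        exact mul_le_of_le_one_left (abs_nonneg _) (hη m a)
    _ = ∑ m, 𝔼 a, |𝔼 b, κ m b * D a b| := expect_sum_comm _ _ _
    _ ≤ ∑ m, √(n - 1) * (p m * √Λ + √(p m) * √ρ) := sum_le_sum fun m _ => hm m
    _ = √(n - 1) * ((∑ m, p m) * √Λ + (∑ m, √(p m)) * √ρ) := by
        rw [← mul_sum, sum_add_distrib, sum_mul, sum_mul]
    _ ≤ √(n - 1) * (1 * √Λ + √(Fintype.card Msg : ℝ) * √ρ) := by gcongr
    _ = _ := by rw [one_mul, Real.sqrt_mul (by positivity)]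

/-! ### Several prescribed points: conditioning on one image at a time -/

/-- The permutation of `Fin (m + 1)` that sends `p` to `q` and acts like `τ` elsewhere. -/
def permThrough {m : ℕ} (p q : Fin (m + 1)) (τ : Equiv.Perm (Fin m)) : Equiv.Perm (Fin (m + 1)) :=
  Equiv.swap q 0 * Equiv.Perm.decomposeFin.symm (0, τ) * Equiv.swap p 0

theorem permThrough_apply_self {m : ℕ} (p q : Fin (m + 1)) (τ : Equiv.Perm (Fin m)) :
    permThrough p q τ p = q := by
  simp [permThrough]

theorem permThrough_apply_swap_succ {m : ℕ} (p q : Fin (m + 1)) (τ : Equiv.Perm (Fin m))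
    (x : Fin m) : permThrough p q τ (Equiv.swap p 0 x.succ) = Equiv.swap q 0 (τ x).succ := by
  simp [permThrough, Equiv.Perm.decomposeFin_symm_apply_succ]

theorem exists_swap_succ {m : ℕ} {p x : Fin (m + 1)} (h : x ≠ p) :
    ∃ x' : Fin m, x = Equiv.swap p 0 x'.succ := by
  have : Equiv.swap p 0 x ≠ 0 := by
    intro h0
    apply h
    have := congrArg (Equiv.swap p 0) h0
    simpa using this
  obtain ⟨x', hx'⟩ := Fin.exists_succ_eq.2 this
  exact ⟨x', by rw [hx']; simp⟩

theorem permThrough_mul {m : ℕ} (p q r : Fin (m + 1)) (τ τ' : Equiv.Perm (Fin m)) :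
    permThrough q r τ' * permThrough p q τ = permThrough p r (τ' * τ) := by
  ext1 x
  rw [Equiv.Perm.mul_apply]
  by_cases h : x = p
  · subst h; simp [permThrough_apply_self]
  · obtain ⟨x', rfl⟩ := exists_swap_succ h
    simp [permThrough_apply_swap_succ]

theorem expect_permThrough {m : ℕ} (p : Fin (m + 1)) (g : Equiv.Perm (Fin (m + 1)) → ℝ) :
    𝔼 σ, g σ = 𝔼 v, 𝔼 τ, g (permThrough p v τ) := by
  rw [← Finset.expect_product' univ univ (fun v τ => g (permThrough p v τ))]
  symm
  refine Fintype.expect_bijective (fun x : Fin (m + 1) × Equiv.Perm (Fin m) =>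
    permThrough p x.1 x.2) ?_ _ _ fun _ => rfl
  rw [Fintype.bijective_iff_injective_and_card]
  refine ⟨?_, ?_⟩
  · rintro ⟨v, τ⟩ ⟨v', τ'⟩ h
    simp only at h
    have hv : v = v' := by
      have := congrArg (fun σ => σ p) h
      simpa [permThrough_apply_self] using this
    subst hv
    simp only [permThrough, mul_left_inj, mul_right_inj, EmbeddingLike.apply_eq_iff_eq] at h
    exact Prod.ext rfl (Prod.ext_iff.1 h).2
  · simp [Fintype.card_perm, Nat.factorial_succ]

/-- Conditioned on sending `p` to `q`, a uniformly random chain is a random chain of permutations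
of the remaining points. -/
theorem exists_chain_lift {m : ℕ} (q : Fin (m + 1)) : ∀ k : ℕ,
    ∃ (V : Type) (_ : Fintype V) (_ : Nonempty V)
      (lA : Fin (m + 1) → V → (Fin (k + 1) → Equiv.Perm (Fin m)) →
        Fin (k + 1) → Equiv.Perm (Fin (m + 1)))
      (lB : Fin (m + 1) → V → (Fin k → Equiv.Perm (Fin m)) → Fin k → Equiv.Perm (Fin (m + 1))),
      ∀ p, (∀ v a b, chain k (lA p v a) (lB p v b) = permThrough p q (chain k a b)) ∧
      ∀ f : (Fin (k + 1) → Equiv.Perm (Fin (m + 1))) → (Fin k → Equiv.Perm (Fin (m + 1))) → ℝ,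
        ((m + 1 : ℕ) : ℝ) * 𝔼 a, 𝔼 b, (if chain k a b p = q then 1 else 0) * f a b =
          𝔼 v, 𝔼 a, 𝔼 b, f (lA p v a) (lB p v b) := by
  intro k
  induction k with
  | zero =>
    refine ⟨Unit, inferInstance, inferInstance,
      fun p _ a => Fin.cons (permThrough p q (a 0)) Fin.elim0, fun _ _ _ => Fin.elim0,
      fun p => ⟨?_, ?_⟩⟩
    · intro v a b
      simp [chain]
    · intro f
      rw [expect_pi_succ, Fintype.expect_const, expect_permThrough p, expect_pi_succ]
      have h : ∀ (v : Fin (m + 1)) (τ : Equiv.Perm (Fin m)),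
          (𝔼 a' : Fin 0 → Equiv.Perm (Fin (m + 1)), 𝔼 b : Fin 0 → Equiv.Perm (Fin (m + 1)),
            (if chain 0 (Fin.cons (permThrough p v τ) a') b p = q then (1 : ℝ) else 0) *
              f (Fin.cons (permThrough p v τ) a') b) = if v = q then
            f (Fin.cons (permThrough p v τ) Fin.elim0) Fin.elim0 else 0 := by
        intro v τ
        have : ∀ (a' b : Fin 0 → Equiv.Perm (Fin (m + 1))),
            (if chain 0 (Fin.cons (permThrough p v τ) a') b p = q then (1 : ℝ) else 0) *
              f (Fin.cons (permThrough p v τ) a') b = if v = q then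
            f (Fin.cons (permThrough p v τ) Fin.elim0) Fin.elim0 else 0 := by
          intro a' b
          rw [Subsingleton.elim a' Fin.elim0, Subsingleton.elim b Fin.elim0]
          simp [chain, permThrough_apply_self]
        simp_rw [this, Fintype.expect_const]
      simp_rw [h]
      rw [Fintype.expect_eq_sum_div_card (ι := Fin (m + 1)), Finset.sum_eq_single q]
      · simp
        field_simp
      · intro v _ hv
        simp [hv]
      · simp
  | succ k ih =>
    obtain ⟨V, hV1, hV2, lA, lB, hl⟩ := ih
    -- The two new coordinates of `V` are the images of `p` after `a 0` and after `b 0 * a 0`. Once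
    -- they are fixed, `lA` depends only on the reduced `a` and `lB` only on the reduced `b`, so the
    -- one-way structure is preserved.
    refine ⟨Fin (m + 1) × Fin (m + 1) × V, inferInstance, inferInstance,
      fun p v a => Fin.cons (permThrough p v.1 (a 0)) (lA v.2.1 v.2.2 (Fin.tail a)),
      fun p v b => Fin.cons (permThrough v.1 v.2.1 (b 0)) (lB v.2.1 v.2.2 (Fin.tail b)),
      fun p => ⟨?_, ?_⟩⟩
    · rintro ⟨v1, v2, v⟩ a b
      simp [chain, (hl _).1, permThrough_mul]
    · intro f
      have lhs : 𝔼 a, 𝔼 b, (if chain (k + 1) a b p = q then (1 : ℝ) else 0) * f a b =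
          𝔼 v1, 𝔼 τ, 𝔼 v2, 𝔼 τ', 𝔼 a, 𝔼 b, (if chain k a b v2 = q then (1 : ℝ) else 0) *
            f (Fin.cons (permThrough p v1 τ) a) (Fin.cons (permThrough v1 v2 τ') b) := by
        rw [expect_pi_succ, expect_permThrough p]
        refine expect_congr rfl fun v1 _ => expect_congr rfl fun τ _ => ?_
        simp_rw [expect_pi_succ (k := k) (X := Equiv.Perm (Fin (m + 1))) (fun b => _ * f _ b)]
        rw [expect_comm, expect_permThrough v1]
        simp [chain, permThrough_apply_self]
      have rhs : (𝔼 v : Fin (m + 1) × Fin (m + 1) × V,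
          𝔼 a : Fin (k + 2) → Equiv.Perm (Fin m), 𝔼 b : Fin (k + 1) → Equiv.Perm (Fin m),
            f (Fin.cons (permThrough p v.1 (a 0)) (lA v.2.1 v.2.2 (Fin.tail a)))
              (Fin.cons (permThrough v.1 v.2.1 (b 0)) (lB v.2.1 v.2.2 (Fin.tail b)))) =
          𝔼 v1, 𝔼 v2, 𝔼 v, 𝔼 τ, 𝔼 τ', 𝔼 a, 𝔼 b,
            f (Fin.cons (permThrough p v1 τ) (lA v2 v a))
              (Fin.cons (permThrough v1 v2 τ') (lB v2 v b)) := by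
        simp_rw [← Finset.univ_product_univ, Finset.expect_product]
        refine expect_congr rfl fun v1 _ => expect_congr rfl fun v2 _ =>
          expect_congr rfl fun v _ => ?_
        rw [expect_pi_succ]
        refine expect_congr rfl fun τ _ => ?_
        rw [expect_comm, expect_pi_succ]
        refine expect_congr rfl fun τ' _ => ?_
        rw [expect_comm]
        simp
      rw [lhs, rhs, mul_expect]
      refine expect_congr rfl fun v1 _ => ?_
      rw [expect_comm, mul_expect]
      refine expect_congr rfl fun v2 _ => ?_
      rw [expect_comm (s := (univ : Finset V)), mul_expect]
      refine expect_congr rfl fun τ _ => ?_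
      rw [expect_comm (s := (univ : Finset V)), mul_expect]
      refine expect_congr rfl fun τ' _ => ?_
      exact (hl v2).2 fun a b => f (Fin.cons (permThrough p v1 τ) a)
        (Fin.cons (permThrough v1 v2 τ') b)

theorem expect_sub_const_le {ι : Type*} [Fintype ι] (f g : ι → ℝ) {c : ℝ} (hc : 0 ≤ c)
    (h : ∀ i, |f i - g i| ≤ c) : |𝔼 i, f i - 𝔼 i, g i| ≤ c := by
  rw [← expect_sub_distrib]
  refine (abs_expect_le _ _).trans ?_
  rcases isEmpty_or_nonempty ι with hι | hι
  · simpa using hc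
  · exact expect_le univ_nonempty fun i _ => h i

/-- Conditioning on the images of `s + 1` points is conditioning on the image of the first one
and then on those of the others. -/
theorem exists_chain_condition_succ {m k s : ℕ} (x y : Fin (s + 1) ↪ Fin (m + 1)) :
    ∃ (V : Type) (_ : Fintype V) (_ : Nonempty V)
      (lA : V → (Fin (k + 1) → Equiv.Perm (Fin m)) → Fin (k + 1) → Equiv.Perm (Fin (m + 1)))
      (lB : V → (Fin k → Equiv.Perm (Fin m)) → Fin k → Equiv.Perm (Fin (m + 1)))
      (x' y' : Fin s ↪ Fin m),
      ∀ f : (Fin (k + 1) → Equiv.Perm (Fin (m + 1))) → (Fin k → Equiv.Perm (Fin (m + 1))) → ℝ,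
        ((m + 1 : ℕ) : ℝ) * 𝔼 a, 𝔼 b, (if chain k a b (x 0) = y 0 then 1 else 0) * f a b =
          𝔼 v, 𝔼 a, 𝔼 b, f (lA v a) (lB v b) ∧
        ((m + 1 : ℕ) : ℝ) * 𝔼 a, 𝔼 b, (if ∀ u, chain k a b (x u) = y u then 1 else 0) * f a b =
          𝔼 v, 𝔼 a, 𝔼 b, (if ∀ u, chain k a b (x' u) = y' u then 1 else 0) *
            f (lA v a) (lB v b) := by
  obtain ⟨V, hV1, hV2, lA, lB, hl⟩ := exists_chain_lift (y 0) k
  have hx : ∀ u : Fin s, ∃ z : Fin m, x u.succ = Equiv.swap (x 0) 0 z.succ := fun u =>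
    exists_swap_succ fun h => Fin.succ_ne_zero u (x.injective h)
  have hy : ∀ u : Fin s, ∃ z : Fin m, y u.succ = Equiv.swap (y 0) 0 z.succ := fun u =>
    exists_swap_succ fun h => Fin.succ_ne_zero u (y.injective h)
  choose x' hx' using hx
  choose y' hy' using hy
  have hxi : Function.Injective x' := by
    intro u u' h
    have : x u.succ = x u'.succ := by rw [hx', hx', h]
    exact Fin.succ_injective _ (x.injective this)
  have hyi : Function.Injective y' := by
    intro u u' h
    have : y u.succ = y u'.succ := by rw [hy', hy', h]
    exact Fin.succ_injective _ (y.injective this)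
  refine ⟨V, hV1, hV2, lA (x 0), lB (x 0), ⟨x', hxi⟩, ⟨y', hyi⟩, fun f => ⟨(hl (x 0)).2 f, ?_⟩⟩
  have h := (hl (x 0)).2 fun a b =>
    (if ∀ u : Fin s, chain k a b (x u.succ) = y u.succ then (1 : ℝ) else 0) * f a b
  have h1 : ∀ (a : Fin (k + 1) → Equiv.Perm (Fin (m + 1))) (b : Fin k → Equiv.Perm (Fin (m + 1))),
      (if ∀ u, chain k a b (x u) = y u then (1 : ℝ) else 0) * f a b =
      (if chain k a b (x 0) = y 0 then 1 else 0) *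
      ((if ∀ u : Fin s, chain k a b (x u.succ) = y u.succ then (1 : ℝ) else 0) * f a b) := by
    intro a b
    simp only [Fin.forall_fin_succ]
    split_ifs <;> simp_all
  simp_rw [h1]
  rw [h]
  refine expect_congr rfl fun v _ => expect_congr rfl fun a _ => expect_congr rfl fun b _ => ?_
  congr 1
  simp only [(hl (x 0)).1, hx', hy', permThrough_apply_swap_succ, EmbeddingLike.apply_eq_iff_eq,
    Fin.succ_inj, Function.Embedding.coeFn_mk]

/-- The chain as a whole is a uniform permutation. The probability does not depend on `x` and `y`,
which gives the conditioned laws a common normalization. -/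
theorem expect_chain_condition {k : ℕ} : ∀ {s m : ℕ} (x y : Fin s ↪ Fin m),
    (m.descFactorial s : ℝ) * 𝔼 a, 𝔼 b, (if ∀ u, chain k a b (x u) = y u then (1 : ℝ) else 0) = 1
  | 0, m, x, y => by
    simp
  | s + 1, 0, x, y => (x 0).elim0
  | s + 1, m + 1, x, y => by
    obtain ⟨V, hV1, hV2, lA, lB, x', y', h⟩ := exists_chain_condition_succ (k := k) x y
    have h1 := (h fun _ _ => 1).2
    simp only [mul_one] at h1
    rw [Nat.succ_descFactorial_succ, Nat.cast_mul, mul_comm ((m + 1 : ℕ) : ℝ), mul_assoc, h1]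
    rw [Fintype.expect_const]
    exact expect_chain_condition x' y'

/-- A message about the factors `b` says little about the images of `s` points under a chain whose
other factors are uniformly random. -/
theorem chain_bound {k : ℕ} {Msg : Type*} [Fintype Msg] {β : ℝ} (hβ : 0 ≤ β) {D : ℕ} :
    ∀ {s m : ℕ} (_ : s + D ≤ m)
    (_ : ∀ m', D < m' → m' ≤ m → ∀ (x y : Fin m') (κ : Msg → (Fin k → Equiv.Perm (Fin m')) → ℝ)
      (η : Msg → (Fin (k + 1) → Equiv.Perm (Fin m')) → ℝ), (∀ m b, 0 ≤ κ m b) →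
      (∀ b, ∑ m, κ m b ≤ 1) → (∀ m a, |η m a| ≤ 1) →
      |𝔼 a, 𝔼 b, ((m' : ℝ) * (if chain k a b x = y then 1 else 0) - 1) *
        ∑ m, κ m b * η m a| ≤ β)
    (x y : Fin s ↪ Fin m) (κ : Msg → (Fin k → Equiv.Perm (Fin m)) → ℝ)
      (η : Msg → (Fin (k + 1) → Equiv.Perm (Fin m)) → ℝ) (_ : ∀ m b, 0 ≤ κ m b)
      (_ : ∀ b, ∑ m, κ m b ≤ 1) (_ : ∀ m a, |η m a| ≤ 1),
    |(m.descFactorial s : ℝ) * 𝔼 a, 𝔼 b, (if ∀ u, chain k a b (x u) = y u then 1 else 0) *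
        ∑ m, κ m b * η m a - 𝔼 a, 𝔼 b, ∑ m, κ m b * η m a| ≤ s * β
  | 0, m, _, _, x, y, κ, η, _, _, _ => by simp
  | s + 1, 0, _, _, x, y, κ, η, _, _, _ => (x 0).elim0
  | s + 1, m + 1, hs, hsingle, x, y, κ, η, h0, h1, h2 => by
    obtain ⟨V, hV1, hV2, lA, lB, x', y', h⟩ := exists_chain_condition_succ (k := k) x y
    obtain ⟨e1, e2⟩ := h fun a b => ∑ m, κ m b * η m a
    -- Imposing the first image costs β. After lifting with `v` fixed, the other s conditions
    -- concern a chain on m points, and the lifted κ and η satisfy the same bounds.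
    have key := hsingle (m + 1) (by omega) le_rfl (x 0) (y 0) κ η h0 h1 h2
    have e3 : 𝔼 a, 𝔼 b, (((m + 1 : ℕ) : ℝ) * (if chain k a b (x 0) = y 0 then 1 else 0) - 1) *
        ∑ m, κ m b * η m a = (𝔼 v, 𝔼 a, 𝔼 b, ∑ m, κ m (lB v b) * η m (lA v a)) -
        𝔼 a, 𝔼 b, ∑ m, κ m b * η m a := by
      rw [← e1]
      simp_rw [sub_mul, expect_sub_distrib, one_mul, mul_assoc, ← mul_expect]
    rw [e3] at key
    rw [Nat.succ_descFactorial_succ, Nat.cast_mul, mul_comm ((m + 1 : ℕ) : ℝ), mul_assoc, e2,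
      mul_expect]
    have step : |𝔼 v, (m.descFactorial s : ℝ) * (𝔼 a, 𝔼 b,
        (if ∀ u, chain k a b (x' u) = y' u then 1 else 0) *
          ∑ m, κ m (lB v b) * η m (lA v a)) -
        𝔼 v, 𝔼 a, 𝔼 b, ∑ m, κ m (lB v b) * η m (lA v a)| ≤ s * β := by
      refine expect_sub_const_le _ _ (by positivity) fun v => ?_
      exact chain_bound hβ (by omega) (fun m' hm hm' => hsingle m' hm (by omega)) x' y'
        (fun m b => κ m (lB v b)) (fun m a => η m (lA v a)) (fun _ _ => h0 _ _) (fun _ => h1 _)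
        (fun _ _ => h2 _ _)
    calc _ ≤ _ := abs_sub_le _ _ _
      _ ≤ s * β + β := add_le_add step key
      _ = _ := by push_cast; ring

/-! ### Random permutations rarely agree -/

theorem expect_perm_extends {m : ℕ} (b : Equiv.Perm (Fin m)) (A : Finset (Fin m)) :
    𝔼 σ : Equiv.Perm (Fin m), (if ∀ v ∈ A, b v = σ v then (1 : ℝ) else 0) =
      1 / m.descFactorial #A := by
  set x : Fin #A ↪ Fin m := A.equivFin.symm.toEmbedding.trans (Function.Embedding.subtype _) with hx
  have h := expect_chain_condition (k := 0) x (x.trans b.toEmbedding)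
  rw [expect_pi_succ] at h
  simp only [chain, Fin.cons_zero, Fintype.expect_const] at h
  have e : ∀ σ : Equiv.Perm (Fin m), (∀ v ∈ A, b v = σ v) ↔
      ∀ u, σ (x u) = (x.trans b.toEmbedding) u := by
    intro σ
    constructor
    · intro h u
      exact (h _ (A.equivFin.symm u).2).symm
    · intro h v hv
      have := h (A.equivFin ⟨v, hv⟩)
      simp [hx] at this
      exact this.symm
  simp_rw [e]
  have hne : (m.descFactorial #A : ℝ) ≠ 0 := by
    intro h0; rw [h0] at h; simp at h
  field_simp
  linarith

/-- The power of two counts the subsets of the agreement set. A given j-set lies in it with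
probability 1/(m)_j, and there are C(m, j) such sets, so the mean is a partial sum of ∑ 1/j! and at
most e. -/
theorem expect_two_pow_agree_le {m : ℕ} (b : Equiv.Perm (Fin m)) :
    𝔼 σ : Equiv.Perm (Fin m), (2 : ℝ) ^ agree b σ ≤ 4 := by
  have h1 : ∀ σ : Equiv.Perm (Fin m), (2 : ℝ) ^ agree b σ =
      ∑ A : Finset (Fin m), if ∀ v ∈ A, b v = σ v then (1 : ℝ) else 0 := by
    intro σ
    rw [← Finset.sum_filter, Finset.sum_const, nsmul_eq_mul, mul_one, agree]
    have : ({A : Finset (Fin m) | ∀ v ∈ A, b v = σ v} : Finset _) =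
        ({v | b v = σ v} : Finset (Fin m)).powerset := by
      ext A
      simp [Finset.subset_iff]
    rw [this, Finset.card_powerset]
    norm_cast
  simp_rw [h1]
  rw [expect_sum_comm]
  simp_rw [expect_perm_extends]
  rw [← Finset.powerset_univ, Finset.sum_powerset_apply_card (fun j => 1 / (m.descFactorial j : ℝ))]
  simp only [Finset.card_univ, Fintype.card_fin]
  have h2 : ∀ j ∈ Finset.range (m + 1), m.choose j • (1 / (m.descFactorial j : ℝ)) =
      1 ^ j / (j.factorial : ℝ) := by
    intro j hj
    have hj : j ≤ m := by simpa [Nat.lt_succ_iff] using hj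
    have hc : (m.choose j : ℝ) ≠ 0 := by exact_mod_cast (Nat.choose_pos hj).ne'
    have hf : (j.factorial : ℝ) ≠ 0 := by exact_mod_cast j.factorial_ne_zero
    rw [Nat.descFactorial_eq_factorial_mul_choose, nsmul_eq_mul, Nat.cast_mul, one_pow]
    field_simp
  rw [Finset.sum_congr rfl h2]
  refine (Real.sum_le_exp_of_nonneg zero_le_one _).trans ?_
  linarith [Real.exp_one_lt_d9]

/-- Markov's inequality for 2 to the total agreement, whose mean factorizes over the independent
coordinates. -/
theorem expect_agree_tail {m k : ℕ} (L : ℕ) (b : Fin k → Equiv.Perm (Fin m)) :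
    𝔼 b' : Fin k → Equiv.Perm (Fin m), (if L ≤ ∑ i, agree (b i) (b' i) then (1 : ℝ) else 0) ≤
      4 ^ k / 2 ^ L := by
  have h1 : ∀ (k : ℕ) (b : Fin k → Equiv.Perm (Fin m)),
      𝔼 b' : Fin k → Equiv.Perm (Fin m), (2 : ℝ) ^ ∑ i, agree (b i) (b' i) ≤ 4 ^ k := by
    intro k
    induction k with
    | zero => intro b; simp
    | succ k ih =>
      intro b
      rw [expect_pi_succ, pow_succ' (4 : ℝ)]
      simp_rw [Fin.sum_univ_succ, pow_add, Fin.cons_zero, Fin.cons_succ, ← mul_expect, ← expect_mul]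
      exact mul_le_mul (expect_two_pow_agree_le _) (ih fun i => b i.succ)
        (expect_nonneg fun _ _ => by positivity) (by norm_num)
  rw [le_div_iff₀ (by positivity), expect_mul]
  refine le_trans (expect_le_expect fun b' _ => ?_) (h1 k b)
  split_ifs with h
  · rw [one_mul]
    exact pow_le_pow_right₀ (by norm_num) h
  · rw [zero_mul]; positivity

theorem prod_le_mean_pow {k : ℕ} (hk : 0 < k) (z : Fin k → ℝ) (hz : ∀ i, 0 ≤ z i) :
    ∏ i, z i ≤ ((∑ i, z i) / k) ^ k := by
  have hk' : (0 : ℝ) < k := by exact_mod_cast hk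
  have h := Real.geom_mean_le_arith_mean univ (fun _ => (1 : ℝ)) z (fun _ _ => zero_le_one)
    (by simpa using hk) (fun i _ => hz i)
  simp only [Real.rpow_one, sum_const, card_univ, Fintype.card_fin, nsmul_eq_mul, mul_one,
    one_mul] at h
  have h0 : 0 ≤ ∏ i, z i := prod_nonneg fun i _ => hz i
  calc ∏ i, z i = ((∏ i, z i) ^ ((k : ℝ)⁻¹)) ^ k := by
        rw [← Real.rpow_natCast, ← Real.rpow_mul h0, inv_mul_cancel₀ hk'.ne', Real.rpow_one]
    _ ≤ _ := pow_le_pow_left₀ (by positivity) h k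

/-- By the inequality of arithmetic and geometric means, for a bounded total number of agreements
the product is largest when they are spread evenly. The summand `k` absorbs the −1 in each character
after taking absolute values. -/
theorem prod_stdChar_le {m k L : ℕ} (hk : 0 < k) (hm : 2 ≤ m) (b b' : Fin k → Equiv.Perm (Fin m))
    (hL : ∑ i, agree (b i) (b' i) < L) :
    ∏ i, stdChar (b i) (b' i) ≤ (((L : ℝ) + k) / (k * ((m : ℝ) - 1))) ^ k := by
  have hm1 : (0 : ℝ) < (m : ℝ) - 1 := by
    have : (2 : ℝ) ≤ m := by exact_mod_cast hm
    linarith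
  calc ∏ i, stdChar (b i) (b' i) ≤ |∏ i, stdChar (b i) (b' i)| := le_abs_self _
    _ = ∏ i, |stdChar (b i) (b' i)| := Finset.abs_prod _ _
    _ ≤ ∏ i, ((agree (b i) (b' i) : ℝ) + 1) / ((m : ℝ) - 1) := by
        refine Finset.prod_le_prod (fun _ _ => abs_nonneg _) fun i _ => ?_
        rw [stdChar, Fintype.card_fin, abs_div, abs_of_pos hm1]
        gcongr
        rw [abs_le]
        constructor <;> linarith [(Nat.cast_nonneg (agree (b i) (b' i)) : (0 : ℝ) ≤ _)]
    _ ≤ ((∑ i, ((agree (b i) (b' i) : ℝ) + 1) / ((m : ℝ) - 1)) / k) ^ k :=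
        prod_le_mean_pow hk _ fun i => by positivity
    _ ≤ _ := by
        have : (0 : ℝ) < k := by exact_mod_cast hk
        have hL' : (∑ i, (agree (b i) (b' i) : ℝ)) ≤ L := by exact_mod_cast hL.le
        rw [← Finset.sum_div, Finset.sum_add_distrib, div_div, mul_comm (k : ℝ)]
        gcongr
        simp

theorem prod_stdChar_le_one {m k : ℕ} (hm : 2 ≤ m) (b b' : Fin k → Equiv.Perm (Fin m)) :
    ∏ i, stdChar (b i) (b' i) ≤ 1 := by
  have hm1 : (2 : ℝ) ≤ m := by exact_mod_cast hm
  refine (le_abs_self _).trans ?_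
  rw [Finset.abs_prod]
  refine Finset.prod_le_one (fun _ _ => abs_nonneg _) fun i _ => ?_
  rw [stdChar, Fintype.card_fin, abs_div, abs_of_pos (show (0 : ℝ) < (m : ℝ) - 1 by linarith),
    div_le_one (by linarith), abs_le]
  have h : agree (b i) (b' i) ≤ m := (Finset.card_le_univ _).trans (by simp)
  have h' : (agree (b i) (b' i) : ℝ) ≤ m := by exact_mod_cast h
  constructor <;> linarith [(Nat.cast_nonneg (agree (b i) (b' i)) : (0 : ℝ) ≤ _)]

/-- The one-way communication bound for chains. -/
theorem chain_message_bound {m s k C L : ℕ} (hk : 0 < k) (hs : s < m) (x y : Fin s ↪ Fin m)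
    (κ : (Fin C → Bool) → (Fin k → Equiv.Perm (Fin m)) → ℝ)
    (η : (Fin C → Bool) → (Fin (k + 1) → Equiv.Perm (Fin m)) → ℝ) (hκ : ∀ m b, 0 ≤ κ m b)
    (hκ1 : ∀ b, ∑ m, κ m b ≤ 1) (hη : ∀ m a, |η m a| ≤ 1) :
    |(m.descFactorial s : ℝ) * 𝔼 a, 𝔼 b, (if ∀ u, chain k a b (x u) = y u then 1 else 0) *
        ∑ m, κ m b * η m a - 𝔼 a, 𝔼 b, ∑ m, κ m b * η m a| ≤
      s * (√m * (√((((L : ℝ) + k) / (k * ((m : ℝ) - s))) ^ k) + √(2 ^ C * (4 ^ k / 2 ^ L)))) := by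
  refine chain_bound (D := m - s) (by positivity) (by omega) ?_ x y κ η hκ hκ1 hη
  intro m' h1 h2 x y κ η hκ hκ1 hη
  -- During the conditioning at least m − s + 1 points remain, so every character keeps a
  -- denominator of at least m − s.
  have hd : (m : ℝ) - s ≤ (m' : ℝ) - 1 := by
    have : m + 1 ≤ m' + s := by omega
    have : (m : ℝ) + 1 ≤ m' + s := by exact_mod_cast this
    linarith
  have hs' : (0 : ℝ) < (m : ℝ) - s := by
    have : (s : ℝ) < m := by exact_mod_cast hs
    linarith
  have hkR : (0 : ℝ) < k := by exact_mod_cast hk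
  have hm' : 2 ≤ m' := by omega
  have := chain_single_point_bound (α := Fin m') (Msg := Fin C → Bool) (by simpa using hm') x y k
    (fun b b' => L ≤ ∑ i, agree (b i) (b' i)) ((((L : ℝ) + k) / (k * ((m : ℝ) - s))) ^ k)
    (4 ^ k / 2 ^ L) (by positivity) (by positivity)
    (fun b b' h => (prod_stdChar_le hk hm' b b' (not_le.1 h)).trans (by
      have : (0 : ℝ) < (m' : ℝ) - 1 := by linarith
      gcongr))
    (fun b b' => prod_stdChar_le_one hm' b b') (fun b => expect_agree_tail L b) κ hκ hκ1 η hη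
  simp only [Fintype.card_fin, Fintype.card_pi, Fintype.card_bool, prod_const, card_univ,
    Nat.cast_pow, Nat.cast_ofNat] at this
  refine this.trans ?_
  gcongr
  have : (m' : ℝ) ≤ m := by exact_mod_cast h2
  linarith

/-! ### Numerical comparison with Φ -/

theorem sqrt_rpow_neg {y e : ℝ} (hy : 0 < y) : √(y ^ (-(2 * e))) = y ^ (-e) := by
  rw [Real.sqrt_eq_rpow, ← Real.rpow_mul hy.le]
  congr 1
  ring

/-- With y = (N − s)/(40C), the threshold L is chosen so that both square roots are at most
y^(−c/6). The prefactors s and √N are at most N each, and the two terms give the 2 in Φ. -/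
theorem message_bound_le_Phi {N s c C k : ℕ} (hs : s < N) (hC : 0 < C) (hk : 6 ≤ k)
    (hc : c ≤ 2 * k + 2) (hy : 40 * (C : ℝ) ≤ (N : ℝ) - s) :
    ∃ L : ℕ, s * (√N * (√((((L : ℝ) + k) / (k * ((N : ℝ) - s))) ^ k) +
      √(2 ^ C * (4 ^ k / 2 ^ L)))) ≤ Phi s c N C := by
  have hC' : (1 : ℝ) ≤ C := by exact_mod_cast hC
  have hk' : (6 : ℝ) ≤ k := by exact_mod_cast hk
  have hc' : (c : ℝ) ≤ 2 * k + 2 := by exact_mod_cast hc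
  have hs' : (s : ℝ) < N := by exact_mod_cast hs
  have hs0 : (0 : ℝ) ≤ s := by positivity
  set y : ℝ := ((N : ℝ) - s) / (40 * C) with hydef
  have hy1 : 1 ≤ y := by rw [hydef, le_div_iff₀ (by positivity)]; linarith
  have hd : (N : ℝ) - s = 40 * C * y := by rw [hydef]; field_simp
  -- From c ≤ 2k + 2; this is where k ≥ 6 is needed. The missing 2/9 in the exponent pays for the
  -- logarithm in L.
  have hc3 : (c : ℝ) / 3 ≤ 7 / 9 * k := by linarith
  have hlog : 0 ≤ Real.logb 2 y := Real.logb_nonneg (by norm_num) hy1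
  -- The least threshold for which 2^C · 4^k / 2^L is at most y^(−c/3).
  set L := ⌈(C : ℝ) + 2 * k + c / 3 * Real.logb 2 y⌉₊ with hL
  have hL1 : (C : ℝ) + 2 * k + c / 3 * Real.logb 2 y ≤ L := Nat.le_ceil _
  have hL2 : (L : ℝ) < C + 2 * k + c / 3 * Real.logb 2 y + 1 := Nat.ceil_lt_add_one (by positivity)
  refine ⟨L, ?_⟩
  have b1 : (2 : ℝ) ^ C * (4 ^ k / 2 ^ L) ≤ y ^ (-(2 * ((c : ℝ) / 6))) := by
    have e1 : (2 : ℝ) ^ C * (4 ^ k / 2 ^ L) = (2 : ℝ) ^ ((C : ℝ) + 2 * k - L) := by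
      rw [Real.rpow_sub (by norm_num), Real.rpow_add (by norm_num), Real.rpow_natCast,
        Real.rpow_natCast, Real.rpow_mul (by norm_num), Real.rpow_natCast]
      norm_num
      ring
    have e2 : y ^ (-(2 * ((c : ℝ) / 6))) = (2 : ℝ) ^ (-(c / 3 * Real.logb 2 y)) := by
      have : (2 : ℝ) ^ Real.logb 2 y = y := Real.rpow_logb (by norm_num) (by norm_num) (by linarith)
      conv_lhs => rw [← this]
      rw [← Real.rpow_mul (by norm_num)]
      congr 1
      ring
    rw [e1, e2]
    exact Real.rpow_le_rpow_of_exponent_le (by norm_num) (by linarith)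
  have b2 : (((L : ℝ) + k) / (k * ((N : ℝ) - s))) ^ k ≤ y ^ (-(2 * ((c : ℝ) / 6))) := by
    -- The natural logarithm is at most (9/2) y^(2/9), and 4.5 / log 2 < 6.5.
    have hl : Real.logb 2 y ≤ 6.5 * y ^ (2 / 9 : ℝ) := by
      have h1 := Real.log_le_rpow_div (x := y) (ε := 2 / 9) (by linarith) (by norm_num)
      have h2 := Real.log_two_gt_d9
      rw [Real.logb, div_le_iff₀ (by linarith)]
      have h3 : 0 ≤ y ^ (2 / 9 : ℝ) := by positivity
      nlinarith
    have hz : 1 ≤ y ^ (2 / 9 : ℝ) := Real.one_le_rpow hy1 (by norm_num)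
    have h1 : ((L : ℝ) + k) / (k * ((N : ℝ) - s)) ≤ y ^ (-(7 / 9) : ℝ) := by
      have e : y ^ (-(7 / 9) : ℝ) = y ^ (2 / 9 : ℝ) / y := by
        rw [← Real.rpow_sub_one (by linarith)]; norm_num
      rw [e, hd, div_le_div_iff₀ (by positivity) (by linarith)]
      have h2 : (c : ℝ) / 3 * Real.logb 2 y ≤ 7 / 9 * k * (6.5 * y ^ (2 / 9 : ℝ)) :=
        mul_le_mul hc3 hl hlog (by positivity)
      have h3 : (L : ℝ) + k ≤ 40 * C * k * y ^ (2 / 9 : ℝ) := by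
        set z := y ^ (2 / 9 : ℝ)
        have h4 : (k : ℝ) ≤ k * z := le_mul_of_one_le_right (by linarith) hz
        have h5 : (k : ℝ) * z ≤ C * (k * z) := le_mul_of_one_le_left (by positivity) hC'
        have h6 : (C : ℝ) ≤ C * (k * z) := le_mul_of_one_le_right (by linarith) (by linarith)
        nlinarith
      nlinarith
    calc (((L : ℝ) + k) / (k * ((N : ℝ) - s))) ^ k ≤ (y ^ (-(7 / 9) : ℝ)) ^ k :=
          pow_le_pow_left₀ (div_nonneg (by positivity) (by nlinarith)) h1 k
      _ = y ^ (-(7 / 9) * k : ℝ) := by rw [← Real.rpow_natCast, ← Real.rpow_mul (by linarith)]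
      _ ≤ _ := Real.rpow_le_rpow_of_exponent_le hy1 (by linarith)
  have hPhi : Phi s c N C = 2 * (N : ℝ) ^ 2 * y ^ (-((c : ℝ) / 6)) := by
    rw [Phi, Real.rpow_neg (by linarith), ← Real.inv_rpow (by linarith), hydef, inv_div]
  have hsqrt : √(N : ℝ) ≤ N := by
    rw [Real.sqrt_le_left (by linarith)]
    have : (1 : ℝ) ≤ N := by exact_mod_cast (by omega : 1 ≤ N)
    nlinarith
  calc s * (√N * (√((((L : ℝ) + k) / (k * ((N : ℝ) - s))) ^ k) + √(2 ^ C * (4 ^ k / 2 ^ L))))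
      ≤ N * (N * (√(y ^ (-(2 * ((c : ℝ) / 6)))) + √(y ^ (-(2 * ((c : ℝ) / 6)))))) := by
        gcongr
    _ = _ := by rw [sqrt_rpow_neg (by linarith), hPhi]; ring

/-- The range in which the bound to be proved is trivial. If the base q of the power is below 1,
then c ≤ 12 makes the power at least q², and the factor N² compensates because N q ≥ 1. -/
theorem one_le_Phi {N s c C : ℕ} (hs : s < N) (hC : 0 < C)
    (h : c ≤ 12 ∨ (N : ℝ) - s ≤ 40 * C) : 1 ≤ Phi s c N C := by
  have hC' : (1 : ℝ) ≤ C := by exact_mod_cast hC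
  have hs' : (s : ℝ) < N := by exact_mod_cast hs
  have hs0 : (0 : ℝ) ≤ s := by positivity
  have hN1 : (1 : ℝ) ≤ N := by exact_mod_cast (by omega : 1 ≤ N)
  have hd : 0 < (N : ℝ) - s := by linarith
  set q : ℝ := 40 * C / ((N : ℝ) - s) with hq
  have hq0 : 0 < q := by positivity
  rw [Phi, ← hq]
  by_cases h1 : 1 ≤ q
  · have := Real.one_le_rpow h1 (show (0 : ℝ) ≤ (c : ℝ) / 6 by positivity)
    nlinarith
  · have hc : c ≤ 12 := by
      rcases h with h | h
      · exact h
      · exact absurd ((one_le_div hd).2 h) h1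
    have hc' : (c : ℝ) ≤ 12 := by exact_mod_cast hc
    have h2 : q ^ (2 : ℝ) ≤ q ^ ((c : ℝ) / 6) :=
      Real.rpow_le_rpow_of_exponent_ge hq0 (by linarith) (by linarith)
    have h3 : (1 : ℝ) ≤ N * q := by
      rw [hq, ← mul_div_assoc, one_le_div hd]
      nlinarith
    rw [Real.rpow_two] at h2
    calc (1 : ℝ) ≤ 2 * (N * q) ^ 2 := by nlinarith
      _ = 2 * (N : ℝ) ^ 2 * q ^ 2 := by ring
      _ ≤ _ := by gcongr

end PermutationChains

/-! ### Replacing what is known before the last round by an independent sample -/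

section Decoupling

open Finset BigOperators

/-- Exchanging the coordinate `j` of the sample with a separate sample `h` maps one product set onto
the other. -/
theorem expect_piFinset_update {J X T : Type*} [Fintype J] [DecidableEq J]
    (fib : T → Finset X) (hfib : ∀ t, (fib t).Nonempty) (M : J → T) (j : J) (t : T)
    (f : (J → X) → ℝ) :
    𝔼 z ∈ Fintype.piFinset fun i => fib (Function.update M j t i), f z =
      𝔼 z ∈ Fintype.piFinset fun i => fib (M i), 𝔼 h ∈ fib t, f (Function.update z j h) := by
  calc 𝔼 z ∈ Fintype.piFinset fun i => fib (Function.update M j t i), f z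
      = 𝔼 z ∈ Fintype.piFinset fun i => fib (Function.update M j t i),
          𝔼 _h ∈ fib (M j), f z := by
        refine expect_congr rfl fun z _ => ?_
        rw [expect_const (hfib _)]
    _ = _ := by
        rw [← expect_product', ← expect_product']
        refine expect_nbij' (fun p => (Function.update p.1 j p.2, p.1 j))
          (fun p => (Function.update p.1 j p.2, p.1 j)) ?_ ?_ ?_ ?_ ?_
        · rintro ⟨z, h⟩ hz
          simp only [mem_product, Fintype.mem_piFinset] at hz ⊢
          refine ⟨fun i => ?_, by simpa using hz.1 j⟩
          by_cases hi : i = j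
          · subst hi; simpa using hz.2
          · simpa [hi] using hz.1 i
        · rintro ⟨z, h⟩ hz
          simp only [mem_product, Fintype.mem_piFinset] at hz ⊢
          refine ⟨fun i => ?_, by simpa using hz.1 j⟩
          by_cases hi : i = j
          · subst hi; simpa using hz.2
          · simpa [hi] using hz.1 i
        · rintro ⟨z, h⟩ _; simp
        · rintro ⟨z, h⟩ _; simp
        · rintro ⟨z, h⟩ _; simp

theorem abs_expect_sub_expect_le {ι : Type*} (s : Finset ι) (f g : ι → ℝ) {c : ℝ} (hc : 0 ≤ c)
    (h : ∀ i ∈ s, |f i - g i| ≤ c) : |𝔼 i ∈ s, f i - 𝔼 i ∈ s, g i| ≤ c := by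
  rw [← expect_sub_distrib]
  refine (abs_expect_le _ _).trans ?_
  rcases s.eq_empty_or_nonempty with hs | hs
  · simpa [hs] using hc
  · exact expect_le hs h

/-- Hybrid argument: if changing the label of one coordinate changes the mean of `f` by at most
`δ`, then changing all labels changes it by at most `δ` times the number of coordinates. -/
theorem hybrid_bound {J X T : Type*} [Fintype J] [DecidableEq J]
    (fib : T → Finset X) (hfib : ∀ t, (fib t).Nonempty) (f : (J → X) → ℝ) {δ : ℝ} (hδ : 0 ≤ δ)
    (hf : ∀ j z t t', |𝔼 h ∈ fib t, f (Function.update z j h) -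
      𝔼 h ∈ fib t', f (Function.update z j h)| ≤ δ) (M M' : J → T) :
    |𝔼 z ∈ Fintype.piFinset fun i => fib (M i), f z -
      𝔼 z ∈ Fintype.piFinset fun i => fib (M' i), f z| ≤ Fintype.card J * δ := by
  have h : ∀ s : Finset J, |𝔼 z ∈ Fintype.piFinset fun i => fib (M i), f z -
      𝔼 z ∈ Fintype.piFinset fun i => fib (s.piecewise M' M i), f z| ≤ #s * δ := by
    intro s
    induction s using Finset.induction_on with
    | empty => simp
    | insert j s hj ih =>
      rw [piecewise_insert, card_insert_of_notMem hj]
      set M1 := s.piecewise M' M with hM1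
      have h1 := expect_piFinset_update fib hfib M1 j (M' j) f
      have h2 := expect_piFinset_update fib hfib M1 j (M1 j) f
      rw [Function.update_eq_self] at h2
      have h3 := abs_expect_sub_expect_le (Fintype.piFinset fun i => fib (M1 i)) _ _ hδ
        fun z _ => hf j z (M1 j) (M' j)
      rw [← h1, ← h2] at h3
      calc _ ≤ _ := abs_sub_le _ _ _
        _ ≤ #s * δ + δ := add_le_add ih h3
        _ = _ := by push_cast; ring
  simpa using h univ

open Classical in
/-- If the fibres of `W` are rectangles, the message depends on `W` and `y` and the outcome on `W`,
the message and `x`, then given `W` the mean outcome splits into a message kernel and a mean. -/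
theorem exists_conditional_kernels {XA XB ΘA ΘB 𝒲 Msg : Type*} [Fintype Msg] [Nonempty Msg]
    (pA : ΘA → Finset XA) (pB : ΘB → Finset XB)
    (W : XA → XB → 𝒲) (msg : XA → XB → Msg) (out : XA → XB → ℝ)
    (hout : ∀ a b, |out a b| ≤ 1)
    (hW : ∀ a b a' b', W a b = W a' b' → W a b' = W a b)
    (hmsg : ∀ a a' b, W a b = W a' b → msg a b = msg a' b)
    (hdet : ∀ a b b', W a b = W a b' → msg a b = msg a b' → out a b = out a b') :
    ∃ (κ : 𝒲 → Msg → ΘB → ℝ) (η : 𝒲 → Msg → ΘA → ℝ), (∀ w m b, 0 ≤ κ w m b) ∧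
      (∀ w b, ∑ m, κ w m b ≤ 1) ∧ (∀ w m a, |η w m a| ≤ 1) ∧
      ∀ a b, 𝔼 x ∈ pA a, 𝔼 y ∈ pB b, out x y =
        𝔼 x ∈ pA a, 𝔼 y ∈ pB b, ∑ m, κ (W x y) m b * η (W x y) m a := by
  -- The message as a function of the value of `W` and of `y` alone; by `hmsg` the choice of `x`
  -- does not matter. In the same way `ow` below depends on `w`, the message and `x` only, by
  -- `hdet`.
  let mw : 𝒲 → XB → Msg := fun w y =>
    if h : ∃ x, W x y = w then msg h.choose y else Classical.arbitrary _
  have hmw : ∀ x y, mw (W x y) y = msg x y := by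
    intro x y
    have h : ∃ x', W x' y = W x y := ⟨x, rfl⟩
    simp only [mw, dif_pos h]
    exact hmsg _ _ _ h.choose_spec
  let ow : 𝒲 → Msg → XA → ℝ := fun w m x =>
    if h : ∃ y, W x y = w ∧ msg x y = m then out x h.choose else 0
  have how : ∀ x y, ow (W x y) (msg x y) x = out x y := by
    intro x y
    have h : ∃ y', W x y' = W x y ∧ msg x y' = msg x y := ⟨y, rfl, rfl⟩
    simp only [ow, dif_pos h]
    exact hdet _ _ _ h.choose_spec.1 h.choose_spec.2
  have how1 : ∀ w m x, |ow w m x| ≤ 1 := by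
    intro w m x
    simp only [ow]
    split_ifs
    · exact hout _ _
    · simp
  -- The level set of `W` inside `pA a ×ˢ pB b` is `rA w a ×ˢ rB w b`. Hence, given `w`, the two
  -- sides are independent: κ is the law of the message on one side and η the mean outcome on the
  -- other.
  let rA : 𝒲 → ΘA → Finset XA := fun w a => {x ∈ pA a | ∃ y, W x y = w}
  let rB : 𝒲 → ΘB → Finset XB := fun w b => {y ∈ pB b | ∃ x, W x y = w}
  let κ : 𝒲 → Msg → ΘB → ℝ := fun w m b => (#{y ∈ rB w b | mw w y = m} : ℝ) / #(rB w b)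
  let η : 𝒲 → Msg → ΘA → ℝ := fun w m a => (∑ x ∈ rA w a, ow w m x) / #(rA w a)
  have hκ0 : ∀ w m b, 0 ≤ κ w m b := fun w m b => by positivity
  have hκ1 : ∀ w b, ∑ m, κ w m b ≤ 1 := by
    intro w b
    simp only [κ]
    rw [← sum_div, ← Nat.cast_sum, ← card_eq_sum_card_fiberwise (f := mw w) fun _ _ => mem_coe.2 (mem_univ _)]
    exact div_self_le_one _
  have hη1 : ∀ w m a, |η w m a| ≤ 1 := by
    intro w m a
    simp only [η]
    rw [abs_div, Nat.abs_cast]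
    refine div_le_one_of_le₀ ?_ (by positivity)
    refine (abs_sum_le_sum_abs _ _).trans ?_
    simpa using sum_le_sum fun x (_ : x ∈ rA w a) => how1 w m x
  refine ⟨κ, η, hκ0, hκ1, hη1, fun a b => ?_⟩
  rw [← expect_product', ← expect_product', expect_eq_sum_div_card, expect_eq_sum_div_card]
  congr 1
  have hmap : ∀ p ∈ pA a ×ˢ pB b, W p.1 p.2 ∈ (pA a ×ˢ pB b).image fun p => W p.1 p.2 :=
    fun p hp => mem_image_of_mem _ hp
  rw [← sum_fiberwise_of_maps_to hmap, ← sum_fiberwise_of_maps_to hmap]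
  refine sum_congr rfl fun w hw => ?_
  have hfilter : ({p ∈ pA a ×ˢ pB b | W p.1 p.2 = w} : Finset _) = rA w a ×ˢ rB w b := by
    ext ⟨x, y⟩
    simp only [mem_filter, mem_product, rA, rB]
    constructor
    · rintro ⟨⟨hx, hy⟩, h⟩
      exact ⟨⟨hx, y, h⟩, ⟨hy, x, h⟩⟩
    · rintro ⟨⟨hx, y', h⟩, ⟨hy, x', h'⟩⟩
      exact ⟨⟨hx, hy⟩, (hW _ _ _ _ (h.trans h'.symm)).trans h⟩
  have hmem : ∀ x y, x ∈ rA w a → y ∈ rB w b → W x y = w := by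
    intro x y hx hy
    have : (x, y) ∈ ({p ∈ pA a ×ˢ pB b | W p.1 p.2 = w} : Finset _) := by
      rw [hfilter]; exact mem_product.2 ⟨hx, hy⟩
    exact (mem_filter.1 this).2
  rw [hfilter, sum_product, sum_product]
  have e1 : ∀ x ∈ rA w a, ∑ y ∈ rB w b, out x y =
      ∑ m, (#{y ∈ rB w b | mw w y = m} : ℝ) * ow w m x := by
    intro x hx
    rw [← sum_fiberwise (rB w b) (mw w)]
    refine sum_congr rfl fun m _ => ?_
    rw [← nsmul_eq_mul, ← sum_const]
    refine sum_congr rfl fun y hy => ?_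
    obtain ⟨hy, hm⟩ := mem_filter.1 hy
    have hxy := hmem x y hx hy
    rw [← how, hxy, ← hm, ← hmw x y, hxy]
  rw [sum_congr rfl e1, sum_comm]
  have e2 : ∀ x ∈ rA w a, ∀ y ∈ rB w b, ∑ m, κ (W x y) m b * η (W x y) m a =
      ∑ m, κ w m b * η w m a := by
    intro x hx y hy
    rw [hmem x y hx hy]
  rw [sum_congr rfl fun x hx => sum_congr rfl (e2 x hx)]
  simp only [sum_const, nsmul_eq_mul]
  rw [mul_sum, mul_sum]
  refine sum_congr rfl fun m _ => ?_
  rw [← mul_sum]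
  simp only [κ, η]
  by_cases h1 : rA w a = ∅
  · simp [h1]
  by_cases h2 : rB w b = ∅
  · simp [h2]
  have h1' : (#(rA w a) : ℝ) ≠ 0 := by
    rw [Nat.cast_ne_zero]; exact card_ne_zero.2 (nonempty_iff_ne_empty.2 h1)
  have h2' : (#(rB w b) : ℝ) ≠ 0 := by
    rw [Nat.cast_ne_zero]; exact card_ne_zero.2 (nonempty_iff_ne_empty.2 h2)
  rw [mul_comm (_ / _) (_ / _), div_mul_div_comm, ← mul_assoc, mul_div_assoc', mul_comm (∑ x ∈ rA w a, _),
    mul_div_cancel_left₀ _ (mul_ne_zero h1' h2')]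

/-- Decoupling: if `W` is almost independent of the labels, then the mean outcomes under two label
distributions differ by little more than in one-way communication. -/
theorem decoupling_bound {X T 𝒲 A B Msg : Type*} [Nonempty T] [Fintype T]
    [Fintype A] [DecidableEq A] [Fintype B] [DecidableEq B] [Fintype Msg] [Nonempty Msg]
    (fib : T → Finset X) (hfib : ∀ t, (fib t).Nonempty)
    (W : (A → X) → (B → X) → 𝒲) (msg : (A → X) → (B → X) → Msg) (out : (A → X) → (B → X) → ℝ)
    (hout : ∀ a b, |out a b| ≤ 1)
    (hW : ∀ a b a' b', W a b = W a' b' → W a b' = W a b)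
    (hmsg : ∀ a a' b, W a b = W a' b → msg a b = msg a' b)
    (hdet : ∀ a b b', W a b = W a b' → msg a b = msg a b' → out a b = out a b')
    {δ : ℝ} (hδ : 0 ≤ δ)
    (hA : ∀ F : 𝒲 → ℝ, (∀ w, |F w| ≤ 1) → ∀ i a b t t',
      |𝔼 h ∈ fib t, F (W (Function.update a i h) b) -
        𝔼 h ∈ fib t', F (W (Function.update a i h) b)| ≤ δ)
    (hB : ∀ F : 𝒲 → ℝ, (∀ w, |F w| ≤ 1) → ∀ i a b t t',
      |𝔼 h ∈ fib t, F (W a (Function.update b i h)) -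
        𝔼 h ∈ fib t', F (W a (Function.update b i h))| ≤ δ)
    (μ ν : (A → T) → (B → T) → ℝ) (hμ : ∀ a b, 0 ≤ μ a b) (hν : ∀ a b, 0 ≤ ν a b)
    (hμ1 : ∑ a, ∑ b, μ a b = 1) (hν1 : ∑ a, ∑ b, ν a b = 1) {γ : ℝ}
    (hγ : ∀ (κ : Msg → (B → T) → ℝ) (η : Msg → (A → T) → ℝ), (∀ m b, 0 ≤ κ m b) →
      (∀ b, ∑ m, κ m b ≤ 1) → (∀ m a, |η m a| ≤ 1) →
      ∑ a, ∑ b, μ a b * ∑ m, κ m b * η m a - ∑ a, ∑ b, ν a b * ∑ m, κ m b * η m a ≤ γ) :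
    ∑ a, ∑ b, μ a b * (𝔼 x ∈ Fintype.piFinset fun i => fib (a i),
        𝔼 y ∈ Fintype.piFinset fun i => fib (b i), out x y) -
      ∑ a, ∑ b, ν a b * (𝔼 x ∈ Fintype.piFinset fun i => fib (a i),
        𝔼 y ∈ Fintype.piFinset fun i => fib (b i), out x y) ≤
      2 * ((Fintype.card A + Fintype.card B) * δ) + γ := by
  have hneA : ∀ a : A → T, (Fintype.piFinset fun i => fib (a i)).Nonempty := fun a =>
    Fintype.piFinset_nonempty.2 fun i => hfib _
  have hneB : ∀ b : B → T, (Fintype.piFinset fun i => fib (b i)).Nonempty := fun b =>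
    Fintype.piFinset_nonempty.2 fun i => hfib _
  set pA : (A → T) → Finset (A → X) := fun a => Fintype.piFinset fun i => fib (a i) with hpA
  set pB : (B → T) → Finset (B → X) := fun b => Fintype.piFinset fun i => fib (b i) with hpB
  obtain ⟨κ, η, hκ0, hκ1, hη1, hcond⟩ := exists_conditional_kernels pA pB W msg out hout hW hmsg hdet
  let H : (A → T) → (B → T) → 𝒲 → ℝ := fun a b w => ∑ m, κ w m b * η w m a
  have hH : ∀ a b w, |H a b w| ≤ 1 := by
    intro a b w
    refine (abs_sum_le_sum_abs _ _).trans (le_trans (sum_le_sum fun m _ => ?_) (hκ1 w b))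
    rw [abs_mul, abs_of_nonneg (hκ0 w m b)]
    exact mul_le_of_le_one_right (hκ0 w m b) (hη1 w m a)
  obtain ⟨t₀⟩ := ‹Nonempty T›
  -- The reference law of `W`: all labels are replaced by one fixed label.
  let E₀ : (𝒲 → ℝ) → ℝ := fun F => 𝔼 x ∈ pA fun _ => t₀, 𝔼 y ∈ pB fun _ => t₀, F (W x y)
  have hhyb : ∀ F : 𝒲 → ℝ, (∀ w, |F w| ≤ 1) → ∀ a b,
      |𝔼 x ∈ pA a, 𝔼 y ∈ pB b, F (W x y) - E₀ F| ≤
        (Fintype.card A + Fintype.card B) * δ := by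
    intro F hF a b
    have h1 : |𝔼 x ∈ pA a, 𝔼 y ∈ pB b, F (W x y) -
        𝔼 x ∈ pA a, 𝔼 y ∈ pB fun _ => t₀, F (W x y)| ≤ Fintype.card B * δ :=
      abs_expect_sub_expect_le _ _ _ (by positivity) fun x _ =>
        hybrid_bound fib hfib (fun y => F (W x y)) hδ (fun j y t t' => hB F hF j x y t t') _ _
    have h2 : |𝔼 x ∈ pA a, 𝔼 y ∈ pB fun _ => t₀, F (W x y) - E₀ F| ≤ Fintype.card A * δ := by
      simp only [E₀]
      rw [expect_comm, expect_comm (pA fun _ => t₀)]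
      exact abs_expect_sub_expect_le _ _ _ (by positivity) fun y _ =>
        hybrid_bound fib hfib (fun x => F (W x y)) hδ (fun j x t t' => hA F hF j x y t t') _ _
    calc _ ≤ _ := abs_sub_le _ _ _
      _ ≤ _ := add_le_add h1 h2
      _ = _ := by ring
  have hmean : ∀ θ : (A → T) → (B → T) → ℝ, (∀ a b, 0 ≤ θ a b) → ∑ a, ∑ b, θ a b = 1 →
      |∑ a, ∑ b, θ a b * (𝔼 x ∈ pA a, 𝔼 y ∈ pB b, out x y) -
        ∑ a, ∑ b, θ a b * E₀ (H a b)| ≤ (Fintype.card A + Fintype.card B) * δ := by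
    intro θ hθ hθ1
    rw [← sum_sub_distrib]
    simp_rw [← sum_sub_distrib, ← mul_sub]
    calc _ ≤ ∑ a, ∑ b, θ a b * ((Fintype.card A + Fintype.card B) * δ) := by
          refine (abs_sum_le_sum_abs _ _).trans (sum_le_sum fun a _ => ?_)
          refine (abs_sum_le_sum_abs _ _).trans (sum_le_sum fun b _ => ?_)
          rw [abs_mul, abs_of_nonneg (hθ a b)]
          refine mul_le_mul_of_nonneg_left ?_ (hθ a b)
          rw [hcond]
          exact hhyb _ (hH a b) a b
      _ = _ := by simp_rw [← sum_mul]; rw [hθ1, one_mul]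
  have hswap : ∀ θ : (A → T) → (B → T) → ℝ, ∑ a, ∑ b, θ a b * E₀ (H a b) =
      E₀ fun w => ∑ a, ∑ b, θ a b * H a b w := by
    intro θ
    simp only [E₀]
    simp_rw [mul_expect, ← expect_sum_comm]
  -- Now `W` does not depend on the labels, so the one-way bound applies for each of its values
  -- separately.
  have hideal : ∑ a, ∑ b, μ a b * E₀ (H a b) - ∑ a, ∑ b, ν a b * E₀ (H a b) ≤ γ := by
    rw [hswap, hswap]
    simp only [E₀]
    simp_rw [← expect_sub_distrib]
    exact expect_le (hneA _) fun x _ => expect_le (hneB _) fun y _ =>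
      hγ (κ (W x y)) (η (W x y)) (hκ0 _) (hκ1 _) (hη1 _)
  have h1 := abs_le.1 (hmean μ hμ hμ1)
  have h2 := abs_le.1 (hmean ν hν hν1)
  linarith [h1.1, h1.2, h2.1, h2.2]

end Decoupling

/-! ### Cutting off and simulating the last rounds of a protocol -/

section Protocols

/-- The player who has the turn after `r` more rounds. -/
def FinalMatching.Player.after : Player → ℕ → Player
  | p, 0 => p
  | p, r + 1 => p.other.after r

theorem FinalMatching.Player.after_succ (p : Player) (r : ℕ) :
    p.after (r + 1) = (p.after r).other := by
  induction r generalizing p with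
  | zero => rfl
  | succ r ih => exact ih p.other

namespace FinalMatching.Protocol

variable {In In' : Player → Type} {O O' : Type}

/-- The bits sent before the last round. -/
def pre (x : (p : Player) → In p) : {p : Player} → {r : ℕ} → Protocol In O p r → List Bool
  | _, 0, _ => []
  | _, 1, _ => []
  | p, _ + 2, .send f next => f (x p) :: (next (f (x p))).pre x
  | _, _ + 2, .endRound next => next.pre x

/-- The message of the last round, padded to an infinite sequence. -/
def lastMsg (x : (p : Player) → In p) : {p : Player} → {r : ℕ} → Protocol In O p r → ℕ → Bool
  | _, 0, _, _ => false
  | p, 1, .send f _, 0 => f (x p)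
  | p, 1, .send f next, i + 1 => (next (f (x p))).lastMsg x i
  | _, 1, .endRound _, _ => false
  | p, _ + 2, .send f next, i => (next (f (x p))).lastMsg x i
  | _, _ + 2, .endRound next, i => next.lastMsg x i

/-- The protocol that stops before the last round; the player who has the turn then outputs a
function of the bits sent so far and of its input. -/
def chop : {p : Player} → {r : ℕ} → (List Bool → (p : Player) → In p → O') →
    Protocol In O p r → Protocol In O' p (r - 1)
  | p, 0, ρ, _ => .output (ρ [] p)
  | p, 1, ρ, _ => .output (ρ [] p)
  | _, _ + 2, ρ, .send f next => .send f fun b => chop (fun l => ρ (b :: l)) (next b)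
  | _, _ + 2, ρ, .endRound next => .endRound (chop ρ next)

/-- The protocol obtained by translating the inputs. -/
def comap (e : (p : Player) → In' p → In p) : {p : Player} → {r : ℕ} → Protocol In O p r →
    Protocol In' O p r
  | p, _, .output f => .output fun v => f (e p v)
  | p, _, .send f next => .send (fun v => f (e p v)) fun b => (next b).comap e
  | _, _, .endRound next => .endRound (next.comap e)

/-- The protocol obtained by exchanging the players and translating the inputs. -/
def comapSwap (e : (p : Player) → In' p.other → In p) : {p : Player} → {r : ℕ} →
    Protocol In O p r → Protocol In' O p.other r
  | p, _, .output f => .output fun v => f (e p v)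
  | p, _, .send f next => .send (fun v => f (e p v)) fun b => (next b).comapSwap e
  | _, _, .endRound next => .endRound (next.comapSwap e)

theorem pre_send (x : (p : Player) → In p) {p : Player} {r : ℕ} (f : In p → Bool)
    (next : Bool → Protocol In O p (r + 1 + 1)) :
    (send f next).pre x = f (x p) :: (next (f (x p))).pre x := by rw [pre]

theorem pre_endRound (x : (p : Player) → In p) {p : Player} {r : ℕ}
    (next : Protocol In O p.other (r + 1)) : (endRound next).pre x = next.pre x := by rw [pre]

theorem pre_one (x : (p : Player) → In p) {p : Player} (π : Protocol In O p (0 + 1)) :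
    π.pre x = [] := by unfold pre; rfl

theorem lastMsg_send (x : (p : Player) → In p) {p : Player} {r : ℕ} (f : In p → Bool)
    (next : Bool → Protocol In O p (r + 1 + 1)) :
    (send f next).lastMsg x = (next (f (x p))).lastMsg x := by funext i; rw [lastMsg]

theorem lastMsg_endRound (x : (p : Player) → In p) {p : Player} {r : ℕ}
    (next : Protocol In O p.other (r + 1)) : (endRound next).lastMsg x = next.lastMsg x := by
  funext i; rw [lastMsg]

theorem lastMsg_send_zero (x : (p : Player) → In p) {p : Player} (f : In p → Bool)
    (next : Bool → Protocol In O p (0 + 1)) : (send f next).lastMsg x 0 = f (x p) := by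
  rw [lastMsg]

theorem lastMsg_send_succ (x : (p : Player) → In p) {p : Player} (f : In p → Bool)
    (next : Bool → Protocol In O p (0 + 1)) (i : ℕ) :
    (send f next).lastMsg x (i + 1) = (next (f (x p))).lastMsg x i := by rw [lastMsg]

theorem chop_send (ρ : List Bool → (p : Player) → In p → O') {p : Player} {r : ℕ} (f : In p → Bool)
    (next : Bool → Protocol In O p (r + 1 + 1)) :
    chop ρ (send f next) = .send f fun b => chop (fun l => ρ (b :: l)) (next b) := by rw [chop]

theorem chop_endRound (ρ : List Bool → (p : Player) → In p → O') {p : Player} {r : ℕ}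
    (next : Protocol In O p.other (r + 1)) :
    chop ρ (endRound next) = .endRound (chop ρ next) := by rw [chop]

theorem chop_one (ρ : List Bool → (p : Player) → In p → O') {p : Player}
    (π : Protocol In O p (0 + 1)) : chop ρ π = .output (ρ [] p) := by unfold chop; rfl

/-- The speaker of the last round becomes the player with the output. Thus any function of the
earlier transcript and this player's input is the outcome of a protocol with one round less. -/
theorem run_chop (x : (p : Player) → In p) {p : Player} {r : ℕ} (π : Protocol In O p r) :
    ∀ ρ : List Bool → (p : Player) → In p → O',
    (chop ρ π).run x = ρ (π.pre x) (p.after (r - 1)) (x (p.after (r - 1))) := by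
  induction π with
  | output f => intro ρ; rfl
  | @send p r f next ih =>
    intro ρ
    cases r with
    | zero => rw [chop_one, pre_one]; rfl
    | succ r => rw [chop_send, pre_send, run]; exact ih _ _
  | @endRound p r next ih =>
    intro ρ
    cases r with
    | zero => rw [chop_one, pre_one]; rfl
    | succ r => rw [chop_endRound, pre_endRound, run]; exact ih _

theorem bits_chop_le (x : (p : Player) → In p) {p : Player} {r : ℕ} (π : Protocol In O p r) :
    ∀ ρ : List Bool → (p : Player) → In p → O', (chop ρ π).bits x ≤ π.bits x := by
  induction π with
  | output f => intro ρ; exact le_rfl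
  | @send p r f next ih =>
    intro ρ
    cases r with
    | zero => rw [chop_one]; exact Nat.zero_le _
    | succ r => rw [chop_send, bits, bits]; exact Nat.succ_le_succ (ih _ _)
  | @endRound p r next ih =>
    intro ρ
    cases r with
    | zero => rw [chop_one]; exact Nat.zero_le _
    | succ r => rw [chop_endRound, bits, bits]; exact ih _

theorem bits_comap (e : (p : Player) → In' p → In p) (x : (p : Player) → In' p) {p : Player}
    {r : ℕ} (π : Protocol In O p r) : (π.comap e).bits x = π.bits fun p => e p (x p) := by
  induction π with
  | output f => rfl
  | send f next ih => exact congrArg (· + 1) (ih _)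
  | endRound next ih => exact ih

theorem bits_comapSwap (e : (p : Player) → In' p.other → In p) (x : (p : Player) → In' p)
    {p : Player} {r : ℕ} (π : Protocol In O p r) :
    (π.comapSwap e).bits x = π.bits fun p => e p (x p.other) := by
  induction π with
  | output f => rfl
  | send f next ih => exact congrArg (· + 1) (ih _)
  | endRound next ih => exact ih

theorem pre_comap (e : (p : Player) → In' p → In p) (x : (p : Player) → In' p) {p : Player}
    {r : ℕ} (π : Protocol In O p r) : (π.comap e).pre x = π.pre fun p => e p (x p) := by
  induction π with
  | output f => rfl
  | @send p r f next ih =>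
    cases r with
    | zero => rw [pre_one, pre_one]
    | succ r => rw [comap, pre_send, pre_send, ih]
  | @endRound p r next ih =>
    cases r with
    | zero => rw [pre_one, pre_one]
    | succ r => rw [comap, pre_endRound, pre_endRound, ih]

theorem pre_comapSwap (e : (p : Player) → In' p.other → In p) (x : (p : Player) → In' p)
    {p : Player} {r : ℕ} (π : Protocol In O p r) :
    (π.comapSwap e).pre x = π.pre fun p => e p (x p.other) := by
  induction π with
  | output f => rfl
  | @send p r f next ih =>
    cases r with
    | zero => rw [pre_one, pre_one]
    | succ r => rw [comapSwap, pre_send, pre_send, ih]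
  | @endRound p r next ih =>
    cases r with
    | zero => rw [pre_one, pre_one]
    | succ r => rw [comapSwap, pre_endRound, pre_endRound, ih]

/-- Transcripts have the rectangle property. -/
theorem pre_rectangle {x y z : (p : Player) → In p} (hz : ∀ p, z p = x p ∨ z p = y p)
    {p : Player} {r : ℕ} (π : Protocol In O p r) : π.pre x = π.pre y → π.pre z = π.pre x := by
  induction π with
  | output f => intro _; rfl
  | @send p r f next ih =>
    cases r with
    | zero => intro _; rw [pre_one, pre_one]
    | succ r =>
      simp only [pre_send, List.cons.injEq]
      rintro ⟨h1, h2⟩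
      have hb : f (z p) = f (x p) := by
        rcases hz p with h' | h'
        · rw [h']
        · rw [h', h1]
      refine ⟨hb, ?_⟩
      rw [hb]
      refine ih _ ?_
      rw [h2, h1]
  | @endRound p r next ih =>
    cases r with
    | zero => intro _; rw [pre_one, pre_one]
    | succ r => simpa only [pre_endRound] using ih

/-- The earlier transcript fixes the node at which the last round starts, and from there on only one
player's input is consulted. -/
theorem lastMsg_congr {x y : (p : Player) → In p} {p : Player} {r : ℕ} (π : Protocol In O p r) :
    π.pre x = π.pre y → x (p.after (r - 1)) = y (p.after (r - 1)) →
    π.lastMsg x = π.lastMsg y := by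
  induction π with
  | output f => intro _ _; rfl
  | @send p r f next ih =>
    cases r with
    | zero =>
      intro _ hp
      have hp' : x p = y p := hp
      funext i
      cases i with
      | zero => rw [lastMsg_send_zero, lastMsg_send_zero, hp']
      | succ i =>
        rw [lastMsg_send_succ, lastMsg_send_succ, hp',
          ih (f (y p)) (by rw [pre_one, pre_one]) hp]
    | succ r =>
      simp only [pre_send, List.cons.injEq]
      rintro ⟨h1, h2⟩ hp
      rw [h1] at h2
      rw [lastMsg_send, lastMsg_send, h1, ih _ h2 hp]
  | @endRound p r next ih =>
    cases r with
    | zero => intro _ _; funext i; rw [lastMsg, lastMsg]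
    | succ r =>
      simp only [pre_endRound]
      intro h hp
      rw [lastMsg_endRound, lastMsg_endRound, ih h hp]

/-- The padded message does not show where the round ends, but the protocol tree does. Following
equal bits leads to the same leaf, and the bound on the cost makes the first `C` bits suffice. -/
theorem run_congr {x y : (p : Player) → In p} {p : Player} {r : ℕ} (π : Protocol In O p r) :
    ∀ C : ℕ, π.pre x = π.pre y → x (p.after r) = y (p.after r) →
    (∀ i < C, π.lastMsg x i = π.lastMsg y i) → π.bits x ≤ C → π.bits y ≤ C →
    π.run x = π.run y := by
  induction π with
  | output f => intro C _ h _ _ _; exact congrArg f h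
  | @send p r f next ih =>
    intro C
    rw [bits, bits, run, run]
    cases r with
    | zero =>
      intro _ hp hm hx hy
      obtain ⟨C, rfl⟩ : ∃ C', C = C' + 1 := ⟨C - 1, by omega⟩
      have hb := hm 0 (by omega)
      rw [lastMsg_send_zero, lastMsg_send_zero] at hb
      rw [hb] at hx ⊢
      refine ih _ C (by rw [pre_one, pre_one]) hp ?_ (by omega) (by omega)
      intro i hi
      have := hm (i + 1) (by omega)
      rwa [lastMsg_send_succ, lastMsg_send_succ, hb] at this
    | succ r =>
      simp only [pre_send, List.cons.injEq]
      rintro ⟨h1, h2⟩ hp hm hx hy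
      rw [lastMsg_send, lastMsg_send] at hm
      rw [h1] at h2 hm hx ⊢
      exact ih _ C h2 hp hm (by omega) (by omega)
  | @endRound p r next ih =>
    intro C
    cases r with
    | zero =>
      cases next
      intro _ hp _ _ _
      exact congrArg _ hp
    | succ r =>
      rw [pre_endRound, pre_endRound, lastMsg_endRound, lastMsg_endRound]
      exact ih C

/-- The bits of the last round but one can be recomputed by their sender. This saves the round that
the odd blocks need because the wrong player starts there. -/
theorem pre_congr_of_pre_chop {x y : (p : Player) → In p} {p : Player} {r : ℕ}
    (π : Protocol In O p r) : ∀ ρ : List Bool → (p : Player) → In p → O',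
    (chop ρ π).pre x = (chop ρ π).pre y → x (p.after (r - 2)) = y (p.after (r - 2)) →
    π.pre x = π.pre y := by
  induction π with
  | output f => intro _ _ _; rfl
  | @send p r f next ih =>
    intro ρ
    match r, next, ih with
    | 0, next, ih => intro _ _; rw [pre_one, pre_one]
    -- Two rounds remain, the current one being the last but one. Its bits are invisible after
    -- chopping, but they depend on the input of `p` only.
    | 1, next, ih =>
      intro _ hp
      have hp' : x p = y p := hp
      rw [pre_send, pre_send, hp', ih (f (y p)) ρ (by unfold pre; rfl) hp]
    | r + 2, next, ih =>
      rw [chop_send]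
      intro h hp
      obtain ⟨h1, h2⟩ := List.cons.inj
        (h : f (x p) :: (chop (fun l => ρ (f (x p) :: l)) (next (f (x p)))).pre x
          = f (y p) :: (chop (fun l => ρ (f (y p) :: l)) (next (f (y p)))).pre y)
      rw [h1] at h2
      rw [pre_send, pre_send, h1, ih _ _ h2 hp]
  | @endRound p r next ih =>
    intro ρ
    match r, next, ih with
    | 0, next, ih => intro _ _; rw [pre_one, pre_one]
    | 1, next, ih => intro _ _; rw [pre_endRound, pre_endRound]; unfold pre; rfl
    | r + 2, next, ih =>
      rw [chop_endRound, pre_endRound, pre_endRound]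
      exact ih ρ

end FinalMatching.Protocol

end Protocols

namespace FinalMatching

/-! ### Following edges, with all layers embedded into ℕ -/

section Walks

/-- The inclusion of `Fin n` into `ℕ` as a partial bijection. -/
def finNat (n : ℕ) : Fin n ≃. ℕ where
  toFun v := some v.val
  invFun a := if h : a < n then some ⟨a, h⟩ else none
  inv a b := by
    by_cases h : b < n
    · simp [h, Fin.ext_iff, eq_comm]
    · simp only [h, dif_neg, not_false_eq_true, reduceCtorEq, Option.some.injEq,
        false_iff]
      rintro rfl
      exact h a.2

/-- A partial bijection between `Fin a` and `Fin b`, seen as one of `ℕ`. -/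
def up {a b : ℕ} (M : Fin a ≃. Fin b) : ℕ ≃. ℕ := (finNat a).symm.trans (M.trans (finNat b))

theorem up_eq_some {a b : ℕ} {M : Fin a ≃. Fin b} {x y : ℕ} :
    up M x = some y ↔ ∃ (hx : x < a) (hy : y < b), M ⟨x, hx⟩ = some ⟨y, hy⟩ := by
  simp only [up, PEquiv.trans_eq_some, PEquiv.eq_some_iff]
  constructor
  · rintro ⟨v, hv, w, hw, hw'⟩
    have hv' : v.val = x := by simpa [finNat] using hv
    have hw'' : w.val = y := by simpa [finNat] using hw'
    subst hv' hw''
    exact ⟨v.2, w.2, hw⟩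
  · rintro ⟨hx, hy, h⟩
    exact ⟨⟨x, hx⟩, rfl, ⟨y, hy⟩, h, rfl⟩

theorem up_injective {a b : ℕ} : Function.Injective (up : (Fin a ≃. Fin b) → (ℕ ≃. ℕ)) := by
  intro M M' h
  ext v w
  have h1 : up M v = some w.val ↔ up M' v = some w.val := by rw [h]
  simpa [up_eq_some] using h1

theorem up_symm {a b : ℕ} (M : Fin a ≃. Fin b) : up M.symm = (up M).symm := by
  ext x y
  have h1 := up_eq_some (M := M.symm) (x := x) (y := y)
  have h2 := up_eq_some (M := M) (x := y) (y := x)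
  simp only [PEquiv.eq_some_iff] at *
  rw [h1, h2]
  exact ⟨fun ⟨h, h', e⟩ => ⟨h', h, e⟩, fun ⟨h, h', e⟩ => ⟨h', h, e⟩⟩

theorem up_trans {a b c : ℕ} (M : Fin a ≃. Fin b) (M' : Fin b ≃. Fin c) :
    up (M.trans M') = (up M).trans (up M') := by
  ext x y
  simp only [PEquiv.trans_eq_some, up_eq_some]
  constructor
  · rintro ⟨hx, hy, v, h1, h2⟩
    exact ⟨v, ⟨hx, v.2, h1⟩, v.2, hy, h2⟩
  · rintro ⟨v, ⟨hx, hv, h1⟩, _, hy, h2⟩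
    exact ⟨hx, hy, _, h1, h2⟩

/-- The number of elements in the domain of a partial bijection. -/
noncomputable def cnt {α β : Type*} (f : α ≃. β) : ℕ := {a | (f a).isSome}.ncard

theorem cnt_symm {α β : Type*} (f : α ≃. β) : cnt f.symm = cnt f := by
  refine (Set.ncard_congr (fun a (h : (f a).isSome) => (f a).get h) ?_ ?_ ?_).symm
  · intro a h
    have : f.symm ((f a).get h) = some a := (PEquiv.eq_some_iff _).2 (by simp)
    simp [this]
  · intro a a' h h' e
    exact f.inj (Option.get_mem h) (by rw [e]; exact Option.get_mem h')
  · intro b h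
    obtain ⟨a, ha⟩ := Option.isSome_iff_exists.1 h
    have := (PEquiv.eq_some_iff _).1 ha
    exact ⟨a, Option.isSome_iff_exists.2 ⟨b, this⟩, Option.get_of_eq_some _ this⟩

theorem cnt_up {a b : ℕ} (M : Fin a ≃. Fin b) : cnt (up M) = cnt M := by
  symm
  refine Set.ncard_congr (fun v _ => v.val) ?_ ?_ ?_
  · intro v h
    obtain ⟨w, hw⟩ := Option.isSome_iff_exists.1 h
    have : up M v = some w.val := up_eq_some.2 ⟨v.2, w.2, hw⟩
    simp [this]
  · intro v w _ _ h
    exact Fin.ext h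
  · intro x h
    obtain ⟨y, hy⟩ := Option.isSome_iff_exists.1 h
    obtain ⟨hx, hy', h⟩ := up_eq_some.1 hy
    exact ⟨⟨x, hx⟩, by simp [h], rfl⟩

theorem cnt_eq_iff_total {f : ℕ ≃. ℕ} {n : ℕ} (hf : ∀ a b, f a = some b → a < n) :
    cnt f = n ↔ ∀ a < n, (f a).isSome := by
  have hsub : {a | (f a).isSome} ⊆ Set.Iio n := by
    intro a h
    obtain ⟨b, hb⟩ := Option.isSome_iff_exists.1 h
    exact hf a b hb
  have hn : (Set.Iio n).ncard = n := by
    rw [← Nat.card_coe_set_eq, Nat.card_eq_fintype_card]; simp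
  constructor
  · intro h a ha
    have := Set.eq_of_subset_of_ncard_le hsub (by rw [hn]; exact h.ge) (Set.finite_Iio n)
    have ha' : a ∈ {a | (f a).isSome} := by rw [this]; exact ha
    exact ha'
  · intro h
    have : {a | (f a).isSome} = Set.Iio n := Set.Subset.antisymm hsub fun a ha => h a ha
    rw [cnt, this, hn]

theorem cnt_trans_of_total {f g : ℕ ≃. ℕ} (h : ∀ a b, f a = some b → (g b).isSome) :
    cnt (f.trans g) = cnt f := by
  unfold cnt
  congr 1
  ext a
  simp only [Set.mem_ofPred_eq, Option.isSome_iff_exists, PEquiv.trans_eq_some]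
  constructor
  · rintro ⟨c, b, h1, _⟩
    exact ⟨b, h1⟩
  · rintro ⟨b, h1⟩
    obtain ⟨c, hc⟩ := Option.isSome_iff_exists.1 (h a b h1)
    exact ⟨c, b, h1, hc⟩

theorem cnt_trans_of_cototal {f g : ℕ ≃. ℕ} (h : ∀ b c, g b = some c → (f.symm b).isSome) :
    cnt (f.trans g) = cnt g := by
  rw [← cnt_symm, ← cnt_symm g, PEquiv.symm_trans_rev]
  refine cnt_trans_of_total fun c b hb => ?_
  rw [PEquiv.eq_some_iff] at hb
  exact h b c hb

/-- The edges at position `i` join layer `i` to layer `i + 1`. -/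
def Supported (E : ℕ → (ℕ ≃. ℕ)) (t : ℕ → ℕ) (i : ℕ) : Prop :=
  ∀ a b, E i a = some b → a < t i ∧ b < t (i + 1)

/-- Following the edges from layer `i` to layer `i + d`. -/
def walk (E : ℕ → (ℕ ≃. ℕ)) (t : ℕ → ℕ) (i : ℕ) : ℕ → (ℕ ≃. ℕ)
  | 0 => PEquiv.ofSet {a | a < t i}
  | d + 1 => (walk E t i d).trans (E (i + d))

theorem walk_lt {E : ℕ → (ℕ ≃. ℕ)} {t : ℕ → ℕ} {i d : ℕ}
    (h : ∀ j, i ≤ j → j < i + d → Supported E t j) {a b : ℕ} (hab : walk E t i d a = some b) :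
    a < t i ∧ b < t (i + d) := by
  induction d generalizing b with
  | zero =>
    simp only [walk, PEquiv.ofSet_eq_some_iff] at hab
    obtain ⟨rfl, h⟩ := hab
    exact ⟨h, h⟩
  | succ d ih =>
    simp only [walk, PEquiv.trans_eq_some] at hab
    obtain ⟨c, h1, h2⟩ := hab
    exact ⟨(ih (fun j hj hj' => h j hj (by omega)) h1).1, (h (i + d) (by omega) (by omega) _ _ h2).2⟩

theorem walk_add {E : ℕ → (ℕ ≃. ℕ)} {t : ℕ → ℕ} {i d : ℕ}
    (h : ∀ j, i ≤ j → j < i + d → Supported E t j) (e : ℕ) :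
    walk E t i (d + e) = (walk E t i d).trans (walk E t (i + d) e) := by
  induction e with
  | zero =>
    ext a b
    simp only [walk, Nat.add_zero, PEquiv.trans_eq_some, PEquiv.ofSet_eq_some_iff]
    constructor
    · intro hab
      exact ⟨b, hab, rfl, (walk_lt h hab).2⟩
    · rintro ⟨c, hc, rfl, _⟩
      exact hc
  | succ e ih =>
    rw [← Nat.add_assoc, walk, ih, walk, PEquiv.trans_assoc, Nat.add_assoc]

theorem walk_shift {E E' : ℕ → (ℕ ≃. ℕ)} {t t' : ℕ → ℕ} {i i' d : ℕ} (ht : t i = t' i')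
    (h : ∀ j < d, E (i + j) = E' (i' + j)) : walk E t i d = walk E' t' i' d := by
  induction d with
  | zero => simp only [walk, ht]
  | succ d ih =>
    rw [walk, walk, ih fun j hj => h j (by omega), h d (by omega)]

/-- Between any two of the layers `a, …, b`, as many vertices as possible are connected. -/
def NiceSeg (E : ℕ → (ℕ ≃. ℕ)) (t : ℕ → ℕ) (a b : ℕ) : Prop :=
  ∀ i d, a ≤ i → i + d ≤ b → cnt (walk E t i d) = (Finset.Icc i (i + d)).inf' ⟨i, by simp⟩ t

theorem NiceSeg.mono {E : ℕ → (ℕ ≃. ℕ)} {t : ℕ → ℕ} {a b a' b' : ℕ} (h : NiceSeg E t a b)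
    (ha : a ≤ a') (hb : b' ≤ b) : NiceSeg E t a' b' :=
  fun i d hi hd => h i d (by omega) (by omega)

theorem NiceSeg.shift {E E' : ℕ → (ℕ ≃. ℕ)} {t t' : ℕ → ℕ} {p p' l : ℕ}
    (ht : ∀ j ≤ l, t (p + j) = t' (p' + j)) (hE : ∀ j < l, E (p + j) = E' (p' + j))
    (h : NiceSeg E t p (p + l)) : NiceSeg E' t' p' (p' + l) := by
  intro i d hi hd
  obtain ⟨j, rfl⟩ := Nat.exists_eq_add_of_le hi
  have h1 := h (p + j) d (by omega) (by omega)
  rw [walk_shift (E' := E') (t' := t') (i' := p' + j) (ht j (by omega))] at h1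
  · rw [h1]
    refine le_antisymm (Finset.le_inf' _ _ fun x hx => ?_) (Finset.le_inf' _ _ fun x hx => ?_)
    · rw [Finset.mem_Icc] at hx
      obtain ⟨y, rfl⟩ := Nat.exists_eq_add_of_le (show p' ≤ x by omega)
      rw [← ht y (by omega)]
      exact Finset.inf'_le _ (by rw [Finset.mem_Icc]; omega)
    · rw [Finset.mem_Icc] at hx
      obtain ⟨y, rfl⟩ := Nat.exists_eq_add_of_le (show p ≤ x by omega)
      rw [ht y (by omega)]
      exact Finset.inf'_le _ (by rw [Finset.mem_Icc]; omega)
  · intro x hx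
    have := hE (j + x) (by omega)
    rwa [← Nat.add_assoc, ← Nat.add_assoc] at this

theorem inf'_Icc_extend_right {t : ℕ → ℕ} {i p q : ℕ} (hip : i ≤ p) (hpq : p ≤ q)
    (h : ∀ j, p ≤ j → j ≤ q → t p ≤ t j) :
    (Finset.Icc i q).inf' ⟨i, by simp; omega⟩ t = (Finset.Icc i p).inf' ⟨i, by simp; omega⟩ t := by
  refine le_antisymm (Finset.le_inf' _ _ fun x hx => Finset.inf'_le _ ?_)
    (Finset.le_inf' _ _ fun x hx => ?_)
  · rw [Finset.mem_Icc] at *; omega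
  · rw [Finset.mem_Icc] at hx
    by_cases hxp : x ≤ p
    · exact Finset.inf'_le _ (by rw [Finset.mem_Icc]; omega)
    · exact (Finset.inf'_le _ (show p ∈ _ by rw [Finset.mem_Icc]; omega)).trans
        (h x (by omega) hx.2)

theorem inf'_Icc_extend_left {t : ℕ → ℕ} {i p q : ℕ} (hip : i ≤ p) (hpq : p ≤ q)
    (h : ∀ j, i ≤ j → j ≤ p → t p ≤ t j) :
    (Finset.Icc i q).inf' ⟨i, by simp; omega⟩ t = (Finset.Icc p q).inf' ⟨p, by simp; omega⟩ t := by
  refine le_antisymm (Finset.le_inf' _ _ fun x hx => Finset.inf'_le _ ?_)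
    (Finset.le_inf' _ _ fun x hx => ?_)
  · rw [Finset.mem_Icc] at *; omega
  · rw [Finset.mem_Icc] at hx
    by_cases hxp : p ≤ x
    · exact Finset.inf'_le _ (by rw [Finset.mem_Icc]; omega)
    · exact (Finset.inf'_le _ (show p ∈ _ by rw [Finset.mem_Icc]; omega)).trans
        (h x hx.1 (by omega))

theorem inf'_Icc_eq_left {t : ℕ → ℕ} {p q : ℕ} (hpq : p ≤ q)
    (h : ∀ j, p ≤ j → j ≤ q → t p ≤ t j) :
    (Finset.Icc p q).inf' ⟨p, by simp; omega⟩ t = t p := by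
  rw [inf'_Icc_extend_right le_rfl hpq h]
  simp

theorem inf'_Icc_eq_right {t : ℕ → ℕ} {p q : ℕ} (hpq : p ≤ q)
    (h : ∀ j, p ≤ j → j ≤ q → t q ≤ t j) :
    (Finset.Icc p q).inf' ⟨p, by simp; omega⟩ t = t q := by
  rw [inf'_Icc_extend_left hpq le_rfl h]
  simp

theorem NiceSeg.total {E : ℕ → (ℕ ≃. ℕ)} {t : ℕ → ℕ} {p d : ℕ} (h : NiceSeg E t p (p + d))
    (hE : ∀ j, p ≤ j → j < p + d → Supported E t j)
    (ht : ∀ j, p ≤ j → j ≤ p + d → t p ≤ t j) {a : ℕ} (ha : a < t p) :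
    (walk E t p d a).isSome := by
  have h1 := h p d le_rfl le_rfl
  rw [inf'_Icc_eq_left (by omega) ht] at h1
  exact (cnt_eq_iff_total fun a b hab => (walk_lt hE hab).1).1 h1 a ha

theorem NiceSeg.cototal {E : ℕ → (ℕ ≃. ℕ)} {t : ℕ → ℕ} {p d : ℕ} (h : NiceSeg E t p (p + d))
    (hE : ∀ j, p ≤ j → j < p + d → Supported E t j)
    (ht : ∀ j, p ≤ j → j ≤ p + d → t (p + d) ≤ t j) {a : ℕ} (ha : a < t (p + d)) :
    ((walk E t p d).symm a).isSome := by
  have h1 := h p d le_rfl le_rfl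
  rw [inf'_Icc_eq_right (by omega) ht, ← cnt_symm] at h1
  exact (cnt_eq_iff_total fun a b hab =>
    (walk_lt hE ((PEquiv.eq_some_iff _).1 hab)).2).1 h1 a ha

/-- As layer `p` is smallest on the right, all its vertices continue to the right. A walk across `p`
therefore loses nothing after `p`, and the minimum of the sizes is attained up to `p`. -/
theorem NiceSeg.glue_right {E : ℕ → (ℕ ≃. ℕ)} {t : ℕ → ℕ} {a p b : ℕ}
    (hE : ∀ j, a ≤ j → j < b → Supported E t j)
    (h1 : NiceSeg E t a p) (h2 : NiceSeg E t p b)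
    (ht : ∀ j, p ≤ j → j ≤ b → t p ≤ t j) : NiceSeg E t a b := by
  intro i d hi hd
  by_cases hp : i + d ≤ p
  · exact h1 i d hi hp
  by_cases hp' : p ≤ i
  · exact h2 i d hp' hd
  obtain ⟨d1, rfl⟩ : ∃ d1, p = i + d1 := ⟨p - i, by omega⟩
  obtain ⟨d2, rfl⟩ : ∃ d2, d = d1 + d2 := ⟨d - d1, by omega⟩
  rw [walk_add fun j hj hj' => hE j (by omega) (by omega), cnt_trans_of_total,
    h1 i d1 hi le_rfl]
  · exact (inf'_Icc_extend_right (by omega) (by omega) fun j hj hj' => ht j hj (by omega)).symm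
  · intro x y hxy
    refine (h2.mono le_rfl (show i + d1 + d2 ≤ b by omega)).total
      (fun j hj hj' => hE j (by omega) (by omega)) (fun j hj hj' => ht j hj (by omega)) ?_
    exact (walk_lt (fun j hj hj' => hE j (by omega) (by omega)) hxy).2

/-- Layers `0` and `b` may be smaller than layer `p`. A walk that ends before `b` loses nothing
after `p`, and one that starts after `0` loses nothing before `p`; only the walk from `0` to `b` is
not controlled by its two parts. -/
theorem NiceSeg.glue_full {E : ℕ → (ℕ ≃. ℕ)} {t : ℕ → ℕ} {p b : ℕ} (hpb : p < b)
    (hE : ∀ j < b, Supported E t j)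
    (h1 : NiceSeg E t 0 p) (h2 : NiceSeg E t p b)
    (ht : ∀ j, 0 < j → j < b → t p ≤ t j)
    (hfull : cnt (walk E t 0 b) = (Finset.Icc 0 (0 + b)).inf' ⟨0, by simp⟩ t) :
    NiceSeg E t 0 b := by
  intro i d hi hd
  by_cases hdb : i + d < b
  · exact (NiceSeg.glue_right (b := i + d) (p := p) (a := 0) (fun j _ hj => hE j (by omega)) h1
      (h2.mono le_rfl (by omega)) (fun j hj hj' => by
        rcases Nat.eq_zero_or_pos j with h0 | h0
        · have : p = j := by omega
          rw [this]
        · exact ht j h0 (by omega))) i d hi le_rfl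
  · have hib : i + d = b := by omega
    by_cases hp' : p ≤ i
    · exact h2 i d hp' hd
    rcases Nat.eq_zero_or_pos i with h0 | h0
    · subst h0
      have : d = b := by omega
      subst this
      exact hfull
    · obtain ⟨d1, rfl⟩ : ∃ d1, p = i + d1 := ⟨p - i, by omega⟩
      obtain ⟨d2, rfl⟩ : ∃ d2, d = d1 + d2 := ⟨d - d1, by omega⟩
      rw [walk_add fun j hj hj' => hE j (by omega), cnt_trans_of_cototal,
        h2 (i + d1) d2 le_rfl (by omega)]
      · have := inf'_Icc_extend_left (t := t) (i := i) (p := i + d1) (q := i + (d1 + d2))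
          (by omega) (by omega) fun j hj hj' => ht j (by omega) (by omega)
        simp only [← Nat.add_assoc] at this ⊢
        exact this.symm
      · intro x y hxy
        refine (h1.mono (Nat.zero_le i) le_rfl).cototal
          (fun j hj hj' => hE j (by omega)) (fun j hj hj' => ht j (by omega) (by omega)) ?_
        exact (walk_lt (fun j hj hj' => hE j (by omega)) hxy).1

end Walks

/-! ### Niceness and connectivity in terms of walks -/

section Edges

variable {k : ℕ} {t : ℕ → ℕ}

/-- The edge sets of a layered graph as partial bijections of `ℕ`. -/
def LayeredGraph.edge (G : LayeredGraph k t) (i : ℕ) : ℕ ≃. ℕ :=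
  if h : i < k then up (G ⟨i, h⟩).1 else ⊥

theorem LayeredGraph.edge_of_lt (G : LayeredGraph k t) {i : ℕ} (h : i < k) :
    LayeredGraph.edge G i = up (G ⟨i, h⟩).1 := dif_pos h

theorem LayeredGraph.supported (G : LayeredGraph k t) (i : ℕ) :
    Supported (LayeredGraph.edge G) t i := by
  intro a b hab
  by_cases h : i < k
  · rw [LayeredGraph.edge_of_lt G h] at hab
    obtain ⟨h1, h2, _⟩ := up_eq_some.1 hab
    exact ⟨h1, h2⟩
  · simp [LayeredGraph.edge, h] at hab

theorem LayeredGraph.up_path (G : LayeredGraph k t) (i : ℕ) : ∀ (d : ℕ) (h : i + d ≤ k),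
    up (LayeredGraph.path G i d h) = walk (LayeredGraph.edge G) t i d
  | 0, h => by
    ext a b
    simp only [LayeredGraph.path, walk, up_eq_some, PEquiv.ofSet_eq_some_iff]
    simp
    constructor
    · rintro ⟨h1, h2, rfl⟩; exact ⟨rfl, h1⟩
    · rintro ⟨rfl, h1⟩; exact ⟨h1, h1, rfl⟩
  | d + 1, h => by
    rw [LayeredGraph.path, walk, up_trans, LayeredGraph.up_path G i d,
      LayeredGraph.edge_of_lt G (by omega)]

theorem LayeredGraph.nice_iff (G : LayeredGraph k t) :
    LayeredGraph.Nice G ↔ NiceSeg (LayeredGraph.edge G) t 0 k := by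
  constructor
  · intro h i d _ hd
    rw [← LayeredGraph.up_path G i d hd, cnt_up]
    exact h i d hd
  · intro h i d hd
    have := h i d (Nat.zero_le _) hd
    rw [← LayeredGraph.up_path G i d hd, cnt_up] at this
    exact this

theorem LayeredGraph.joins_iff (G : LayeredGraph k t) (a b : ℕ) :
    LayeredGraph.Joins G a b ↔ walk (LayeredGraph.edge G) t 0 k a = some b := by
  rw [← LayeredGraph.up_path G 0 k (by omega), up_eq_some]
  constructor
  · rintro ⟨v, w, rfl, rfl, h⟩
    exact ⟨v.2, w.2, h⟩
  · rintro ⟨h1, h2, h⟩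
    exact ⟨_, _, rfl, rfl, h⟩

end Edges

/-! ### Arithmetic of the layer sizes -/

section Nest

/-- The definition peels off the last entry of `S`, the argument the first one. In this form the
interior of nest(c, S) is visibly a repetition of nest(c, S_{≥2}). -/
theorem nest_succ {c : ℕ} (hc : 0 < c) : ∀ {n : ℕ} (S : Fin (n + 2) → ℕ) (m : ℕ),
    nest c S m = if (2 * c) ^ (n + 1) ∣ m then S 0 else nest c (Fin.tail S) m := by
  have h2 : 2 * c - 1 + 1 = 2 * c := by omega
  intro n
  induction n with
  | zero =>
    intro S m
    simp only [nest, plug, h2, zero_add, pow_one]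
    rfl
  | succ n ih =>
    intro S m
    rw [nest, plug]
    simp only [h2]
    by_cases hm : 2 * c ∣ m
    · obtain ⟨q, rfl⟩ := hm
      rw [if_pos (Dvd.intro _ rfl), Nat.mul_div_cancel_left _ (by omega), ih,
        pow_succ' (2 * c) (n + 1)]
      simp only [Nat.mul_dvd_mul_iff_left (show 0 < 2 * c by omega)]
      congr 1
      rw [nest, plug]
      simp only [h2]
      rw [if_pos (Dvd.intro _ rfl), Nat.mul_div_cancel_left _ (by omega)]
      rfl
    · have h3 : ¬ (2 * c) ^ (n + 1 + 1) ∣ m := fun h =>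
        hm ((dvd_pow_self _ (by omega)).trans h)
      rw [if_neg hm, if_neg h3, nest, plug]
      simp only [h2]
      rw [if_neg hm]
      rfl

theorem nest_of_dvd {c : ℕ} (hc : 0 < c) {n : ℕ} (S : Fin (n + 1) → ℕ) {m : ℕ}
    (h : (2 * c) ^ n ∣ m) : nest c S m = S 0 := by
  cases n with
  | zero => rfl
  | succ n => rw [nest_succ hc, if_pos h]

theorem le_nest {c : ℕ} (hc : 0 < c) : ∀ {n : ℕ} {S : Fin (n + 1) → ℕ} (_ : StrictMono S) (m : ℕ),
    S 0 ≤ nest c S m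
  | 0, _, _, _ => le_rfl
  | n + 1, S, hS, m => by
    rw [nest_succ hc]
    split_ifs
    · exact le_rfl
    · have h1 : StrictMono (Fin.tail S) := fun i j h => hS (Fin.succ_lt_succ_iff.2 h)
      exact (hS.monotone (Fin.zero_le 1)).trans (le_nest hc h1 m)

theorem nest_periodic {c : ℕ} (hc : 0 < c) : ∀ {n : ℕ} (S : Fin (n + 1) → ℕ) {q : ℕ} (m : ℕ)
    (_ : (2 * c) ^ n ∣ q), nest c S (q + m) = nest c S m
  | 0, _, _, _, _ => rfl
  | n + 1, S, q, m, h => by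
    rw [nest_succ hc, nest_succ hc, nest_periodic hc (Fin.tail S) m
      ((pow_dvd_pow _ (Nat.le_succ n)).trans h)]
    simp only [Nat.dvd_add_right h]

/-- Divisibility does not see signs. This symmetry of a block is what allows it to be read
backwards. -/
theorem nest_reflect {c : ℕ} (hc : 0 < c) : ∀ {n : ℕ} (S : Fin (n + 1) → ℕ) {m m' : ℕ}
    (_ : (2 * c) ^ n ∣ m + m'), nest c S m = nest c S m'
  | 0, _, _, _, _ => rfl
  | n + 1, S, m, m', h => by
    rw [nest_succ hc, nest_succ hc, nest_reflect hc (Fin.tail S)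
      ((pow_dvd_pow _ (Nat.le_succ n)).trans h)]
    have : (2 * c) ^ (n + 1) ∣ m ↔ (2 * c) ^ (n + 1) ∣ m' :=
      ⟨fun h' => (Nat.dvd_add_right h').1 h, fun h' => (Nat.dvd_add_left h').1 h⟩
    simp only [this]

end Nest

/-! ### Layered graphs from edge sets on ℕ -/

section OfEdges

/-- The restriction of a partial bijection of `ℕ` to `Fin a` and `Fin b`. -/
def down (a b : ℕ) (f : ℕ ≃. ℕ) : Fin a ≃. Fin b := (finNat a).trans (f.trans (finNat b).symm)

theorem up_down {a b : ℕ} {f : ℕ ≃. ℕ} (hf : ∀ x y, f x = some y → x < a ∧ y < b) :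
    up (down a b f) = f := by
  ext x y
  simp only [up_eq_some, down, PEquiv.trans_eq_some, PEquiv.eq_some_iff]
  constructor
  · rintro ⟨hx, hy, x', h1, y', h2, h3⟩
    simp only [finNat, PEquiv.coe_mk, Option.some.injEq] at h1 h3
    subst h1 h3
    exact h2
  · intro h
    exact ⟨(hf x y h).1, (hf x y h).2, x, rfl, y, h, rfl⟩

/-- A matching from a partial bijection of `ℕ` of the right size. -/
def matchingOf {a b : ℕ} (f : ℕ ≃. ℕ) (hf : ∀ x y, f x = some y → x < a ∧ y < b)
    (hc : cnt f = min a b) : Matching a b :=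
  ⟨down a b f, by
    have : cnt (down a b f) = min a b := by rw [← cnt_up, up_down hf, hc]
    exact this⟩

theorem up_matchingOf {a b : ℕ} (f : ℕ ≃. ℕ) (hf : ∀ x y, f x = some y → x < a ∧ y < b)
    (hc : cnt f = min a b) : up (matchingOf f hf hc).1 = f := up_down hf

theorem cnt_matching {a b : ℕ} (M : Matching a b) : cnt (up M.1) = min a b := by
  rw [cnt_up]; exact M.2

theorem matching_ext {a b : ℕ} {M M' : Matching a b} (h : up M.1 = up M'.1) : M = M' :=
  Subtype.ext (up_injective h)

variable {k : ℕ} {t : ℕ → ℕ}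

theorem LayeredGraph.ext_edge {G G' : LayeredGraph k t}
    (h : ∀ i < k, LayeredGraph.edge G i = LayeredGraph.edge G' i) : G = G' := by
  funext i
  refine matching_ext ?_
  have := h i.1 i.2
  rwa [LayeredGraph.edge_of_lt G i.2, LayeredGraph.edge_of_lt G' i.2] at this

theorem LayeredGraph.cnt_edge (G : LayeredGraph k t) {i : ℕ} (h : i < k) :
    cnt (LayeredGraph.edge G i) = min (t i) (t (i + 1)) := by
  rw [LayeredGraph.edge_of_lt G h]; exact cnt_matching _

/-- The layered graph with given edge sets. -/
def ofEdges (E : ℕ → (ℕ ≃. ℕ)) (hE : ∀ i < k, Supported E t i)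
    (hc : ∀ i < k, cnt (E i) = min (t i) (t (i + 1))) : LayeredGraph k t :=
  fun i => matchingOf (E i) (hE i i.2) (hc i i.2)

theorem edge_ofEdges (E : ℕ → (ℕ ≃. ℕ)) (hE : ∀ i < k, Supported E t i)
    (hc : ∀ i < k, cnt (E i) = min (t i) (t (i + 1))) {i : ℕ} (h : i < k) :
    LayeredGraph.edge (ofEdges E hE hc) i = E i := by
  rw [LayeredGraph.edge_of_lt _ h]; exact up_matchingOf _ _ _

end OfEdges

/-! ### Reading a block backwards -/

section Reverse

variable {B : ℕ} {t : ℕ → ℕ}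

theorem walk_one {E : ℕ → (ℕ ≃. ℕ)} {t : ℕ → ℕ} {i : ℕ} (h : Supported E t i) :
    walk E t i 1 = E i := by
  ext a b
  simp only [walk, PEquiv.trans_eq_some, PEquiv.ofSet_eq_some_iff, Nat.add_zero]
  constructor
  · rintro ⟨c, ⟨rfl, _⟩, h⟩; exact h
  · intro h'; exact ⟨a, ⟨rfl, (h a b h').1⟩, h'⟩

theorem walk_reverse {E : ℕ → (ℕ ≃. ℕ)} (hE : ∀ i < B, Supported E t i)
    (ht : ∀ i ≤ B, t (B - i) = t i) {i : ℕ} : ∀ {d : ℕ}, i + d ≤ B →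
    walk (fun j => (E (B - 1 - j)).symm) t i d = (walk E t (B - i - d) d).symm
  | 0, h => by
    have : t (B - i) = t i := ht i h
    simp only [walk, PEquiv.ofSet_symm, Nat.sub_zero, this]
  | d + 1, h => by
    rw [walk, walk_reverse hE ht (by omega), ← PEquiv.symm_trans_rev]
    have h1 : B - i - d = (B - i - (d + 1)) + 1 := by omega
    have h2 : B - 1 - (i + d) = B - i - (d + 1) := by omega
    rw [h1, h2, add_comm d 1, walk_add (d := 1) (fun j hj hj' => hE j (by omega)),
      walk_one (hE _ (by omega))]

/-- The mirror image of a layered graph. -/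
def reverse (ht : ∀ i ≤ B, t (B - i) = t i) (G : LayeredGraph B t) : LayeredGraph B t :=
  ofEdges (fun j => (LayeredGraph.edge G (B - 1 - j)).symm)
    (fun i hi a b hab => by
      have h := LayeredGraph.supported G (B - 1 - i) b a ((PEquiv.eq_some_iff _).1 hab)
      have h1 := ht i (by omega)
      have h2 := ht (i + 1) (by omega)
      rw [show B - 1 - i + 1 = B - i by omega, show B - 1 - i = B - (i + 1) by omega, h1, h2] at h
      exact h.symm)
    (fun i hi => by
      have h1 := ht i (by omega)
      have h2 := ht (i + 1) (by omega)
      rw [cnt_symm, LayeredGraph.cnt_edge G (by omega), show B - 1 - i + 1 = B - i by omega,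
        show B - 1 - i = B - (i + 1) by omega, h1, h2, min_comm])

theorem edge_reverse (ht : ∀ i ≤ B, t (B - i) = t i) (G : LayeredGraph B t) {i : ℕ} (hi : i < B) :
    LayeredGraph.edge (reverse ht G) i = (LayeredGraph.edge G (B - 1 - i)).symm :=
  edge_ofEdges _ _ _ hi

theorem reverse_reverse (ht : ∀ i ≤ B, t (B - i) = t i) (G : LayeredGraph B t) :
    reverse ht (reverse ht G) = G := by
  refine LayeredGraph.ext_edge fun i hi => ?_
  rw [edge_reverse ht _ hi, edge_reverse ht _ (by omega), PEquiv.symm_symm]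
  congr 1
  omega

theorem walk_edge_reverse (ht : ∀ i ≤ B, t (B - i) = t i) (G : LayeredGraph B t) {i d : ℕ}
    (h : i + d ≤ B) : walk (LayeredGraph.edge (reverse ht G)) t i d =
      (walk (LayeredGraph.edge G) t (B - i - d) d).symm := by
  rw [← walk_reverse (fun i _ => LayeredGraph.supported G i) ht h]
  exact walk_shift rfl fun j hj => edge_reverse ht G (by omega)

theorem niceSeg_reverse (ht : ∀ i ≤ B, t (B - i) = t i) {G : LayeredGraph B t}
    (h : NiceSeg (LayeredGraph.edge G) t 0 B) :
    NiceSeg (LayeredGraph.edge (reverse ht G)) t 0 B := by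
  intro i d _ hd
  rw [walk_edge_reverse ht G hd, cnt_symm, h _ _ (Nat.zero_le _) (by omega)]
  refine le_antisymm (Finset.le_inf' _ _ fun x hx => ?_) (Finset.le_inf' _ _ fun x hx => ?_)
  · rw [Finset.mem_Icc] at hx
    rw [← ht x (by omega)]
    exact Finset.inf'_le _ (by rw [Finset.mem_Icc]; omega)
  · rw [Finset.mem_Icc] at hx
    rw [← ht x (by omega)]
    exact Finset.inf'_le _ (by rw [Finset.mem_Icc]; omega)

end Reverse

/-! ### Blocks with a prescribed permutation -/

section Fibres

variable {B N : ℕ} {t : ℕ → ℕ}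

/-- A permutation of `Fin N` as a partial bijection of `ℕ`. -/
def upPerm (σ : Equiv.Perm (Fin N)) : ℕ ≃. ℕ := up σ.toPEquiv

theorem upPerm_eq_some {σ : Equiv.Perm (Fin N)} {x y : ℕ} :
    upPerm σ x = some y ↔ ∃ hx : x < N, (σ ⟨x, hx⟩).val = y := by
  simp only [upPerm, up_eq_some, Equiv.toPEquiv_apply, Option.some.injEq]
  constructor
  · rintro ⟨hx, hy, h⟩; exact ⟨hx, by rw [h]⟩
  · rintro ⟨hx, rfl⟩; exact ⟨hx, (σ ⟨x, hx⟩).2, rfl⟩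

theorem upPerm_mul (σ τ : Equiv.Perm (Fin N)) : upPerm (σ * τ) = (upPerm τ).trans (upPerm σ) := by
  rw [upPerm, upPerm, upPerm, ← up_trans, ← Equiv.toPEquiv_trans]
  rfl

theorem upPerm_inv (σ : Equiv.Perm (Fin N)) : upPerm σ⁻¹ = (upPerm σ).symm := by
  rw [upPerm, upPerm, ← up_symm, ← Equiv.toPEquiv_symm]
  rfl

theorem upPerm_injective : Function.Injective (upPerm : Equiv.Perm (Fin N) → (ℕ ≃. ℕ)) := by
  intro σ τ h
  ext v
  have h1 : upPerm σ v = some (σ v).val := upPerm_eq_some.2 ⟨v.2, rfl⟩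
  rw [h] at h1
  obtain ⟨_, h2⟩ := upPerm_eq_some.1 h1
  exact h2.symm

/-- The nice layered graphs whose end-to-end matching is the permutation `σ`. -/
def fibre (B : ℕ) (t : ℕ → ℕ) (σ : Equiv.Perm (Fin N)) : Set (LayeredGraph B t) :=
  {G | NiceSeg (LayeredGraph.edge G) t 0 B ∧ walk (LayeredGraph.edge G) t 0 B = upPerm σ}

theorem eq_of_mem_fibre {σ τ : Equiv.Perm (Fin N)} {G : LayeredGraph B t} (h : G ∈ fibre B t σ)
    (h' : G ∈ fibre B t τ) : σ = τ := upPerm_injective (h.2.symm.trans h'.2)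

theorem exists_mem_fibre {G : LayeredGraph B t} (h : NiceSeg (LayeredGraph.edge G) t 0 B)
    (h0 : t 0 = N) (hB : t B = N) (ht : ∀ j ≤ B, N ≤ t j) :
    ∃ σ : Equiv.Perm (Fin N), G ∈ fibre B t σ := by
  have hs : ∀ j, 0 ≤ j → j < 0 + B → Supported (LayeredGraph.edge G) t j :=
    fun j _ _ => LayeredGraph.supported G j
  have htot : ∀ v : Fin N, ∃ w : Fin N, walk (LayeredGraph.edge G) t 0 B v = some w.val := by
    intro v
    have h1 := NiceSeg.total (p := 0) (d := B) (by simpa using h) hs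
      (fun j _ hj => by rw [h0]; exact ht j (by omega)) (a := v) (by rw [h0]; exact v.2)
    obtain ⟨w, hw⟩ := Option.isSome_iff_exists.1 h1
    have := (walk_lt hs hw).2
    rw [Nat.zero_add, hB] at this
    exact ⟨⟨w, this⟩, hw⟩
  choose f hf using htot
  have hinj : Function.Injective f := by
    intro v v' e
    have h2 := hf v'
    rw [← e] at h2
    exact Fin.ext ((walk (LayeredGraph.edge G) t 0 B).inj (hf v) h2)
  refine ⟨Equiv.ofBijective f (Finite.injective_iff_bijective.1 hinj), h, ?_⟩
  ext x y
  rw [upPerm_eq_some]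
  constructor
  · intro hxy
    have hx := (walk_lt hs hxy).1
    rw [h0] at hx
    refine ⟨hx, ?_⟩
    have := (hf ⟨x, hx⟩).symm.trans hxy
    simpa using this
  · rintro ⟨hx, rfl⟩
    exact hf ⟨x, hx⟩

theorem reverse_mem_fibre (ht : ∀ i ≤ B, t (B - i) = t i) {σ : Equiv.Perm (Fin N)}
    {G : LayeredGraph B t} (h : G ∈ fibre B t σ) : reverse ht G ∈ fibre B t σ⁻¹ := by
  refine ⟨niceSeg_reverse ht h.1, ?_⟩
  rw [walk_edge_reverse ht G (by omega), upPerm_inv, ← h.2]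
  simp

/-- The layered graph obtained by permuting the last layer. -/
def relabel (hN : t B = N) (σ : Equiv.Perm (Fin N)) (G : LayeredGraph B t) :
    LayeredGraph B t :=
  ofEdges (fun i => if i + 1 = B then (LayeredGraph.edge G i).trans (upPerm σ)
      else LayeredGraph.edge G i)
    (fun i hi a b hab => by
      by_cases h : i + 1 = B
      · simp only [h, if_true, PEquiv.trans_eq_some] at hab
        obtain ⟨c, h1, h2⟩ := hab
        obtain ⟨h3, h4⟩ := upPerm_eq_some.1 h2
        refine ⟨(LayeredGraph.supported G i _ _ h1).1, ?_⟩
        rw [h, hN, ← h4]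
        exact Fin.is_lt _
      · simp only [h, if_false] at hab
        exact LayeredGraph.supported G i _ _ hab)
    (fun i hi => by
      rw [← LayeredGraph.cnt_edge G hi]
      by_cases h : i + 1 = B
      · simp only [h, if_true]
        refine cnt_trans_of_total fun a b hab => ?_
        have := (LayeredGraph.supported G i _ _ hab).2
        rw [h, hN] at this
        exact Option.isSome_iff_exists.2 ⟨_, upPerm_eq_some.2 ⟨this, rfl⟩⟩
      · simp only [h, if_false])

theorem edge_relabel (hN : t B = N) (σ : Equiv.Perm (Fin N)) (G : LayeredGraph B t)
    {i : ℕ} (hi : i < B) : LayeredGraph.edge (relabel hN σ G) i =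
      if i + 1 = B then (LayeredGraph.edge G i).trans (upPerm σ) else LayeredGraph.edge G i :=
  edge_ofEdges _ _ _ hi

theorem walk_edge_relabel_of_lt (hN : t B = N) (σ : Equiv.Perm (Fin N))
    (G : LayeredGraph B t) {i d : ℕ} (h : i + d < B) :
    walk (LayeredGraph.edge (relabel hN σ G)) t i d = walk (LayeredGraph.edge G) t i d := by
  refine walk_shift rfl fun j hj => ?_
  rw [edge_relabel hN σ G (by omega), if_neg (by omega)]

theorem walk_edge_relabel_of_eq (hN : t B = N) (σ : Equiv.Perm (Fin N))
    (G : LayeredGraph B t) {i d : ℕ} (h : i + (d + 1) = B) :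
    walk (LayeredGraph.edge (relabel hN σ G)) t i (d + 1) =
      (walk (LayeredGraph.edge G) t i (d + 1)).trans (upPerm σ) := by
  rw [walk, walk_edge_relabel_of_lt hN σ G (by omega), edge_relabel hN σ G (by omega),
    if_pos (by omega), ← PEquiv.trans_assoc, walk]

theorem relabel_mem_fibre (hB : 0 < B) (hN : t B = N) (σ : Equiv.Perm (Fin N))
    {τ : Equiv.Perm (Fin N)} {G : LayeredGraph B t} (h : G ∈ fibre B t τ) :
    relabel hN σ G ∈ fibre B t (σ * τ) := by
  refine ⟨?_, ?_⟩
  · intro i d _ hd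
    rw [← h.1 i d (Nat.zero_le _) hd]
    by_cases hlt : i + d < B
    · rw [walk_edge_relabel_of_lt hN σ G hlt]
    · cases d with
      | zero => rfl
      | succ d =>
        rw [walk_edge_relabel_of_eq hN σ G (by omega)]
        refine cnt_trans_of_total fun a b hab => ?_
        have := (walk_lt (fun j _ _ => LayeredGraph.supported G j) hab).2
        rw [show i + (d + 1) = B by omega, hN] at this
        exact Option.isSome_iff_exists.2 ⟨_, upPerm_eq_some.2 ⟨this, rfl⟩⟩
  · obtain ⟨d, rfl⟩ : ∃ d, B = d + 1 := ⟨B - 1, by omega⟩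
    rw [walk_edge_relabel_of_eq hN σ G (by omega), upPerm_mul, h.2]

theorem relabel_injective (hN : t B = N) (σ : Equiv.Perm (Fin N)) :
    Function.Injective (relabel hN σ) := by
  intro G G' h
  refine LayeredGraph.ext_edge fun i hi => ?_
  have h1 : LayeredGraph.edge (relabel hN σ G) i = LayeredGraph.edge (relabel hN σ G') i := by
    rw [h]
  rw [edge_relabel hN σ G hi, edge_relabel hN σ G' hi] at h1
  by_cases hiB : i + 1 = B
  · simp only [hiB, if_true] at h1
    ext a b
    have key : ∀ H : LayeredGraph B t, LayeredGraph.edge H i a = some b ↔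
        ∃ hb : b < N, ((LayeredGraph.edge H i).trans (upPerm σ)) a = some (σ ⟨b, hb⟩).val := by
      intro H
      simp only [PEquiv.trans_eq_some, upPerm_eq_some]
      constructor
      · intro hab
        have hb := (LayeredGraph.supported H i _ _ hab).2
        rw [hiB, hN] at hb
        exact ⟨hb, b, hab, hb, rfl⟩
      · rintro ⟨hb, b', hab, hb', e⟩
        have : b' = b := by simpa using σ.injective (Fin.ext e)
        rwa [this] at hab
    exact (key G).trans ((by rw [h1] : _ ↔ _).trans (key G').symm)
  · simpa only [hiB, if_false] using h1

instance {a b : ℕ} : Finite (Fin a ≃. Fin b) := DFunLike.finite _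

instance {B : ℕ} {t : ℕ → ℕ} : Finite (LayeredGraph B t) := inferInstanceAs
  (Finite ((i : Fin B) → Matching (t i) (t (i + 1))))

/-- Relabelling the last layer by τσ⁻¹ injects one fibre into the other. As σ and τ are arbitrary,
all fibres have the same size. -/
theorem ncard_fibre_le (hB : 0 < B) (hN : t B = N) (σ τ : Equiv.Perm (Fin N)) :
    (fibre B t σ).ncard ≤ (fibre B t τ).ncard := by
  refine Set.ncard_le_ncard_of_injOn (relabel hN (τ * σ⁻¹)) (fun G hG => ?_)
    (relabel_injective hN _).injOn (Set.toFinite _)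
  have := relabel_mem_fibre hB hN (τ * σ⁻¹) hG
  simpa using this

end Fibres

/-! ### What the players see -/

section Views

variable {k : ℕ} {t : ℕ → ℕ}

theorem views_eq_iff {G G' : LayeredGraph k t} {p : Player} :
    LayeredGraph.views G p = LayeredGraph.views G' p ↔
      ∀ i < k, owner (i + 1) = p → LayeredGraph.edge G i = LayeredGraph.edge G' i := by
  constructor
  · intro h i hi hp
    rw [LayeredGraph.edge_of_lt G hi, LayeredGraph.edge_of_lt G' hi]
    have : G ⟨i, hi⟩ = G' ⟨i, hi⟩ := congrFun h ⟨⟨i, hi⟩, hp⟩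
    rw [this]
  · intro h
    funext i
    refine matching_ext ?_
    have := h i.1 i.1.2 i.2
    rwa [LayeredGraph.edge_of_lt G i.1.2, LayeredGraph.edge_of_lt G' i.1.2] at this

open Classical in
/-- A layered graph with a prescribed view of player `p`. -/
noncomputable def complete (G : LayeredGraph k t) (p : Player) (v : View k t p) : LayeredGraph k t :=
  fun i => if h : owner (i + 1) = p then v ⟨i, h⟩ else G i

theorem views_complete (G : LayeredGraph k t) (p : Player) (v : View k t p) :
    LayeredGraph.views (complete G p v) p = v := by
  funext i
  simp only [LayeredGraph.views, complete, dif_pos i.2]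

theorem Player.other_other (p : Player) : p.other.other = p := by cases p <;> rfl

theorem owner_succ (i : ℕ) : owner (i + 1) = (owner i).other := by
  unfold owner
  by_cases h : Even i
  · rw [if_pos h, if_neg (by simpa [Nat.even_add_one] using h)]; rfl
  · rw [if_neg h, if_pos (by simpa [Nat.even_add_one] using h)]; rfl

theorem owner_add_of_even {m : ℕ} (hm : Even m) (i : ℕ) : owner (m + i) = owner i := by
  simp only [owner, Nat.even_add, hm, true_iff]

theorem owner_add_of_odd {m : ℕ} (hm : ¬ Even m) (i : ℕ) : owner (m + i) = (owner i).other := by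
  by_cases h : Even i <;> simp [owner, Nat.even_add, hm, h, Player.other]

/-- Reversing a graph with an even number of edge layers exchanges the players. -/
theorem views_reverse {B : ℕ} (hB : Even B) (ht : ∀ i ≤ B, t (B - i) = t i)
    {G G' : LayeredGraph B t} {p : Player}
    (h : LayeredGraph.views G p.other = LayeredGraph.views G' p.other) :
    LayeredGraph.views (reverse ht G) p = LayeredGraph.views (reverse ht G') p := by
  rw [views_eq_iff] at h ⊢
  intro i hi hp
  rw [edge_reverse ht G hi, edge_reverse ht G' hi, h (B - 1 - i) (by omega)]
  rw [← hp, owner_succ i, Player.other_other]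
  unfold owner
  have : Even (B - 1 - i + 1) ↔ Even i := by
    rw [show B - 1 - i + 1 = B - i by omega, Nat.even_sub (by omega)]
    simp [hB]
  simp only [this]

end Views

/-! ### Decomposing a graph into consecutive blocks and an outer part -/

section Glue

variable {K B k lo : ℕ} {t t' : ℕ → ℕ}

/-- From layer `lo` on, a layered graph of type `t` contains `2 * k + 1` consecutive blocks of
type `t'`. -/
structure Layout (K B k lo : ℕ) (t t' : ℕ → ℕ) : Prop where
  pos : 0 < B
  le : lo + (2 * k + 1) * B ≤ K
  size : ∀ q ≤ 2 * k, ∀ r ≤ B, t (lo + q * B + r) = t' r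

/-- The position `i` lies in one of the blocks. -/
def InMid (B k lo i : ℕ) : Prop := lo ≤ i ∧ i < lo + (2 * k + 1) * B

instance (B k lo i : ℕ) : Decidable (InMid B k lo i) := inferInstanceAs (Decidable (_ ∧ _))

/-- The edge sets outside of the blocks. -/
abbrev Outer (K B k lo : ℕ) (t : ℕ → ℕ) : Type :=
  (i : {i : Fin K // ¬ InMid B k lo i}) → Matching (t i.1) (t (i.1 + 1))

/-- The block number `q` if the `a i` are put at the even and the `b i` at the odd numbers. -/
def sel {X : Type*} (a : Fin (k + 1) → X) (b : Fin k → X) (q : ℕ) (hq : q < 2 * k + 1) : X :=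
  if h : q % 2 = 0 then a ⟨q / 2, by omega⟩ else b ⟨q / 2, by omega⟩

theorem sel_even {X : Type*} (a : Fin (k + 1) → X) (b : Fin k → X) (i : Fin (k + 1))
    (h : 2 * i.val < 2 * k + 1) : sel a b (2 * i) h = a i := by
  rw [sel, dif_pos (by omega)]
  congr 1
  exact Fin.ext (by simp)

theorem sel_odd {X : Type*} (a : Fin (k + 1) → X) (b : Fin k → X) (i : Fin k)
    (h : 2 * i.val + 1 < 2 * k + 1) : sel a b (2 * i + 1) h = b i := by
  rw [sel, dif_neg (by omega)]
  congr 1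
  exact Fin.ext (by simp; omega)

theorem inMid_add (hB : 0 < B) {q r : ℕ} (hq : q < 2 * k + 1) (hr : r < B) :
    InMid B k lo (lo + q * B + r) ∧ (lo + q * B + r - lo) / B = q ∧
      (lo + q * B + r - lo) % B = r := by
  have h1 : lo + q * B + r - lo = r + q * B := by omega
  have h2 : (q + 1) * B ≤ (2 * k + 1) * B := Nat.mul_le_mul_right _ hq
  refine ⟨⟨by omega, by rw [Nat.add_mul] at h2; omega⟩, ?_, ?_⟩
  · rw [h1, Nat.add_mul_div_right _ _ hB, Nat.div_eq_of_lt hr, zero_add]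
  · rw [h1, Nat.add_mul_mod_self_right, Nat.mod_eq_of_lt hr]

theorem InMid.decomp (hB : 0 < B) {i : ℕ} (h : InMid B k lo i) :
    (i - lo) / B < 2 * k + 1 ∧ (i - lo) % B < B ∧ i = lo + (i - lo) / B * B + (i - lo) % B := by
  refine ⟨?_, Nat.mod_lt _ hB, ?_⟩
  · rw [Nat.div_lt_iff_lt_mul hB]
    have := h.2
    have := h.1
    omega
  · have h1 := Nat.div_add_mod' (i - lo) B
    have := h.1
    omega

/-- The layered graph with given blocks and given edges outside of the blocks. -/
def glue (H : Layout K B k lo t t') (ω : Outer K B k lo t) (a : Fin (k + 1) → LayeredGraph B t')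
    (b : Fin k → LayeredGraph B t') : LayeredGraph K t := fun i =>
  if h : InMid B k lo i then
    matchingOf (LayeredGraph.edge (sel a b ((i - lo) / B) (h.decomp H.pos).1) ((i - lo) % B))
      (by
        obtain ⟨h1, h2, h3⟩ := h.decomp H.pos
        have e1 := H.size ((i - lo) / B) (by omega) ((i - lo) % B) h2.le
        have e2 := H.size ((i - lo) / B) (by omega) ((i - lo) % B + 1) h2
        rw [← Nat.add_assoc, ← h3] at e2
        rw [← h3] at e1
        intro x y hxy
        rw [e1, e2]
        exact LayeredGraph.supported _ _ _ _ hxy)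
      (by
        obtain ⟨h1, h2, h3⟩ := h.decomp H.pos
        have e1 := H.size ((i - lo) / B) (by omega) ((i - lo) % B) h2.le
        have e2 := H.size ((i - lo) / B) (by omega) ((i - lo) % B + 1) h2
        rw [← Nat.add_assoc, ← h3] at e2
        rw [← h3] at e1
        rw [e1, e2]
        exact LayeredGraph.cnt_edge _ h2)
  else ω ⟨i, h⟩

theorem sel_congr {X : Type*} (a : Fin (k + 1) → X) (b : Fin k → X) {q q' : ℕ}
    (hq : q < 2 * k + 1) (hq' : q' < 2 * k + 1) (h : q = q') : sel a b q hq = sel a b q' hq' := by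
  subst h; rfl

theorem Layout.add_lt (H : Layout K B k lo t t') {q r : ℕ} (hq : q < 2 * k + 1) (hr : r < B) :
    lo + q * B + r < K :=
  (inMid_add (lo := lo) H.pos hq hr).1.2.trans_le H.le

theorem edge_glue_mid (H : Layout K B k lo t t') (ω : Outer K B k lo t)
    (a : Fin (k + 1) → LayeredGraph B t') (b : Fin k → LayeredGraph B t') {q r : ℕ}
    (hq : q < 2 * k + 1) (hr : r < B) :
    LayeredGraph.edge (glue H ω a b) (lo + q * B + r) = LayeredGraph.edge (sel a b q hq) r := by
  obtain ⟨h1, h2, h3⟩ := inMid_add (k := k) (lo := lo) H.pos hq hr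
  rw [LayeredGraph.edge_of_lt _ (H.add_lt hq hr)]
  simp only [glue, dif_pos h1]
  rw [up_matchingOf, sel_congr a b _ hq h2, h3]

/-- The edges outside of the blocks as partial bijections of `ℕ`. -/
def outerEdge (ω : Outer K B k lo t) (i : ℕ) : ℕ ≃. ℕ :=
  if h : ∃ h : i < K, ¬ InMid B k lo (⟨i, h⟩ : Fin K) then up (ω ⟨⟨i, h.1⟩, h.2⟩).1 else ⊥

theorem edge_glue_out (H : Layout K B k lo t t') (ω : Outer K B k lo t)
    (a : Fin (k + 1) → LayeredGraph B t') (b : Fin k → LayeredGraph B t') {i : ℕ}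
    (h : ¬ InMid B k lo i) : LayeredGraph.edge (glue H ω a b) i = outerEdge ω i := by
  by_cases hi : i < K
  · rw [LayeredGraph.edge_of_lt _ hi, outerEdge, dif_pos ⟨hi, h⟩]
    simp only [glue, dif_neg h]
  · rw [outerEdge, dif_neg (by rintro ⟨h1, _⟩; exact hi h1), LayeredGraph.edge, dif_neg hi]

theorem glue_injective (H : Layout K B k lo t t') :
    Function.Injective fun x : Outer K B k lo t × (Fin (k + 1) → LayeredGraph B t') ×
      (Fin k → LayeredGraph B t') => glue H x.1 x.2.1 x.2.2 := by
  rintro ⟨ω, a, b⟩ ⟨ω', a', b'⟩ h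
  simp only at h
  have hsel : ∀ q (hq : q < 2 * k + 1), sel a b q hq = sel a' b' q hq := by
    intro q hq
    refine LayeredGraph.ext_edge fun r hr => ?_
    rw [← edge_glue_mid H ω a b hq hr, h, edge_glue_mid H ω' a' b' hq hr]
  refine Prod.ext ?_ (Prod.ext ?_ ?_)
  · funext i
    have h1 := congrFun h i.1
    simpa only [glue, dif_neg i.2] using h1
  · funext i
    have := hsel (2 * i) (by omega)
    rwa [sel_even, sel_even] at this
  · funext i
    have := hsel (2 * i + 1) (by omega)
    rwa [sel_odd, sel_odd] at this

theorem glue_surjective (H : Layout K B k lo t t') :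
    Function.Surjective fun x : Outer K B k lo t × (Fin (k + 1) → LayeredGraph B t') ×
      (Fin k → LayeredGraph B t') => glue H x.1 x.2.1 x.2.2 := by
  intro G
  have hblock : ∀ q, q < 2 * k + 1 → ∃ g : LayeredGraph B t', ∀ r < B,
      LayeredGraph.edge g r = LayeredGraph.edge G (lo + q * B + r) := by
    intro q hq
    have hs : ∀ r < B, Supported (fun r => LayeredGraph.edge G (lo + q * B + r)) t' r := by
      intro r hr x y hxy
      have := LayeredGraph.supported G _ _ _ hxy
      rwa [Nat.add_assoc (lo + q * B) r 1, H.size q (by omega) r hr.le,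
        H.size q (by omega) (r + 1) hr] at this
    have hc : ∀ r < B, cnt (LayeredGraph.edge G (lo + q * B + r)) = min (t' r) (t' (r + 1)) := by
      intro r hr
      have := LayeredGraph.cnt_edge G (H.add_lt hq hr)
      rwa [Nat.add_assoc (lo + q * B) r 1, H.size q (by omega) r hr.le,
        H.size q (by omega) (r + 1) hr] at this
    exact ⟨ofEdges (fun r => LayeredGraph.edge G (lo + q * B + r)) hs hc,
      fun r hr => edge_ofEdges _ _ _ hr⟩
  choose g hg using hblock
  refine ⟨⟨fun i => G i.1, fun i => g (2 * i) (by omega), fun i => g (2 * i + 1) (by omega)⟩, ?_⟩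
  refine LayeredGraph.ext_edge fun i hi => ?_
  by_cases h : InMid B k lo i
  · obtain ⟨h1, h2, h3⟩ := h.decomp H.pos
    have e := edge_glue_mid H (fun i => G i.1)
      (fun i : Fin (k + 1) => g (2 * i) (by omega)) (fun i => g (2 * i + 1) (by omega)) h1 h2
    have e' := hg ((i - lo) / B) h1 ((i - lo) % B) h2
    rw [← h3] at e e'
    rw [e, ← e']
    congr 1
    rw [sel]
    split_ifs with hpar
    · congr 1; simp only; omega
    · congr 1; simp only; omega
  · rw [edge_glue_out H _ _ _ h, outerEdge, dif_pos ⟨hi, h⟩, LayeredGraph.edge_of_lt _ hi]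

/-- The side of a player on the blocks at odd numbers: the players are exchanged there if the
block length is odd. -/
def oddSide (B : ℕ) (p : Player) : Player := if Even B then p else p.other

theorem views_glue (H : Layout K B k lo t t') (hlo : Even lo) (ω : Outer K B k lo t)
    {a a' : Fin (k + 1) → LayeredGraph B t'} {b b' : Fin k → LayeredGraph B t'} {p : Player}
    (ha : ∀ i, LayeredGraph.views (a i) p = LayeredGraph.views (a' i) p)
    (hb : ∀ i, LayeredGraph.views (b i) (oddSide B p) = LayeredGraph.views (b' i) (oddSide B p)) :
    LayeredGraph.views (glue H ω a b) p = LayeredGraph.views (glue H ω a' b') p := by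
  rw [views_eq_iff]
  intro i hi hp
  by_cases h : InMid B k lo i
  · obtain ⟨h1, h2, h3⟩ := h.decomp H.pos
    set q := (i - lo) / B
    set r := (i - lo) % B
    rw [h3, edge_glue_mid H ω a b h1 h2, edge_glue_mid H ω a' b' h1 h2, sel, sel]
    split_ifs with hpar
    · refine views_eq_iff.1 (ha _) r h2 ?_
      have he : Even (lo + q * B) := hlo.add ((Nat.even_iff.2 hpar).mul_right _)
      rw [h3, Nat.add_assoc, owner_add_of_even he] at hp
      exact hp
    · refine views_eq_iff.1 (hb _) r h2 ?_
      have hq : ¬ Even q := fun h => hpar (Nat.even_iff.1 h)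
      rw [h3, Nat.add_assoc] at hp
      by_cases hB : Even B
      · rw [owner_add_of_even (hlo.add (hB.mul_left _))] at hp
        rw [oddSide, if_pos hB, hp]
      · rw [owner_add_of_odd] at hp
        · rw [oddSide, if_neg hB, ← hp, Player.other_other]
        · rw [Nat.even_add, Nat.even_mul]
          simp [hlo, hq, hB]
  · rw [edge_glue_out H ω a b h, edge_glue_out H ω a' b' h]

end Glue

/-! ### The end-to-end matching as a condition on the block permutations -/

section Membership

open Finset BigOperators

variable {K B k lo N s : ℕ} {t t' : ℕ → ℕ}

theorem walk_blocks {E : ℕ → (ℕ ≃. ℕ)} (hE : ∀ i, Supported E t i) :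
    ∀ (k lo : ℕ) (a : Fin (k + 1) → Equiv.Perm (Fin N)) (b : Fin k → Equiv.Perm (Fin N)),
    (∀ q (hq : q < 2 * k + 1), walk E t (lo + q * B) B = upPerm (sel a b q hq)) →
    walk E t lo ((2 * k + 1) * B) = upPerm (chain k a b)
  | 0, lo, a, b, h => by
    have := h 0 (by omega)
    simpa [sel, chain] using this
  | k + 1, lo, a, b, h => by
    have h0 : walk E t lo B = upPerm (a 0) := by
      have := h 0 (by omega)
      simpa [sel] using this
    have h1 : walk E t (lo + B) B = upPerm (b 0) := by
      have := h 1 (by omega)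
      simpa [sel] using this
    have ih := walk_blocks hE k (lo + (B + B)) (Fin.tail a) (Fin.tail b) (by
      intro q hq
      have := h (q + 2) (by omega)
      rw [show lo + (q + 2) * B = lo + (B + B) + q * B by ring] at this
      rw [this]
      congr 1
      unfold sel
      by_cases hpar : q % 2 = 0
      · rw [dif_pos hpar, dif_pos (by omega)]
        simp only [Fin.tail]
        congr 1
        exact Fin.ext (by simp)
      · rw [dif_neg hpar, dif_neg (by omega)]
        simp only [Fin.tail]
        congr 1
        exact Fin.ext (by simp))
    rw [show (2 * (k + 1) + 1) * B = (B + B) + (2 * k + 1) * B by ring,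
      walk_add (fun j _ _ => hE j), walk_add (fun j _ _ => hE j), h0, h1, ih, chain, upPerm_mul,
      upPerm_mul]

/-- The layers outside of the blocks are at least as large as the ends of the blocks, except for the
first and the last one. -/
structure Cut (K B k lo N : ℕ) (t t' : ℕ → ℕ) : Prop extends Layout K B k lo t t' where
  first : t' 0 = N
  last : t' B = N
  lo_pos : 0 < lo
  hi_lt : lo + (2 * k + 1) * B < K
  le_size : ∀ j, 0 < j → j < K → N ≤ t j
  size_zero : t 0 ≤ N
  size_end : t K ≤ N

theorem Cut.size_boundary (H : Cut K B k lo N t t') {q : ℕ} (hq : q ≤ 2 * k + 1) :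
    t (lo + q * B) = N := by
  by_cases h : q ≤ 2 * k
  · have := H.size q h 0 (Nat.zero_le _)
    rw [← H.first]
    exact this
  · have : q = 2 * k + 1 := by omega
    subst this
    have := H.size (2 * k) le_rfl B le_rfl
    rw [H.last] at this
    rw [← this]
    congr 1
    ring

/-- The layered graphs that are nice and join `src u` to `tgt u` for all `u`. -/
def joined (K : ℕ) (t : ℕ → ℕ) (src tgt : Fin s → ℕ) : Set (LayeredGraph K t) :=
  {G | NiceSeg (LayeredGraph.edge G) t 0 K ∧
    ∀ u, walk (LayeredGraph.edge G) t 0 K (src u) = some (tgt u)}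

/-- The part of a graph outside of the blocks is nice. -/
def OuterNice (ω : Outer K B k lo t) : Prop :=
  NiceSeg (outerEdge ω) t 0 lo ∧ NiceSeg (outerEdge ω) t (lo + (2 * k + 1) * B) K

theorem outerNice_iff (H : Layout K B k lo t t') (ω : Outer K B k lo t)
    (a : Fin (k + 1) → LayeredGraph B t') (b : Fin k → LayeredGraph B t') :
    OuterNice ω ↔ NiceSeg (LayeredGraph.edge (glue H ω a b)) t 0 lo ∧
      NiceSeg (LayeredGraph.edge (glue H ω a b)) t (lo + (2 * k + 1) * B) K := by
  obtain ⟨l, rfl⟩ := Nat.exists_eq_add_of_le H.le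
  have e1 : ∀ j < lo, LayeredGraph.edge (glue H ω a b) (0 + j) = outerEdge ω (0 + j) := fun j hj =>
    edge_glue_out H ω a b fun h => by have := h.1; omega
  have e2 : ∀ j < l, LayeredGraph.edge (glue H ω a b) (lo + (2 * k + 1) * B + j) =
      outerEdge ω (lo + (2 * k + 1) * B + j) := fun j hj =>
    edge_glue_out H ω a b fun h => by have := h.2; omega
  constructor
  · rintro ⟨h1, h2⟩
    refine ⟨?_, NiceSeg.shift (fun _ _ => rfl) (fun j hj => (e2 j hj).symm) h2⟩
    have := NiceSeg.shift (p := 0) (p' := 0) (l := lo) (fun _ _ => rfl)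
      (fun j hj => (e1 j hj).symm) (by simpa using h1)
    simpa using this
  · rintro ⟨h1, h2⟩
    refine ⟨?_, NiceSeg.shift (fun _ _ => rfl) e2 h2⟩
    have := NiceSeg.shift (p := 0) (p' := 0) (l := lo) (fun _ _ => rfl) e1 (by simpa using h1)
    simpa using this

theorem niceSeg_block_iff (H : Layout K B k lo t t') (ω : Outer K B k lo t)
    (a : Fin (k + 1) → LayeredGraph B t') (b : Fin k → LayeredGraph B t') {q : ℕ}
    (hq : q < 2 * k + 1) :
    NiceSeg (LayeredGraph.edge (glue H ω a b)) t (lo + q * B) (lo + q * B + B) ↔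
      NiceSeg (LayeredGraph.edge (sel a b q hq)) t' 0 B := by
  have e1 : ∀ j < B, LayeredGraph.edge (glue H ω a b) (lo + q * B + j) =
      LayeredGraph.edge (sel a b q hq) (0 + j) := fun j hj => by
    rw [edge_glue_mid H ω a b hq hj, zero_add]
  have e2 : ∀ j ≤ B, t (lo + q * B + j) = t' (0 + j) := fun j hj => by
    rw [H.size q (by omega) j hj, zero_add]
  constructor
  · intro h
    simpa using NiceSeg.shift e2 e1 h
  · intro h
    exact NiceSeg.shift (p := 0) (p' := lo + q * B) (fun j hj => (e2 j hj).symm)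
      (fun j hj => (e1 j hj).symm) (by simpa using h)

theorem walk_block (H : Layout K B k lo t t') (ω : Outer K B k lo t)
    (a : Fin (k + 1) → LayeredGraph B t') (b : Fin k → LayeredGraph B t') {q : ℕ}
    (hq : q < 2 * k + 1) :
    walk (LayeredGraph.edge (glue H ω a b)) t (lo + q * B) B =
      walk (LayeredGraph.edge (sel a b q hq)) t' 0 B :=
  walk_shift (by simpa using H.size q (by omega) 0 (Nat.zero_le _)) fun j hj => by
    rw [edge_glue_mid H ω a b hq hj, zero_add]

theorem walk_glue (H : Cut K B k lo N t t') (ω : Outer K B k lo t)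
    {a : Fin (k + 1) → LayeredGraph B t'} {b : Fin k → LayeredGraph B t'}
    {Ma : Fin (k + 1) → Equiv.Perm (Fin N)} {Mb : Fin k → Equiv.Perm (Fin N)}
    (ha : ∀ i, a i ∈ fibre B t' (Ma i)) (hb : ∀ i, b i ∈ fibre B t' (Mb i)) :
    walk (LayeredGraph.edge (glue H.toLayout ω a b)) t 0 K =
      ((walk (outerEdge ω) t 0 lo).trans (upPerm (chain k Ma Mb))).trans
        (walk (outerEdge ω) t (lo + (2 * k + 1) * B) (K - (lo + (2 * k + 1) * B))) := by
  set G := glue H.toLayout ω a b with hG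
  have hK : K = lo + (2 * k + 1) * B + (K - (lo + (2 * k + 1) * B)) := by
    have := H.hi_lt; omega
  have hs : ∀ i, Supported (LayeredGraph.edge G) t i := LayeredGraph.supported G
  rw [congrArg (walk (LayeredGraph.edge G) t 0) hK, walk_add (fun j _ _ => hs j),
    walk_add (fun j _ _ => hs j)]
  simp only [zero_add]
  congr 1
  · congr 1
    · exact walk_shift rfl fun j hj => edge_glue_out _ _ _ _ fun h => by have := h.1; omega
    · refine walk_blocks hs k lo Ma Mb fun q hq => ?_
      rw [hG, walk_block H.toLayout ω a b hq]
      unfold sel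
      split_ifs
      · exact (ha _).2
      · exact (hb _).2
  · exact walk_shift rfl fun j hj => edge_glue_out _ _ _ _ fun h => by have := h.2; omega

theorem niceSeg_of_glue_mem {src tgt : Fin s → ℕ} (H : Cut K B k lo N t t')
    {ω : Outer K B k lo t}
    {a : Fin (k + 1) → LayeredGraph B t'} {b : Fin k → LayeredGraph B t'}
    (h : glue H.toLayout ω a b ∈ joined K t src tgt) {q : ℕ} (hq : q < 2 * k + 1) :
    NiceSeg (LayeredGraph.edge (sel a b q hq)) t' 0 B := by
  rw [← niceSeg_block_iff H.toLayout ω a b hq]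
  refine h.1.mono (Nat.zero_le _) ?_
  have h2 : (q + 1) * B ≤ (2 * k + 1) * B := Nat.mul_le_mul_right _ hq
  have := H.hi_lt
  rw [Nat.add_mul] at h2
  omega

/-- Beyond niceness of the parts and the prescribed paths nothing is required. Block boundaries are
smallest among the inner layers, so niceness passes through them, and the s paths already give the
walk between the two end layers its maximal size. -/
theorem glue_mem_iff {src tgt : Fin s → ℕ} (H : Cut K B k lo N t t')
    (hsrc : Function.Injective src)
    (hmin : s = min (t 0) (t K)) (ω : Outer K B k lo t)
    {a : Fin (k + 1) → LayeredGraph B t'} {b : Fin k → LayeredGraph B t'}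
    {Ma : Fin (k + 1) → Equiv.Perm (Fin N)} {Mb : Fin k → Equiv.Perm (Fin N)}
    (ha : ∀ i, a i ∈ fibre B t' (Ma i)) (hb : ∀ i, b i ∈ fibre B t' (Mb i)) :
    glue H.toLayout ω a b ∈ joined K t src tgt ↔ OuterNice ω ∧
      ∀ u, ((walk (outerEdge ω) t 0 lo).trans (upPerm (chain k Ma Mb))).trans
        (walk (outerEdge ω) t (lo + (2 * k + 1) * B) (K - (lo + (2 * k + 1) * B))) (src u) =
          some (tgt u) := by
  rw [← walk_glue H ω ha hb]
  have hhi := H.hi_lt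
  have hB := H.pos
  constructor
  · rintro ⟨h1, h2⟩
    refine ⟨(outerNice_iff H.toLayout ω a b).2 ⟨h1.mono le_rfl (by omega), h1.mono (by omega) le_rfl⟩,
      h2⟩
  · rintro ⟨h1, h2⟩
    refine ⟨?_, h2⟩
    obtain ⟨h3, h4⟩ := (outerNice_iff H.toLayout ω a b).1 h1
    set G := glue H.toLayout ω a b with hG
    have hs : ∀ i, Supported (LayeredGraph.edge G) t i := LayeredGraph.supported G
    -- The blocks are attached one by one from the left; the last outer segment comes afterwards
    -- because its final layer may be small.
    have hpre : ∀ q ≤ 2 * k + 1, NiceSeg (LayeredGraph.edge G) t 0 (lo + q * B) := by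
      intro q
      induction q with
      | zero => intro _; simpa using h3
      | succ q ih =>
        intro hq
        have hle : (q + 1) * B ≤ (2 * k + 1) * B := Nat.mul_le_mul_right _ hq
        have e : lo + (q + 1) * B = lo + q * B + B := by ring
        rw [e]
        refine NiceSeg.glue_right (fun j _ _ => hs j) (ih (by omega)) ?_ ?_
        · rw [hG, niceSeg_block_iff H.toLayout ω a b (show q < 2 * k + 1 by omega)]
          unfold sel
          split_ifs
          · exact (ha _).1
          · exact (hb _).1
        · intro j hj hj'
          rw [H.size_boundary (by omega)]
          have := H.lo_pos
          exact H.le_size j (by omega) (by omega)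
    refine NiceSeg.glue_full hhi (fun j _ => hs j) (hpre _ le_rfl) h4 ?_ ?_
    · intro j hj hj'
      rw [H.size_boundary le_rfl]
      exact H.le_size j hj hj'
    · have hinf : (Finset.Icc 0 (0 + K)).inf' ⟨0, by simp⟩ t = s := by
        refine le_antisymm ?_ (Finset.le_inf' _ _ fun x hx => ?_)
        · rw [hmin]
          exact le_min (Finset.inf'_le _ (by simp)) (Finset.inf'_le _ (by simp))
        · rw [Finset.mem_Icc] at hx
          have := min_le_left (t 0) (t K)
          have := min_le_right (t 0) (t K)
          rcases Nat.eq_zero_or_pos x with h0 | h0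
          · subst h0; omega
          · by_cases hxK : x = K
            · subst hxK; omega
            · have := H.le_size x h0 (by omega)
              have := H.size_zero
              omega
      rw [hinf]
      have hlow : s ≤ cnt (walk (LayeredGraph.edge G) t 0 K) := by
        have : (Set.range src).ncard = s := by
          rw [← Set.image_univ, Set.ncard_image_of_injective _ hsrc, Set.ncard_univ]; simp
        rw [← this]
        refine Set.ncard_le_ncard ?_ ?_
        · rintro _ ⟨u, rfl⟩
          exact Option.isSome_iff_exists.2 ⟨_, h2 u⟩
        · refine (Set.finite_Iio (t 0)).subset fun x hx => ?_
          obtain ⟨y, hy⟩ := Option.isSome_iff_exists.1 hx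
          exact (walk_lt (fun j _ _ => hs j) hy).1
      have hup : ∀ (f : ℕ ≃. ℕ) (n : ℕ), (∀ x y, f x = some y → x < n) → cnt f ≤ n := by
        intro f n hf
        have hn : (Set.Iio n).ncard = n := by
          rw [← Nat.card_coe_set_eq, Nat.card_eq_fintype_card]; simp
        conv_rhs => rw [← hn]
        refine Set.ncard_le_ncard (fun x hx => ?_) (Set.finite_Iio n)
        obtain ⟨y, hy⟩ := Option.isSome_iff_exists.1 hx
        exact hf x y hy
      refine le_antisymm ?_ hlow
      rw [hmin]
      refine le_min (hup _ _ fun x y hxy => (walk_lt (fun j _ _ => hs j) hxy).1) ?_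
      rw [← cnt_symm]
      refine hup _ _ fun x y hxy => ?_
      have := (walk_lt (fun j _ _ => hs j) ((PEquiv.eq_some_iff _).1 hxy)).2
      rwa [zero_add] at this

/-- If the outer part is nice, then joining prescribed vertices amounts to prescribing the images
of some points under the chain of the block permutations. -/
theorem exists_endpoints {src tgt : Fin s → ℕ} (H : Cut K B k lo N t t')
    (hsrc : Function.Injective src) (htgt : Function.Injective tgt)
    (hsrc' : ∀ u, src u < t 0) (htgt' : ∀ u, tgt u < t K)
    {ω : Outer K B k lo t} (a : Fin (k + 1) → LayeredGraph B t') (b : Fin k → LayeredGraph B t')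
    (hω : OuterNice ω) :
    ∃ x y : Fin s ↪ Fin N, ∀ M : Equiv.Perm (Fin N),
      (∀ u, ((walk (outerEdge ω) t 0 lo).trans (upPerm M)).trans
        (walk (outerEdge ω) t (lo + (2 * k + 1) * B) (K - (lo + (2 * k + 1) * B))) (src u) =
          some (tgt u)) ↔ ∀ u, M (x u) = y u := by
  obtain ⟨h3, h4⟩ := (outerNice_iff H.toLayout ω a b).1 hω
  have hhi := H.hi_lt
  have hB := H.pos
  have hlo := H.lo_pos
  set G := glue H.toLayout ω a b with hG
  have hs : ∀ i, Supported (LayeredGraph.edge G) t i := LayeredGraph.supported G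
  have eL : walk (outerEdge ω) t 0 lo = walk (LayeredGraph.edge G) t 0 lo :=
    (walk_shift rfl fun j hj => edge_glue_out _ _ _ _ fun h => by have := h.1; omega).symm
  have eR : walk (outerEdge ω) t (lo + (2 * k + 1) * B) (K - (lo + (2 * k + 1) * B)) =
      walk (LayeredGraph.edge G) t (lo + (2 * k + 1) * B) (K - (lo + (2 * k + 1) * B)) :=
    (walk_shift rfl fun j hj => edge_glue_out _ _ _ _ fun h => by have := h.2; omega).symm
  rw [eL, eR]
  set L := walk (LayeredGraph.edge G) t 0 lo with hL
  have hlast : lo + (2 * k + 1) * B + (K - (lo + (2 * k + 1) * B)) = K := by omega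
  set R := walk (LayeredGraph.edge G) t (lo + (2 * k + 1) * B) (K - (lo + (2 * k + 1) * B)) with hR
  have tlo : t lo = N := by simpa using H.size_boundary (q := 0) (by omega)
  have thi : t (lo + (2 * k + 1) * B) = N := H.size_boundary le_rfl
  have hx : ∀ u, ∃ x : Fin N, L (src u) = some x.val := by
    intro u
    have h5 := NiceSeg.total (p := 0) (d := lo) (by simpa using h3) (fun j _ _ => hs j)
      (fun j _ hj => by
        rcases Nat.eq_zero_or_pos j with h0 | h0
        · rw [h0]
        · exact H.size_zero.trans (H.le_size j h0 (by omega))) (hsrc' u)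
    obtain ⟨x, hx⟩ := Option.isSome_iff_exists.1 h5
    have := (walk_lt (fun j _ _ => hs j) hx).2
    rw [zero_add, tlo] at this
    exact ⟨⟨x, this⟩, hx⟩
  have hy : ∀ u, ∃ y : Fin N, R y.val = some (tgt u) := by
    intro u
    have h5 := NiceSeg.cototal (p := lo + (2 * k + 1) * B) (d := K - (lo + (2 * k + 1) * B))
      (by rw [hlast]; exact h4) (fun j _ _ => hs j)
      (fun j hj hj' => by
        rw [hlast] at hj' ⊢
        by_cases hjK : j = K
        · rw [hjK]
        · exact H.size_end.trans (H.le_size j (by omega) (by omega))) (a := tgt u)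
      (by rw [hlast]; exact htgt' u)
    obtain ⟨y, hy⟩ := Option.isSome_iff_exists.1 h5
    rw [PEquiv.eq_some_iff] at hy
    have := (walk_lt (fun j _ _ => hs j) hy).1
    rw [thi] at this
    exact ⟨⟨y, this⟩, hy⟩
  choose x hx using hx
  choose y hy using hy
  have hxi : Function.Injective x := by
    intro u u' e
    have := hx u'
    rw [← e] at this
    exact hsrc (L.inj (hx u) this)
  have hyi : Function.Injective y := by
    intro u u' e
    have := hy u'
    rw [← e, hy u] at this
    exact htgt (Option.some.inj this)
  refine ⟨⟨x, hxi⟩, ⟨y, hyi⟩, fun M => forall_congr' fun u => ?_⟩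
  simp only [PEquiv.trans_eq_some, upPerm_eq_some, Function.Embedding.coeFn_mk]
  constructor
  · rintro ⟨c, ⟨b, h1, hb, h2⟩, h3⟩
    rw [hx u, Option.some.injEq] at h1
    subst h1
    have := R.inj h3 (hy u)
    exact Fin.ext (h2.trans this)
  · intro h
    exact ⟨y u, ⟨x u, hx u, (x u).2, by simp [h]⟩, hy u⟩

end Membership

/-! ### Sums over tuples of blocks -/

section Members

open Finset BigOperators

/-- The elements of a subset of a finite type. -/
noncomputable def members {X : Type*} [Finite X] (A : Set X) : Finset X := A.toFinite.toFinset

theorem mem_members {X : Type*} [Finite X] {A : Set X} {x : X} : x ∈ members A ↔ x ∈ A := by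
  simp [members]

theorem card_members {X : Type*} [Finite X] (A : Set X) : #(members A) = A.ncard := by
  rw [members, Set.ncard_eq_toFinset_card A]

open Classical in
-- A tuple with an entry outside all fibres contributes nothing, and any other tuple determines its
-- labels.
theorem sum_eq_sum_piFinset {ι X T : Type*} [Fintype ι] [DecidableEq ι] [Fintype X] [Fintype T]
    (fib : T → Finset X) (hdis : ∀ x t t', x ∈ fib t → x ∈ fib t' → t = t')
    (g : (ι → X) → ℝ) (hg : ∀ a, (∃ i, ∀ t, a i ∉ fib t) → g a = 0) :
    ∑ a, g a = ∑ t : ι → T, ∑ a ∈ Fintype.piFinset fun i => fib (t i), g a := by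
  have h1 : ∀ t : ι → T, ∑ a ∈ Fintype.piFinset fun i => fib (t i), g a =
      ∑ a, if a ∈ Fintype.piFinset (fun i => fib (t i)) then g a else 0 := by
    intro t
    rw [← sum_filter]
    congr 1
    ext a
    simp
  simp_rw [h1]
  rw [sum_comm]
  refine sum_congr rfl fun a _ => ?_
  by_cases h : ∀ i, ∃ t, a i ∈ fib t
  · choose t ht using h
    rw [sum_eq_single t]
    · rw [if_pos (Fintype.mem_piFinset.2 ht)]
    · intro t' _ hne
      refine if_neg fun h' => hne ?_
      funext i
      exact hdis _ _ _ (Fintype.mem_piFinset.1 h' i) (ht i)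
    · simp
  · push Not at h
    rw [hg a h]
    simp

end Members

/-! ### Disintegration of the uniform distribution -/

section SumFormula

open Finset BigOperators

variable {K B k lo N s : ℕ} {t t' : ℕ → ℕ}

theorem nonempty_fibre_of_mem_joined {src tgt : Fin s → ℕ} (H : Cut K B k lo N t t')
    (ht' : ∀ j ≤ B, N ≤ t' j) {G : LayeredGraph K t} (hG : G ∈ joined K t src tgt)
    (σ : Equiv.Perm (Fin N)) : (fibre B t' σ).Nonempty := by
  obtain ⟨⟨ω, a, b⟩, rfl⟩ := glue_surjective H.toLayout G
  obtain ⟨τ, hτ⟩ := exists_mem_fibre (niceSeg_of_glue_mem H hG (q := 0) (by omega)) H.first H.last ht'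
  rw [← Set.ncard_pos]
  exact ((Set.ncard_pos).2 ⟨_, hτ⟩).trans_le (ncard_fibre_le H.pos H.last τ σ)

/-- The density of the uniform distribution on the permutations whose chain maps `x u` to `y u`. -/
noncomputable def chainWeight (x y : Fin s ↪ Fin N) (a : Fin (k + 1) → Equiv.Perm (Fin N))
    (b : Fin k → Equiv.Perm (Fin N)) : ℝ :=
  N.descFactorial s * (if ∀ u, chain k a b (x u) = y u then 1 else 0) /
    (Fintype.card (Fin (k + 1) → Equiv.Perm (Fin N)) * Fintype.card (Fin k → Equiv.Perm (Fin N)))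

theorem chainWeight_nonneg (x y : Fin s ↪ Fin N) (a : Fin (k + 1) → Equiv.Perm (Fin N))
    (b : Fin k → Equiv.Perm (Fin N)) : 0 ≤ chainWeight x y a b := by
  unfold chainWeight
  split_ifs <;> positivity

theorem sum_chainWeight_mul (x y : Fin s ↪ Fin N)
    (f : (Fin (k + 1) → Equiv.Perm (Fin N)) → (Fin k → Equiv.Perm (Fin N)) → ℝ) :
    ∑ a, ∑ b, chainWeight x y a b * f a b = N.descFactorial s *
      𝔼 a, 𝔼 b, (if ∀ u, chain k a b (x u) = y u then 1 else 0) * f a b := by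
  simp only [Fintype.expect_eq_sum_div_card, chainWeight]
  rw [sum_div, mul_sum]
  refine sum_congr rfl fun a _ => ?_
  rw [sum_div, sum_div, mul_sum]
  refine sum_congr rfl fun b _ => ?_
  field_simp

theorem sum_chainWeight (x y : Fin s ↪ Fin N) :
    ∑ a : Fin (k + 1) → Equiv.Perm (Fin N), ∑ b, chainWeight x y a b = 1 := by
  have := sum_chainWeight_mul (k := k) x y fun _ _ => 1
  simp only [mul_one] at this
  rw [this]
  exact expect_chain_condition x y

/-- The graphs that join prescribed vertices decompose into outer parts and blocks; the
permutations of the blocks have to satisfy a condition on the values of their chain. -/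
theorem sum_joined [Fintype (Outer K B k lo t)] [DecidablePred (OuterNice (K := K) (B := B) (k := k)
      (lo := lo) (t := t))]
    {src tgt : Fin s → ℕ} (H : Cut K B k lo N t t')
    (hsrc : Function.Injective src) (htgt : Function.Injective tgt)
    (hsrc' : ∀ u, src u < t 0) (htgt' : ∀ u, tgt u < t K) (hmin : s = min (t 0) (t K))
    (ht' : ∀ j ≤ B, N ≤ t' j) (σ₀ : Equiv.Perm (Fin N)) (h₀ : (fibre B t' σ₀).Nonempty) :
    ∃ x y : Outer K B k lo t → Fin s ↪ Fin N, ∀ f : LayeredGraph K t → ℝ,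
      ∑ G ∈ members (joined K t src tgt), f G =
        ((#(members (fibre B t' σ₀)) : ℝ) ^ (2 * k + 1) *
          (Fintype.card (Fin (k + 1) → Equiv.Perm (Fin N)) *
            Fintype.card (Fin k → Equiv.Perm (Fin N))) / N.descFactorial s) *
        ∑ ω with OuterNice ω, ∑ Ma, ∑ Mb, chainWeight (x ω) (y ω) Ma Mb *
          𝔼 a ∈ Fintype.piFinset fun i => members (fibre B t' (Ma i)),
            𝔼 b ∈ Fintype.piFinset fun i => members (fibre B t' (Mb i)),
              f (glue H.toLayout ω a b) := by
  classical
  have : Fintype (LayeredGraph B t') := Fintype.ofFinite _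
  have : Fintype (LayeredGraph K t) := Fintype.ofFinite _
  obtain ⟨g₀, hg₀⟩ := h₀
  -- Equal fibres give every admissible tuple of permutations the same weight, so sums over blocks
  -- can be normalized to means with one common factor.
  have hcard : ∀ σ : Equiv.Perm (Fin N), #(members (fibre B t' σ)) = #(members (fibre B t' σ₀)) := by
    intro σ
    rw [card_members, card_members]
    exact le_antisymm (ncard_fibre_le H.pos H.last _ _) (ncard_fibre_le H.pos H.last _ _)
  have hend : ∀ ω : Outer K B k lo t, ∃ x y : Fin s ↪ Fin N, OuterNice ω →
      ∀ M : Equiv.Perm (Fin N),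
      (∀ u, ((walk (outerEdge ω) t 0 lo).trans (upPerm M)).trans
        (walk (outerEdge ω) t (lo + (2 * k + 1) * B) (K - (lo + (2 * k + 1) * B))) (src u) =
          some (tgt u)) ↔ ∀ u, M (x u) = y u := by
    intro ω
    by_cases hω : OuterNice ω
    · obtain ⟨x, y, h⟩ := exists_endpoints H hsrc htgt hsrc' htgt' (fun _ => g₀) (fun _ => g₀) hω
      exact ⟨x, y, fun _ => h⟩
    · have hs : s ≤ N := by have := H.size_zero; omega
      exact ⟨Fin.castLEEmb hs, Fin.castLEEmb hs, fun h => absurd h hω⟩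
  choose x y hxy using hend
  refine ⟨x, y, fun f => ?_⟩
  have hsN : s ≤ N := by have := H.size_zero; omega
  set φ : ℝ := ((#(members (fibre B t' σ₀)) : ℕ) : ℝ) with hφ
  have hφ0 : φ ≠ 0 := by
    rw [hφ, Nat.cast_ne_zero]
    exact card_ne_zero.2 ⟨g₀, mem_members.2 hg₀⟩
  have hpi : ∀ {ι : Type} [Fintype ι] [DecidableEq ι] (M : ι → Equiv.Perm (Fin N)),
      (#(Fintype.piFinset fun i => members (fibre B t' (M i))) : ℝ) = φ ^ Fintype.card ι := by
    intro ι _ _ M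
    rw [Fintype.card_piFinset]
    simp only [hcard, prod_const, card_univ, Nat.cast_pow, hφ]
  have hdf : (N.descFactorial s : ℝ) ≠ 0 := by
    rw [Nat.cast_ne_zero]
    exact (Nat.descFactorial_pos.2 hsN).ne'
  have hdis : ∀ (g : LayeredGraph B t') (σ τ : Equiv.Perm (Fin N)),
      g ∈ members (fibre B t' σ) → g ∈ members (fibre B t' τ) → σ = τ := fun g σ τ h h' =>
    eq_of_mem_fibre (mem_members.1 h) (mem_members.1 h')
  have e1 : ∑ G ∈ members (joined K t src tgt), f G =
      ∑ ω : Outer K B k lo t, ∑ a, ∑ b, if glue H.toLayout ω a b ∈ joined K t src tgt then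
        f (glue H.toLayout ω a b) else 0 := by
    have h1 : ∑ G ∈ members (joined K t src tgt), f G =
        ∑ G, if G ∈ joined K t src tgt then f G else 0 := by
      rw [← sum_filter]
      congr 1
      ext G
      simp [mem_members]
    rw [h1, ← Function.Bijective.sum_comp ⟨glue_injective H.toLayout, glue_surjective H.toLayout⟩,
      Fintype.sum_prod_type]
    refine sum_congr rfl fun ω _ => ?_
    rw [Fintype.sum_prod_type]
  rw [e1, sum_filter, mul_sum]
  refine sum_congr rfl fun ω _ => ?_
  have hmemA : ∀ a b, glue H.toLayout ω a b ∈ joined K t src tgt → ∀ i, ∃ σ : Equiv.Perm (Fin N),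
      a i ∈ members (fibre B t' σ) := by
    intro a b h i
    have := niceSeg_of_glue_mem H h (q := 2 * i) (by omega)
    rw [sel_even] at this
    obtain ⟨σ, hσ⟩ := exists_mem_fibre this H.first H.last ht'
    exact ⟨σ, mem_members.2 hσ⟩
  have hmemB : ∀ a b, glue H.toLayout ω a b ∈ joined K t src tgt → ∀ i, ∃ σ : Equiv.Perm (Fin N),
      b i ∈ members (fibre B t' σ) := by
    intro a b h i
    have := niceSeg_of_glue_mem H h (q := 2 * i + 1) (by omega)
    rw [sel_odd] at this
    obtain ⟨σ, hσ⟩ := exists_mem_fibre this H.first H.last ht'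
    exact ⟨σ, mem_members.2 hσ⟩
  rw [sum_eq_sum_piFinset (fun σ : Equiv.Perm (Fin N) => members (fibre B t' σ)) hdis _ (by
    rintro a ⟨i, hi⟩
    refine sum_eq_zero fun b _ => if_neg fun h => ?_
    obtain ⟨σ, hσ⟩ := hmemA a b h i
    exact hi σ hσ)]
  by_cases hω : OuterNice ω
  swap
  · rw [if_neg hω, mul_zero]
    refine sum_eq_zero fun Ma _ => sum_eq_zero fun a ha => ?_
    refine sum_eq_zero fun b _ => if_neg fun h => ?_
    choose Mb hMb using hmemB a b h
    exact hω ((glue_mem_iff H hsrc hmin ω (fun i => mem_members.1 (Fintype.mem_piFinset.1 ha i))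
      fun i => mem_members.1 (hMb i)).1 h).1
  rw [if_pos hω, mul_sum]
  refine sum_congr rfl fun Ma _ => ?_
  have e2 : ∀ a ∈ Fintype.piFinset fun i => members (fibre B t' (Ma i)),
      (∑ b, if glue H.toLayout ω a b ∈ joined K t src tgt then f (glue H.toLayout ω a b) else 0) =
      ∑ Mb : Fin k → Equiv.Perm (Fin N), ∑ b ∈ Fintype.piFinset fun i => members (fibre B t' (Mb i)),
        (if ∀ u, chain k Ma Mb (x ω u) = y ω u then 1 else 0) * f (glue H.toLayout ω a b) := by
    intro a ha
    rw [sum_eq_sum_piFinset (fun σ : Equiv.Perm (Fin N) => members (fibre B t' σ)) hdis _ (by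
      rintro b ⟨i, hi⟩
      refine if_neg fun h => ?_
      obtain ⟨σ, hσ⟩ := hmemB a b h i
      exact hi σ hσ)]
    refine sum_congr rfl fun Mb _ => sum_congr rfl fun b hb => ?_
    have := glue_mem_iff (src := src) (tgt := tgt) H hsrc hmin ω
      (fun i => mem_members.1 (Fintype.mem_piFinset.1 ha i))
      (fun i => mem_members.1 (Fintype.mem_piFinset.1 hb i))
    rw [hxy ω hω] at this
    simp only [this, hω, true_and]
    split_ifs <;> simp
  rw [sum_congr rfl e2, sum_comm, mul_sum]
  refine sum_congr rfl fun Mb _ => ?_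
  rw [expect_eq_sum_div_card, hpi]
  simp_rw [expect_eq_sum_div_card, hpi, ← mul_sum, ← sum_div]
  rw [chainWeight]
  simp only [Fintype.card_fin]
  have hA : (Fintype.card (Fin (k + 1) → Equiv.Perm (Fin N)) : ℝ) ≠ 0 := by
    rw [Nat.cast_ne_zero]; exact Fintype.card_ne_zero
  have hB : (Fintype.card (Fin k → Equiv.Perm (Fin N)) : ℝ) ≠ 0 := by
    rw [Nat.cast_ne_zero]; exact Fintype.card_ne_zero
  rw [show 2 * k + 1 = k + (k + 1) by ring, pow_add]
  field_simp

/-- If the means for fixed outer part differ by at most `Δ`, so do the overall means. -/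
theorem expect_joined_sub_le {src tgt src₂ tgt₂ : Fin s → ℕ} (H : Cut K B k lo N t t')
    (hsrc : Function.Injective src) (htgt : Function.Injective tgt)
    (hsrc' : ∀ u, src u < t 0) (htgt' : ∀ u, tgt u < t K)
    (hsrc₂ : Function.Injective src₂) (htgt₂ : Function.Injective tgt₂)
    (hsrc₂' : ∀ u, src₂ u < t 0) (htgt₂' : ∀ u, tgt₂ u < t K) (hmin : s = min (t 0) (t K))
    (ht' : ∀ j ≤ B, N ≤ t' j) (h₀ : ∀ σ : Equiv.Perm (Fin N), (fibre B t' σ).Nonempty)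
    (f : LayeredGraph K t → ℝ) {Δ : ℝ} (hΔ : 0 ≤ Δ)
    (hf : ∀ (ω : Outer K B k lo t) (x y x₂ y₂ : Fin s ↪ Fin N),
      ∑ Ma, ∑ Mb, chainWeight x y Ma Mb *
          (𝔼 a ∈ Fintype.piFinset fun i => members (fibre B t' (Ma i)),
            𝔼 b ∈ Fintype.piFinset fun i => members (fibre B t' (Mb i)),
              f (glue H.toLayout ω a b)) -
        ∑ Ma, ∑ Mb, chainWeight x₂ y₂ Ma Mb *
          (𝔼 a ∈ Fintype.piFinset fun i => members (fibre B t' (Ma i)),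
            𝔼 b ∈ Fintype.piFinset fun i => members (fibre B t' (Mb i)),
              f (glue H.toLayout ω a b)) ≤ Δ) :
    𝔼 G ∈ members (joined K t src tgt), f G - 𝔼 G ∈ members (joined K t src₂ tgt₂), f G ≤ Δ := by
  classical
  have : Fintype (Outer K B k lo t) := Fintype.ofFinite _
  obtain ⟨x, y, hxy⟩ := sum_joined H hsrc htgt hsrc' htgt' hmin ht' 1 (h₀ 1)
  obtain ⟨x₂, y₂, hxy₂⟩ := sum_joined H hsrc₂ htgt₂ hsrc₂' htgt₂' hmin ht' 1 (h₀ 1)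
  set D : ℝ := ((#(members (fibre B t' (1 : Equiv.Perm (Fin N)))) : ℝ) ^ (2 * k + 1) *
          (Fintype.card (Fin (k + 1) → Equiv.Perm (Fin N)) *
            Fintype.card (Fin k → Equiv.Perm (Fin N))) / N.descFactorial s) with hD
  have hD0 : 0 ≤ D := by positivity
  have hone : ∀ (Ma : Fin (k + 1) → Equiv.Perm (Fin N)) (Mb : Fin k → Equiv.Perm (Fin N)),
      (𝔼 _a ∈ Fintype.piFinset fun i => members (fibre B t' (Ma i)),
        𝔼 _b ∈ Fintype.piFinset fun i => members (fibre B t' (Mb i)), (1 : ℝ)) = 1 := by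
    intro Ma Mb
    have hne : ∀ {ι : Type} [Fintype ι] [DecidableEq ι] (M : ι → Equiv.Perm (Fin N)),
        (Fintype.piFinset fun i => members (fibre B t' (M i))).Nonempty := by
      intro ι _ _ M
      refine Fintype.piFinset_nonempty.2 fun i => ?_
      obtain ⟨g, hg⟩ := h₀ (M i)
      exact ⟨g, mem_members.2 hg⟩
    rw [expect_const (hne _), expect_const (hne _)]
  -- Taking the test function 1 counts the graphs. The count is the same for every prescribed
  -- matching, so the two means have a common denominator.
  have hc : (#(members (joined K t src tgt)) : ℝ) =
      D * #{ω : Outer K B k lo t | OuterNice ω} := by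
    have := hxy fun _ => 1
    simp only [hone, mul_one, sum_chainWeight, sum_const, nsmul_eq_mul] at this
    exact this
  have hc₂ : (#(members (joined K t src₂ tgt₂)) : ℝ) =
      D * #{ω : Outer K B k lo t | OuterNice ω} := by
    have := hxy₂ fun _ => 1
    simp only [hone, mul_one, sum_chainWeight, sum_const, nsmul_eq_mul] at this
    exact this
  rw [expect_eq_sum_div_card, expect_eq_sum_div_card, hc, hc₂, ← sub_div, hxy, hxy₂, ← mul_sub,
    ← sum_sub_distrib]
  refine div_le_of_le_mul₀ (by positivity) hΔ ?_
  rw [mul_comm Δ, mul_assoc]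
  refine mul_le_mul_of_nonneg_left ?_ hD0
  rw [← nsmul_eq_mul]
  exact sum_le_card_nsmul _ _ _ fun ω _ => hf ω _ _ _ _

end SumFormula

/-! ### Simulating the whole protocol on a single block -/

section Core

open Finset BigOperators

variable {K B k lo N s n C : ℕ} {t t' : ℕ → ℕ} {O : Type}

/-- What is known before the last round: the transcript, and the inputs from which the last speaker
and the player who computes the output learn about the blocks at even and at odd numbers. -/
def state (H : Layout K B k lo t t') (ω : Outer K B k lo t)
    (π : Protocol (View K t) O .alice (n + 1))
    (a : Fin (k + 1) → LayeredGraph B t') (b : Fin k → LayeredGraph B t') :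
    List Bool × (Fin (k + 1) → View B t' (Player.alice.after n)) ×
      (Fin k → View B t' (oddSide B (Player.alice.after n).other)) :=
  (π.pre (LayeredGraph.views (glue H ω a b)), fun i => LayeredGraph.views (a i) _,
    fun i => LayeredGraph.views (b i) _)

theorem state_eq_iff (H : Layout K B k lo t t') {ω : Outer K B k lo t}
    {π : Protocol (View K t) O .alice (n + 1)}
    {a a' : Fin (k + 1) → LayeredGraph B t'} {b b' : Fin k → LayeredGraph B t'} :
    state H ω π a b = state H ω π a' b' ↔
      π.pre (LayeredGraph.views (glue H ω a b)) = π.pre (LayeredGraph.views (glue H ω a' b')) ∧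
      (∀ i, LayeredGraph.views (a i) (Player.alice.after n) =
        LayeredGraph.views (a' i) (Player.alice.after n)) ∧
      ∀ i, LayeredGraph.views (b i) (oddSide B (Player.alice.after n).other) =
        LayeredGraph.views (b' i) (oddSide B (Player.alice.after n).other) := by
  simp only [state, Prod.mk.injEq, funext_iff (f := fun i => LayeredGraph.views _ _)]

theorem state_rectangle (H : Layout K B k lo t t') (hlo : Even lo) {ω : Outer K B k lo t}
    {π : Protocol (View K t) O .alice (n + 1)}
    {a a' : Fin (k + 1) → LayeredGraph B t'} {b b' : Fin k → LayeredGraph B t'}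
    (h : state H ω π a b = state H ω π a' b') : state H ω π a b' = state H ω π a b := by
  rw [state_eq_iff] at h ⊢
  obtain ⟨h1, h2, h3⟩ := h
  refine ⟨Protocol.pre_rectangle (fun p => ?_) π h1, fun _ => rfl, fun i => (h3 i).symm⟩
  by_cases hp : p = Player.alice.after n
  · subst hp
    exact Or.inr (views_glue H hlo ω h2 fun _ => rfl)
  · have hp : p = (Player.alice.after n).other := by
      revert hp
      cases p <;> cases Player.alice.after n <;> simp [Player.other]
    subst hp
    exact Or.inl (views_glue H hlo ω (fun _ => rfl) fun i => (h3 i).symm)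

/-- The mean of any function of the state changes by at most `δ` when the permutation of one even
block is changed. -/
theorem abs_expect_state_even_le (H : Layout K B k lo t t') (hlo : Even lo)
    (ω : Outer K B k lo t) (π : Protocol (View K t) O .alice (n + 1))
    (hπ : ∀ G, π.bits (LayeredGraph.views G) ≤ C) {δ : ℝ}
    (hyp : ∀ π' : Protocol (View B t') ℝ .alice n,
      (∀ G, π'.bits (LayeredGraph.views G) ≤ C) → (∀ G, |π'.run (LayeredGraph.views G)| ≤ 1) →
      ∀ M M' : Equiv.Perm (Fin N), |𝔼 g ∈ members (fibre B t' M), π'.run (LayeredGraph.views g) -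
        𝔼 g ∈ members (fibre B t' M'), π'.run (LayeredGraph.views g)| ≤ δ)
    (F : _ → ℝ) (hF : ∀ w, |F w| ≤ 1) (i : Fin (k + 1)) (a : Fin (k + 1) → LayeredGraph B t')
    (b : Fin k → LayeredGraph B t') (M M' : Equiv.Perm (Fin N)) :
    |𝔼 g ∈ members (fibre B t' M), F (state H ω π (Function.update a i g) b) -
      𝔼 g ∈ members (fibre B t' M'), F (state H ω π (Function.update a i g) b)| ≤ δ := by
  -- All other blocks and the outer part are hard-wired. The edges of the block that `p` does not
  -- own are filled in arbitrarily by `complete`, since they do not enter the view of `p`.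
  let e : (p : Player) → View B t' p → View K t p := fun p v =>
    LayeredGraph.views (glue H ω (Function.update a i (complete (a i) p v)) b) p
  have he : ∀ g : LayeredGraph B t', (fun p => e p (LayeredGraph.views g p)) =
      LayeredGraph.views (glue H ω (Function.update a i g) b) := by
    intro g
    funext p
    refine views_glue H hlo ω (fun j => ?_) fun _ => rfl
    by_cases hj : j = i
    · subst hj; simp [views_complete]
    · simp [hj]
  let key : LayeredGraph B t' → List Bool × Σ p, View B t' p := fun g =>
    (π.pre (LayeredGraph.views (glue H ω (Function.update a i g) b)),
      ⟨Player.alice.after n, LayeredGraph.views g _⟩)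
  let val : LayeredGraph B t' → ℝ := fun g => F (state H ω π (Function.update a i g) b)
  have hkey : Function.FactorsThrough val key := by
    intro g g' h
    obtain ⟨h1, h2⟩ := Prod.mk.inj h
    have h2 := eq_of_heq (Sigma.mk.inj h2).2
    simp only [val]
    congr 1
    rw [state_eq_iff]
    refine ⟨h1, fun j => ?_, fun _ => rfl⟩
    by_cases hj : j = i
    · subst hj; simpa using h2
    · simp [hj]
  -- The state is a function of the transcript and the last speaker's view of this block.
  -- `Function.extend` turns this into an output rule; the default 0 never occurs in a run.
  let ρ : List Bool → (p : Player) → View B t' p → ℝ := fun l p v =>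
    Function.extend key val 0 (l, ⟨p, v⟩)
  have hrun : ∀ g, (Protocol.chop ρ (π.comap e)).run (LayeredGraph.views g) = val g := by
    intro g
    rw [Protocol.run_chop, Protocol.pre_comap, he g]
    exact hkey.extend_apply 0 g
  have := hyp (Protocol.chop ρ (π.comap e))
    (fun G => by
      refine (Protocol.bits_chop_le _ _ _).trans ?_
      rw [Protocol.bits_comap, he G]
      exact hπ _)
    (fun G => by rw [hrun]; exact hF _) M M'
  simpa only [hrun] using this

theorem expect_fibre_inv (ht : ∀ i ≤ B, t' (B - i) = t' i) (M : Equiv.Perm (Fin N))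
    (f : LayeredGraph B t' → ℝ) :
    𝔼 g ∈ members (fibre B t' M⁻¹), f (reverse ht g) = 𝔼 g ∈ members (fibre B t' M), f g := by
  refine expect_nbij' (reverse ht) (reverse ht) (fun g hg => ?_) (fun g hg => ?_)
    (fun g _ => reverse_reverse ht g) (fun g _ => reverse_reverse ht g) fun _ _ => rfl
  · have := reverse_mem_fibre ht (mem_members.1 hg)
    rw [inv_inv] at this
    exact mem_members.2 this
  · exact mem_members.2 (reverse_mem_fibre ht (mem_members.1 hg))

/-- The mean of any function of the state changes by at most `δ` when the permutation of one odd
block is changed. -/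
theorem abs_expect_state_odd_le (H : Layout K B k lo t t') (hlo : Even lo)
    (ht : ∀ i ≤ B, t' (B - i) = t' i) (hB : Even B)
    (ω : Outer K B k lo t) (π : Protocol (View K t) O .alice (n + 1 + 1))
    (hπ : ∀ G, π.bits (LayeredGraph.views G) ≤ C) {δ : ℝ}
    (hyp : ∀ π' : Protocol (View B t') ℝ .alice (n + 1),
      (∀ G, π'.bits (LayeredGraph.views G) ≤ C) → (∀ G, |π'.run (LayeredGraph.views G)| ≤ 1) →
      ∀ M M' : Equiv.Perm (Fin N), |𝔼 g ∈ members (fibre B t' M), π'.run (LayeredGraph.views g) -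
        𝔼 g ∈ members (fibre B t' M'), π'.run (LayeredGraph.views g)| ≤ δ)
    (F : _ → ℝ) (hF : ∀ w, |F w| ≤ 1) (i : Fin k) (a : Fin (k + 1) → LayeredGraph B t')
    (b : Fin k → LayeredGraph B t') (M M' : Equiv.Perm (Fin N)) :
    |𝔼 g ∈ members (fibre B t' M), F (state H ω π a (Function.update b i g)) -
      𝔼 g ∈ members (fibre B t' M'), F (state H ω π a (Function.update b i g))| ≤ δ := by
  have hside : ∀ p, oddSide B p = p := fun p => if_pos hB
  let e : (p : Player) → View B t' p.other → View K t p := fun p v =>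
    LayeredGraph.views
      (glue H ω a (Function.update b i (reverse ht (complete (b i) p.other v)))) p
  have he : ∀ g : LayeredGraph B t', (fun p => e p (LayeredGraph.views g p.other)) =
      LayeredGraph.views (glue H ω a (Function.update b i (reverse ht g))) := by
    intro g
    funext p
    refine views_glue H hlo ω (fun _ => rfl) fun j => ?_
    rw [hside]
    by_cases hj : j = i
    · subst hj
      simp only [Function.update_self]
      exact views_reverse hB ht (views_complete _ _ _)
    · simp [hj]
  -- Reversing a block of even length exchanges the players, so the simulation starts with Bob. The
  -- last round is cut off here, and σ serves only for its transcript.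
  let σ : Protocol (View B t') Unit (Player.alice.other) (n + 1) :=
    Protocol.chop (fun _ _ _ => ()) (π.comapSwap e)
  let key : LayeredGraph B t' → List Bool × Σ p, View B t' p := fun g =>
    (σ.pre (LayeredGraph.views g), ⟨Player.alice.after (n + 1), LayeredGraph.views g _⟩)
  let val : LayeredGraph B t' → ℝ := fun g =>
    F (state H ω π a (Function.update b i (reverse ht g)))
  have hkey : Function.FactorsThrough val key := by
    intro g g' h
    obtain ⟨h1, h2⟩ := Prod.mk.inj h
    have h2 := eq_of_heq (Sigma.mk.inj h2).2
    have h3 := Protocol.pre_congr_of_pre_chop (π.comapSwap e) _ h1 h2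
    rw [Protocol.pre_comapSwap, Protocol.pre_comapSwap, he, he] at h3
    simp only [val]
    congr 1
    rw [state_eq_iff]
    refine ⟨h3, fun _ => rfl, fun j => ?_⟩
    by_cases hj : j = i
    · subst hj
      simp only [Function.update_self]
      rw [hside]
      refine views_reverse hB ht ?_
      rw [Player.other_other]
      exact h2
    · simp [hj]
  let ρ : List Bool → (p : Player) → View B t' p → ℝ := fun l p v =>
    Function.extend key val 0 (l, ⟨p, v⟩)
  -- A silent first round hands the turn to Bob. It is affordable because σ is chopped once more:
  -- the sender of the removed round is the player with the output and can recompute its bits.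
  let π' : Protocol (View B t') ℝ .alice (n + 1) := .endRound (Protocol.chop ρ σ)
  have hrun : ∀ g, π'.run (LayeredGraph.views g) = val g := by
    intro g
    simp only [π', Protocol.run]
    rw [Protocol.run_chop]
    exact hkey.extend_apply 0 g
  have := hyp π'
    (fun G => by
      refine (Protocol.bits_chop_le _ σ ρ).trans ((Protocol.bits_chop_le _ _ _).trans ?_)
      rw [Protocol.bits_comapSwap, he G]
      exact hπ _)
    (fun G => by rw [hrun]; exact hF _) M⁻¹ M'⁻¹
  simp only [hrun, val] at this
  rwa [expect_fibre_inv ht M fun g => F (state H ω π a (Function.update b i g)),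
    expect_fibre_inv ht M' fun g => F (state H ω π a (Function.update b i g))] at this

/-- For a fixed outer part, the mean outcomes of a protocol under two conditions on the chain of the
block permutations are close to each other. -/
theorem chain_protocol_bound {L : ℕ} (H : Layout K B k lo t t') (hlo : Even lo) (hk : 0 < k)
    (hs : s < N)
    (ht : ∀ i ≤ B, t' (B - i) = t' i) (hB : B = 1 ∧ n = 0 ∨ Even B ∧ 0 < n)
    (h₀ : ∀ σ : Equiv.Perm (Fin N), (fibre B t' σ).Nonempty)
    (ω : Outer K B k lo t) (π : Protocol (View K t) O .alice (n + 1))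
    (hπ : ∀ G, π.bits (LayeredGraph.views G) ≤ C) {δ : ℝ} (hδ : 0 ≤ δ)
    (hyp : ∀ π' : Protocol (View B t') ℝ .alice n,
      (∀ G, π'.bits (LayeredGraph.views G) ≤ C) → (∀ G, |π'.run (LayeredGraph.views G)| ≤ 1) →
      ∀ M M' : Equiv.Perm (Fin N), |𝔼 g ∈ members (fibre B t' M), π'.run (LayeredGraph.views g) -
        𝔼 g ∈ members (fibre B t' M'), π'.run (LayeredGraph.views g)| ≤ δ)
    (h : O → ℝ) (hh : ∀ o, |h o| ≤ 1) (x y x₂ y₂ : Fin s ↪ Fin N) :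
    ∑ Ma, ∑ Mb, chainWeight x y Ma Mb *
        (𝔼 a ∈ Fintype.piFinset fun i => members (fibre B t' (Ma i)),
          𝔼 b ∈ Fintype.piFinset fun i => members (fibre B t' (Mb i)),
            h (π.run (LayeredGraph.views (glue H ω a b)))) -
      ∑ Ma, ∑ Mb, chainWeight x₂ y₂ Ma Mb *
        (𝔼 a ∈ Fintype.piFinset fun i => members (fibre B t' (Ma i)),
          𝔼 b ∈ Fintype.piFinset fun i => members (fibre B t' (Mb i)),
            h (π.run (LayeredGraph.views (glue H ω a b)))) ≤
      2 * ((2 * k + 1) * δ) + 2 * (s * (√N * (√(((L + k) / (k * ((N : ℝ) - s))) ^ k) +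
        √(2 ^ C * (4 ^ k / 2 ^ L))))) := by
  have hne : ∀ σ : Equiv.Perm (Fin N), (members (fibre B t' σ)).Nonempty := fun σ =>
    (h₀ σ).imp fun _ => mem_members.2
  have main := decoupling_bound (fun σ : Equiv.Perm (Fin N) => members (fibre B t' σ)) hne
    (state H ω π)
    (fun a b (i : Fin C) => π.lastMsg (LayeredGraph.views (glue H ω a b)) i)
    (fun a b => h (π.run (LayeredGraph.views (glue H ω a b)))) (fun _ _ => hh _)
    (fun a b a' b' h => state_rectangle H hlo h)
    (fun a a' b h => by
      rw [state_eq_iff] at h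
      funext i
      rw [Protocol.lastMsg_congr π h.1 (views_glue H hlo ω h.2.1 fun _ => rfl)])
    (fun a b b' h hm => by
      rw [state_eq_iff] at h
      congr 1
      refine Protocol.run_congr π C h.1 ?_ (fun i hi => congrFun hm ⟨i, hi⟩) (hπ _) (hπ _)
      rw [Player.after_succ]
      exact views_glue H hlo ω (fun _ => rfl) h.2.2)
    hδ
    (fun F hF i a b M M' => abs_expect_state_even_le H hlo ω π hπ hyp F hF i a b M M')
    (fun F hF i a b M M' => by
      rcases hB with ⟨rfl, rfl⟩ | ⟨hB, hn⟩
      -- Here a block is a single edge set and nothing has been sent. The player who computes the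
      -- output owns no odd block, so the state ignores the odd blocks.
      · have hc : ∀ g g', state H ω π a (Function.update b i g) =
            state H ω π a (Function.update b i g') := by
          intro g g'
          rw [state_eq_iff]
          refine ⟨by rw [Protocol.pre_one, Protocol.pre_one], fun _ => rfl, fun j => ?_⟩
          rw [views_eq_iff]
          intro l hl ho
          obtain rfl : l = 0 := by omega
          simp [oddSide, owner, Player.after, Player.other] at ho
        have hc' : ∀ M : Equiv.Perm (Fin N), 𝔼 g ∈ members (fibre 1 t' M),
            F (state H ω π a (Function.update b i g)) = F (state H ω π a b) := by
          intro M
          rw [← expect_const (hne M) (F (state H ω π a b))]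
          refine expect_congr rfl fun g _ => ?_
          rw [hc g (b i), Function.update_eq_self]
        rw [hc', hc', sub_self, abs_zero]
        exact hδ
      · obtain ⟨n, rfl⟩ : ∃ m, n = m + 1 := ⟨n - 1, by omega⟩
        exact abs_expect_state_odd_le H hlo ht hB ω π hπ hyp F hF i a b M M')
    (chainWeight x y) (chainWeight x₂ y₂) (chainWeight_nonneg x y) (chainWeight_nonneg x₂ y₂)
    (sum_chainWeight x y) (sum_chainWeight x₂ y₂)
    -- Both conditions are compared with the unconditioned chain, hence the factor 2.
    (γ := 2 * (s * (√N * (√(((L + k) / (k * ((N : ℝ) - s))) ^ k) +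
        √(2 ^ C * (4 ^ k / 2 ^ L))))))
    (fun κ η hκ hκ1 hη => by
      rw [sum_chainWeight_mul, sum_chainWeight_mul]
      have h1 := abs_le.1 (chain_message_bound (L := L) hk hs x y κ η hκ hκ1 hη)
      have h2 := abs_le.1 (chain_message_bound (L := L) hk hs x₂ y₂ κ η hκ hκ1 hη)
      linarith [h1.1, h1.2, h2.1, h2.2])
  refine main.trans (le_of_eq ?_)
  simp only [Fintype.card_fin]
  push_cast
  ring

end Core

/-! ### Total variation distance and test functions -/

section TotalVariation

open Finset BigOperators

theorem sum_mul_ncard_div {X O : Type*} [Finite X] (A : Set X) (r : X → O) (F : Finset O)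
    (v : O → ℝ) [DecidableEq O] :
    ∑ o ∈ F, v o * (({G ∈ A | r G = o}.ncard : ℝ) / A.ncard) =
      𝔼 G ∈ members A, if r G ∈ F then v (r G) else 0 := by
  rw [expect_eq_sum_div_card, card_members]
  simp_rw [← mul_div_assoc]
  rw [← sum_div]
  congr 1
  have h1 : ∀ o, (({G ∈ A | r G = o}.ncard : ℕ) : ℝ) =
      ∑ G ∈ members A, if r G = o then 1 else 0 := by
    intro o
    rw [← card_members, sum_boole]
    congr 2
    ext G
    simp [mem_members]
  simp_rw [h1, mul_sum]
  rw [sum_comm]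
  refine sum_congr rfl fun G _ => ?_
  simp only [mul_ite, mul_one, mul_zero]
  rw [sum_ite_eq]

variable {side : Side} {s c n : ℕ} {S : Fin (n + 1) → ℕ} {O : Type} {r : ℕ}

theorem ncard_div_nonneg_le_one {X : Type*} [Finite X] (A : Set X) (p : X → Prop) :
    0 ≤ (({G ∈ A | p G}.ncard : ℝ) / A.ncard) ∧ (({G ∈ A | p G}.ncard : ℝ) / A.ncard) ≤ 1 := by
  refine ⟨by positivity, div_le_one_of_le₀ ?_ (by positivity)⟩
  exact_mod_cast Set.ncard_le_ncard (Set.sep_subset _ _) (Set.toFinite _)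

/-- The total variation distance is controlled by bounded test functions applied to the outputs of
the deterministic protocols. -/
theorem tvd_outputProb_le (P : RandProtocol side s c S O r) (Y Z : Fin s ↪ Fin (S 0)) {Δ : ℝ}
    (hP : ∀ π ∈ P.support, ∀ h : O → ℝ, (∀ o, |h o| ≤ 1) →
      𝔼 G ∈ members (blockGraphs side s c S Y), h (π.run (LayeredGraph.views G)) -
        𝔼 G ∈ members (blockGraphs side s c S Z), h (π.run (LayeredGraph.views G)) ≤ 2 * Δ) :
    tvd (outputProb P Y) (outputProb P Z) ≤ Δ := by
  classical
  have hsum : Summable fun π => (P π).toReal := ENNReal.summable_toReal P.tsum_coe_ne_top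
  have hone : ∑' π, (P π).toReal = 1 := by
    rw [← ENNReal.tsum_toReal_eq fun π => P.apply_ne_top π, P.tsum_coe, ENNReal.toReal_one]
  let q : (Fin s ↪ Fin (S 0)) → O → BlockProtocol side s c S O r → ℝ := fun Z o π =>
    ({G ∈ blockGraphs side s c S Z | π.run (LayeredGraph.views G) = o}.ncard : ℝ) /
      (blockGraphs side s c S Z).ncard
  have hq : ∀ Z o, Summable fun π => (P π).toReal * q Z o π := by
    intro Z o
    refine Summable.of_nonneg_of_le (fun π => ?_) (fun π => ?_) hsum
    · exact mul_nonneg ENNReal.toReal_nonneg (ncard_div_nonneg_le_one _ _).1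
    · exact mul_le_of_le_one_right ENNReal.toReal_nonneg (ncard_div_nonneg_le_one _ _).2
  have hfin : ∀ F : Finset O, ∑ o ∈ F, |outputProb P Y o - outputProb P Z o| ≤ 2 * Δ := by
    intro F
    -- The sign is the extremal test function. Cutting it off outside the finite set `F` avoids
    -- infinite sums over outputs.
    let v : O → ℝ := fun o => SignType.sign (outputProb P Y o - outputProb P Z o)
    have hv : ∀ o, |v o| ≤ 1 := by
      intro o
      simp only [v]
      cases SignType.sign (outputProb P Y o - outputProb P Z o) <;> simp
    have e1 : ∀ o, |outputProb P Y o - outputProb P Z o| =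
        ∑' π, (P π).toReal * (v o * q Y o π - v o * q Z o π) := by
      intro o
      rw [← sign_mul_self]
      change v o * (outputProb P Y o - outputProb P Z o) = _
      have : outputProb P Y o - outputProb P Z o =
          ∑' π, ((P π).toReal * q Y o π - (P π).toReal * q Z o π) :=
        ((hq Y o).tsum_sub (hq Z o)).symm
      rw [this, ← tsum_mul_left]
      congr 1
      funext π
      ring
    have hs1 : ∀ o, Summable fun π => (P π).toReal * (v o * q Y o π - v o * q Z o π) := by
      intro o
      refine (((hq Y o).sub (hq Z o)).mul_left (v o)).congr fun π => ?_
      ring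
    rw [sum_congr rfl fun o _ => e1 o, ← Summable.tsum_finsetSum fun o _ => hs1 o]
    have hle : ∀ π, ∑ o ∈ F, (P π).toReal * (v o * q Y o π - v o * q Z o π) ≤
        (P π).toReal * (2 * Δ) := by
      intro π
      rw [← mul_sum]
      by_cases hπ : π ∈ P.support
      · refine mul_le_mul_of_nonneg_left ?_ ENNReal.toReal_nonneg
        rw [sum_sub_distrib, sum_mul_ncard_div, sum_mul_ncard_div]
        refine hP π hπ (fun o => if o ∈ F then v o else 0) fun o => ?_
        split_ifs
        · exact hv o
        · simp
      · have : P π = 0 := by simpa [PMF.mem_support_iff] using hπ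
        simp [this]
    calc _ ≤ ∑' π, (P π).toReal * (2 * Δ) :=
          Summable.tsum_le_tsum hle (summable_sum fun o _ => hs1 o) (hsum.mul_right _)
      _ = 2 * Δ := by rw [tsum_mul_right, hone, one_mul]
  rw [tvd]
  have := Real.tsum_le_of_sum_le (fun o => abs_nonneg (outputProb P Y o - outputProb P Z o)) hfin
  linarith

/-- The difference of the mean outputs of a deterministic protocol with bounded outputs is
controlled by the total variation distance. -/
theorem abs_expect_run_sub_le (π : BlockProtocol side s c S ℝ r)
    (hπ : ∀ G, |π.run (LayeredGraph.views G)| ≤ 1) (Y Z : Fin s ↪ Fin (S 0)) :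
    |𝔼 G ∈ members (blockGraphs side s c S Y), π.run (LayeredGraph.views G) -
      𝔼 G ∈ members (blockGraphs side s c S Z), π.run (LayeredGraph.views G)| ≤
      2 * tvd (outputProb (PMF.pure π) Y) (outputProb (PMF.pure π) Z) := by
  classical
  have hpure : ∀ (Z : Fin s ↪ Fin (S 0)) (o : ℝ), outputProb (PMF.pure π) Z o =
      ({G ∈ blockGraphs side s c S Z | π.run (LayeredGraph.views G) = o}.ncard : ℝ) /
        (blockGraphs side s c S Z).ncard := by
    intro Z o
    rw [outputProb, tsum_eq_single π]
    · simp
    · intro π' h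
      simp [PMF.pure_apply, h]
  -- There are finitely many inputs, so only finitely many real outputs occur.
  let V : Finset ℝ := (members (Set.univ : Set (BlockGraph side s c S))).image
    fun G => π.run (LayeredGraph.views G)
  have hV : ∀ G : BlockGraph side s c S, π.run (LayeredGraph.views G) ∈ V := fun G =>
    mem_image_of_mem _ (mem_members.2 (Set.mem_univ G))
  have hmean : ∀ Z : Fin s ↪ Fin (S 0),
      𝔼 G ∈ members (blockGraphs side s c S Z), π.run (LayeredGraph.views G) =
      ∑ o ∈ V, o * outputProb (PMF.pure π) Z o := by
    intro Z
    simp_rw [hpure]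
    rw [sum_mul_ncard_div _ _ V fun o => o]
    simp [hV]
  have hzero : ∀ (Z : Fin s ↪ Fin (S 0)), ∀ o ∉ V, outputProb (PMF.pure π) Z o = 0 := by
    intro Z o ho
    rw [hpure]
    have : {G ∈ blockGraphs side s c S Z | π.run (LayeredGraph.views G) = o} = ∅ := by
      ext G
      simp only [Set.mem_ofPred_eq, Set.mem_empty_iff_false, iff_false, not_and]
      rintro _ rfl
      exact ho (hV G)
    rw [this]
    simp
  have htvd : 2 * tvd (outputProb (PMF.pure π) Y) (outputProb (PMF.pure π) Z) =
      ∑ o ∈ V, |outputProb (PMF.pure π) Y o - outputProb (PMF.pure π) Z o| := by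
    rw [tvd, tsum_eq_sum (s := V)]
    · ring
    · intro o ho
      rw [hzero Y o ho, hzero Z o ho]
      simp
  rw [hmean, hmean, htvd, ← sum_sub_distrib]
  refine (abs_sum_le_sum_abs _ _).trans (sum_le_sum fun o ho => ?_)
  rw [← mul_sub, abs_mul]
  obtain ⟨G, _, rfl⟩ := mem_image.1 ho
  exact mul_le_of_le_one_left (abs_nonneg _) (hπ G)

end TotalVariation

/-! ### Almost nested block graphs and the induction step -/

section Main

open Finset BigOperators

variable {n c s : ℕ}

theorem almostNest_left_self (hc : 0 < c) (S : Fin (n + 1) → ℕ) (m : ℕ) :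
    almostNest .left (S 0) c S m = nest c S m := by
  rw [almostNest]
  split_ifs with h
  · rw [h, nest_of_dvd hc S (dvd_zero _)]
  · rfl

/-- The starting vertices of the prescribed paths. -/
def source {N : ℕ} : Side → (Fin s ↪ Fin N) → Fin s → ℕ
  | .left, _, u => u
  | .right, Z, u => Z u

/-- The end vertices of the prescribed paths. -/
def target {N : ℕ} : Side → (Fin s ↪ Fin N) → Fin s → ℕ
  | .left, Z, u => Z u
  | .right, _, u => u

theorem source_injective {N : ℕ} (side : Side) (Z : Fin s ↪ Fin N) :
    Function.Injective (source side Z) := by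
  cases side
  · exact Fin.val_injective
  · exact Fin.val_injective.comp Z.injective

theorem target_injective {N : ℕ} (side : Side) (Z : Fin s ↪ Fin N) :
    Function.Injective (target side Z) := by
  cases side
  · exact Fin.val_injective.comp Z.injective
  · exact Fin.val_injective

theorem blockGraphs_eq_joined (side : Side) (S : Fin (n + 1) → ℕ) (Z : Fin s ↪ Fin (S 0)) :
    blockGraphs side s c S Z =
      joined (nestLen c n) (almostNest side s c S) (source side Z) (target side Z) := by
  ext G
  cases side <;>
  simp only [blockGraphs, joined, FinalIs, Set.mem_ofPred_eq, LayeredGraph.nice_iff,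
    LayeredGraph.joins_iff, source, target]

/-- If the modified size equals the original one, nothing is modified and an injection is a
permutation. In this case the hypothesis of the theorem is a statement about fibres. -/
theorem blockGraphs_eq_fibre (hc : 0 < c) (S : Fin (n + 1) → ℕ) (σ : Equiv.Perm (Fin (S 0))) :
    blockGraphs .left (S 0) c S σ.toEmbedding =
      fibre (nestLen c n) (almostNest .left (S 0) c S) σ := by
  rw [blockGraphs_eq_joined]
  ext G
  refine and_congr_right fun _ => ?_
  simp only [source, target]
  constructor
  · intro h
    ext x y
    rw [upPerm_eq_some]
    constructor
    · intro hxy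
      have hx := (walk_lt (fun j _ _ => LayeredGraph.supported G j) hxy).1
      rw [almostNest_left_self hc, nest_of_dvd hc S (dvd_zero _)] at hx
      refine ⟨hx, ?_⟩
      have := h ⟨x, hx⟩
      rw [hxy, Option.some.injEq] at this
      exact this.symm
    · rintro ⟨hx, rfl⟩
      exact h ⟨x, hx⟩
  · intro h u
    rw [h]
    exact upPerm_eq_some.2 ⟨u.2, rfl⟩

theorem almostNest_eq_nest_tail (hc : 0 < c) (side : Side) (S : Fin (n + 2) → ℕ) {m : ℕ}
    (h0 : 0 < m) (h1 : m < nestLen c (n + 1)) :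
    almostNest side s c S m = nest c (Fin.tail S) m := by
  have h2 : nest c S m = nest c (Fin.tail S) m := by
    rw [nest_succ hc]
    exact if_neg (Nat.not_dvd_of_pos_of_lt h0 h1)
  cases side
  · rw [almostNest, if_neg h0.ne', h2]
  · rw [almostNest, if_neg h1.ne, h2]

theorem almostNest_zero_end (hc : 0 < c) (side : Side) (S : Fin (n + 2) → ℕ) :
    almostNest side s c S 0 = (match side with | .left => s | .right => S 0) ∧
    almostNest side s c S (nestLen c (n + 1)) = (match side with | .left => S 0 | .right => s) := by
  have hK : nestLen c (n + 1) ≠ 0 := (Nat.pow_pos (by omega)).ne'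
  cases side <;> refine ⟨?_, ?_⟩ <;> simp only [almostNest]
  · rfl
  · rw [if_neg hK]; exact nest_of_dvd hc S dvd_rfl
  · rw [if_neg hK.symm, nest_of_dvd hc S (dvd_zero _)]
  · simp

/-- An almost nested block graph contains many consecutive nested block graphs of lower depth. -/
theorem cut_almostNest (hc : 0 < c) (side : Side) {S : Fin (n + 2) → ℕ} (hS : StrictMono S)
    (hs : s ≤ S 0) {k : ℕ} (hk : 2 * k + 3 < 2 * c) :
    Cut (nestLen c (n + 1)) (nestLen c n) k (2 * nestLen c n) (S 1) (almostNest side s c S)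
      (almostNest .left (S 1) c (Fin.tail S)) := by
  have hB : 0 < nestLen c n := Nat.pow_pos (by omega)
  have hK : nestLen c (n + 1) = 2 * c * nestLen c n := by rw [nestLen, nestLen, pow_succ, mul_comm]
  have ht' : ∀ m, almostNest .left (S 1) c (Fin.tail S) m = nest c (Fin.tail S) m :=
    almostNest_left_self hc (Fin.tail S)
  have htail : StrictMono (Fin.tail S) := fun i j h => hS (Fin.succ_lt_succ_iff.2 h)
  have h01 : S 0 < S 1 := hS (by simp)
  -- Of the 2c blocks two are left out before the chosen ones and at least one after them. Leaving
  -- out two makes the starting layer even also for blocks of length 1, so that the even blocks keep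
  -- the original owners.
  have hlt : 2 * nestLen c n + (2 * k + 1) * nestLen c n < nestLen c (n + 1) := by
    rw [hK, ← Nat.add_mul]
    exact Nat.mul_lt_mul_of_pos_right (by omega) hB
  obtain ⟨e0, e1⟩ := almostNest_zero_end (s := s) hc side S
  refine ⟨⟨hB, hlt.le, fun q hq r hr => ?_⟩, ?_, ?_, by omega, hlt, fun j hj hj' => ?_, ?_, ?_⟩
  · have h1 : (q + 1) * nestLen c n ≤ (2 * k + 1) * nestLen c n := Nat.mul_le_mul_right _ (by omega)
    rw [Nat.add_mul] at h1
    rw [almostNest_eq_nest_tail hc side S (by omega) (by omega), ht', ← Nat.add_mul]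
    exact nest_periodic hc (Fin.tail S) r (Dvd.intro_left _ rfl)
  · rw [ht', nest_of_dvd hc (Fin.tail S) (dvd_zero _)]; rfl
  · rw [ht']; exact nest_of_dvd hc (Fin.tail S) dvd_rfl
  · rw [almostNest_eq_nest_tail hc side S hj hj']
    exact le_nest hc htail j
  · rw [e0]; cases side <;> simp only <;> omega
  · rw [e1]; cases side <;> simp only <;> omega

/-- One more level of nesting and one more round: indistinguishability of the end-to-end matchings
is inherited from the nested block graphs of lower depth. -/
theorem tvd_outputProb_le_of_tail {n : ℕ} (S : Fin (n + 2) → ℕ) (hS : StrictMono S) (hpos : ∀ i, 0 < S i)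
    (c C : ℕ) (hc : 0 < c) (hC : 0 < C) (ε₀ : ℝ) (hε₀ : 0 < ε₀)
    (h : ∀ (side : Side) (s : ℕ), 0 < s → s ≤ S 1 → ∀ (Y' N' : Fin s ↪ Fin (S 1)) (O : Type)
      (P' : RandProtocol side s c (Fin.tail S) O n), CostAtMost P' C →
        tvd (outputProb P' Y') (outputProb P' N') ≤ ε₀) :
    ∀ (side : Side) (s : ℕ), 0 < s → s ≤ S 0 → ∀ (Y N : Fin s ↪ Fin (S 0)) (O : Type)
      (P : RandProtocol side s c S O (n + 1)), CostAtMost P C →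
        tvd (outputProb P Y) (outputProb P N) ≤ 2 * c * ε₀ + Phi s c (S 1) C := by
  intro side s hs0 hs Y N O P hP
  have h01 : S 0 < S 1 := hS (by simp)
  have hsN : s < S 1 := by omega
  have hΦ : 0 ≤ Phi s c (S 1) C := by
    have : (s : ℝ) < S 1 := by exact_mod_cast hsN
    have : 0 ≤ 40 * (C : ℝ) / ((S 1 : ℝ) - s) := div_nonneg (by positivity) (by linarith)
    unfold Phi
    positivity
  refine tvd_outputProb_le P Y N fun π hπ φ hφ => ?_
  -- In this case Φ ≥ 1, and two means of a function bounded by 1 differ by at most 2.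
  by_cases hsmall : c ≤ 12 ∨ (S 1 : ℝ) - s ≤ 40 * C
  · have h1 := one_le_Phi hsN hC hsmall
    have hle : ∀ Z : Fin s ↪ Fin (S 0), |𝔼 G ∈ members (blockGraphs side s c S Z),
        φ (π.run (LayeredGraph.views G))| ≤ 1 := by
      intro Z
      refine (abs_expect_le _ _).trans ?_
      rcases (members (blockGraphs side s c S Z)).eq_empty_or_nonempty with h0 | h0
      · rw [h0]; simp
      · exact expect_le h0 fun _ _ => hφ _
    have h2 := abs_le.1 (hle Y)
    have h3 := abs_le.1 (hle N)
    have h4 : 0 ≤ 2 * (c : ℝ) * ε₀ := by positivity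
    linarith [h2.2, h3.1]
  push Not at hsmall
  obtain ⟨hc12, hbig⟩ := hsmall
  -- The loss over 2k + 1 blocks must stay within 2cε₀, so 2k + 1 ≤ c; the decay needs many blocks,
  -- and c ≤ 2k + 2 suffices. As c ≥ 13, k is at least 6.
  set k := (c - 1) / 2 with hk
  have hcut := cut_almostNest (k := k) hc side hS hs (by omega)
  obtain ⟨L, hL⟩ := message_bound_le_Phi (c := c) (k := k) hsN hC (by omega) (by omega) hbig.le
  have hkc : (2 * k + 1 : ℝ) ≤ c := by exact_mod_cast (by omega : 2 * k + 1 ≤ c)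
  have htail : StrictMono (Fin.tail S) := fun i j h => hS (Fin.succ_lt_succ_iff.2 h)
  have ht' : ∀ m, almostNest .left (S 1) c (Fin.tail S) m = nest c (Fin.tail S) m :=
    almostNest_left_self hc (Fin.tail S)
  have hrefl : ∀ i ≤ nestLen c n, almostNest .left (S 1) c (Fin.tail S) (nestLen c n - i) =
      almostNest .left (S 1) c (Fin.tail S) i := by
    intro i hi
    rw [ht', ht']
    refine nest_reflect hc (Fin.tail S) ?_
    rw [Nat.sub_add_cancel hi]
    exact dvd_rfl
  have hge : ∀ j ≤ nestLen c n, S 1 ≤ almostNest .left (S 1) c (Fin.tail S) j := fun j _ => by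
    rw [ht']; exact le_nest hc htail j
  have hpar : nestLen c n = 1 ∧ n = 0 ∨ Even (nestLen c n) ∧ 0 < n := by
    rcases Nat.eq_zero_or_pos n with rfl | h0
    · exact Or.inl ⟨rfl, rfl⟩
    · refine Or.inr ⟨?_, h0⟩
      rw [nestLen]
      exact Even.pow_of_ne_zero (even_two_mul c) h0.ne'
  obtain ⟨e0, e1⟩ := almostNest_zero_end (s := s) hc side S
  have hsrc : ∀ (Z : Fin s ↪ Fin (S 0)) u, source side Z u < almostNest side s c S 0 := by
    intro Z u
    rw [e0]
    cases side
    · exact u.2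
    · exact (Z u).2
  have htgt : ∀ (Z : Fin s ↪ Fin (S 0)) u,
      target side Z u < almostNest side s c S (nestLen c (n + 1)) := by
    intro Z u
    rw [e1]
    cases side
    · exact (Z u).2
    · exact u.2
  have hmin : s = min (almostNest side s c S 0) (almostNest side s c S (nestLen c (n + 1))) := by
    rw [e0, e1]
    cases side
    · exact (min_eq_left hs).symm
    · exact (min_eq_right hs).symm
  -- The inner 2ε₀ is the hypothesis in terms of test functions, the 2 before it the use of
  -- decoupling for both matchings; the right side is doubled because the conclusion is also tested
  -- by functions.
  have hbd : 2 * ((2 * k + 1) * (2 * ε₀)) + 2 * (s * (√(S 1) *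
      (√((((L : ℝ) + k) / (k * ((S 1 : ℝ) - s))) ^ k) + √(2 ^ C * (4 ^ k / 2 ^ L))))) ≤
      2 * (2 * c * ε₀ + Phi s c (S 1) C) := by
    have := mul_le_mul_of_nonneg_right hkc hε₀.le
    linarith
  rw [blockGraphs_eq_joined, blockGraphs_eq_joined]
  by_cases h₀ : ∀ σ : Equiv.Perm (Fin (S 1)),
      (fibre (nestLen c n) (almostNest .left (S 1) c (Fin.tail S)) σ).Nonempty
  · refine expect_joined_sub_le hcut (source_injective side Y) (target_injective side Y) (hsrc Y)
      (htgt Y) (source_injective side N) (target_injective side N) (hsrc N) (htgt N) hmin hge h₀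
      (fun G => φ (π.run (LayeredGraph.views G))) (by positivity) fun ω x y x₂ y₂ => ?_
    refine le_trans (chain_protocol_bound (L := L) hcut.toLayout (even_two_mul _) (by omega) hsN
      hrefl hpar h₀ ω π (hP π hπ) (δ := 2 * ε₀) (by positivity) ?_ φ hφ x y x₂ y₂) hbd
    intro π' hbits hrun M M'
    have h1 := abs_expect_run_sub_le (side := .left) (c := c) (S := Fin.tail S) π' hrun
      M.toEmbedding M'.toEmbedding
    have h2 := h .left (S 1) (hpos 1) le_rfl M.toEmbedding M'.toEmbedding ℝ (PMF.pure π')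
      (fun π'' hπ'' G => by
        rw [PMF.mem_support_pure_iff] at hπ''
        rw [hπ'']
        exact hbits G)
    have h3 : ∀ M : Equiv.Perm (Fin (S 1)), blockGraphs .left (S 1) c (Fin.tail S) M.toEmbedding =
        fibre (nestLen c n) (almostNest .left (S 1) c (Fin.tail S)) M :=
      blockGraphs_eq_fibre hc (Fin.tail S)
    rw [h3, h3] at h1
    exact h1.trans (mul_le_mul_of_nonneg_left h2 (by norm_num))
  -- If a fibre is empty, all are, and no graph joins the prescribed vertices. Both means are then 0
  -- by convention.
  · have hempty : ∀ Z : Fin s ↪ Fin (S 0), members (joined (nestLen c (n + 1))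
        (almostNest side s c S) (source side Z) (target side Z)) = ∅ := fun Z =>
      eq_empty_of_forall_notMem fun G hG =>
        h₀ (nonempty_fibre_of_mem_joined hcut hge (mem_members.1 hG))
    rw [hempty, hempty, expect_empty, sub_zero]
    positivity

end Main

end FinalMatching

theorem lemma3p3 {n : ℕ} (S : Fin (n + 2) → ℕ) (hS : StrictMono S) (hpos : ∀ i, 0 < S i)
    (c C : ℕ) (hc : 0 < c) (hC : 0 < C) (ε₀ : ℝ) (hε₀ : 0 < ε₀)
    (h : ∀ (side : Side) (s : ℕ), 0 < s → s ≤ S 1 → ∀ (Y' N' : Fin s ↪ Fin (S 1)) (O : Type)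
      (P' : RandProtocol side s c (Fin.tail S) O n), CostAtMost P' C →
        tvd (outputProb P' Y') (outputProb P' N') ≤ ε₀) :
    ∀ (side : Side) (s : ℕ), 0 < s → s ≤ S 0 → ∀ (Y N : Fin s ↪ Fin (S 0)) (O : Type)
      (P : RandProtocol side s c S O (n + 1)), CostAtMost P C →
        tvd (outputProb P Y) (outputProb P N) ≤ 2 * c * ε₀ + Phi s c (S 1) C :=
  tvd_outputProb_le_of_tail S hS hpos c C hc hC ε₀ hε₀ h
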